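/- **Model.** A deterministic real RAM: a finite structured program over arrays of natural numbers and arrays of real numbers with indirect addressing; natural numbers can be added, subtracted (truncated at $0$) and compared, real numbers can be added, subtracted, negated and compared (no multiplication or division; the only real constant is $0$); each operation, test and memory access takes unit time. **Graphs.** $G=(V,E^+\cup N,w)$ is a finite directed graph with real edge weights (loops and parallel edges allowed), whose edges are partitioned into the nonnegative edges $E^+$, with $w(e)\ge 0$ for all $e\in E^+$, and the "negative" edges $N$, of arbitrary real weight. Let $n=|V|$, $m=|E^+\cup N|\ge 1$, $\hat k=|N|$. For a graph with such a classification, an $h$-hop path is a (not necessarily simple) path on which negative edges occur at most $h$ times; $\mathrm{dist}^h(u,v)$ is the infimum of the weights of $h$-hop $u$-to-$v$ paths, $\mathrm{dist}(u,v)$ the infimum over all $u$-to-$v$ paths, and $\mathrm{dist}^h(S,v)=\min_{u\in S}\mathrm{dist}^h(u,v)$. For an integer $r\ge 1$, the set $N$ is *$r$-remote* if, with $X$ the set of tails of edges in $N$, $|\{v\in V:\mathrm{dist}_G^r(X,v)<0\}|\le n/r$. For a price function $\phi:V\to\mathbb R$ let $w_\phi(u,v)=w(u,v)+\phi(u)-\phi(v)$;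 $\phi$ is valid if $w_\phi\ge 0$ on $E^+$, and eliminates $N$ if $w_\phi\ge 0$ on $N$. **Layered graph.** Let $\delta_j(v)=\mathrm{dist}^j_G(V,v)$ and $R=\{v:\delta_r(v)<0\}$. The graph $H$ has a vertex $v_0$ for every $v\in V$ and vertices $v_1,\dots,v_r$ for every $v\in R$. For every edge $e=(u,v)$ of $G$ and every copy $u_j$ of $u$ (with $j<r$ if $e\in N$), it has one edge from $u_j$ to: $v_0$ if $v\notin R$; $v_j$ if $v\in R$ and $e\in E^+$; $v_{j+1}$ if $v\in R$ and $e\in N$. For every $u\in R$ it also has the self edges $(u_0,u_1),\dots,(u_{r-1},u_r),(u_r,u_0)$. An edge from $u_i$ to $v_j$ has weight $w(u,v)+\delta_i(u)-\delta_j(v)$, where $w$ is the weight of the underlying edge, or $0$ for self edges. The negative edges of $H$ are those of negative weight. **Lemma.** There are a fixed program and a constant $c$ such that for every $D$ there is a constant $C$ with the following property. Let $G$ be as above, with every vertex of out-degree at most $D\,m/n$, and let $r\ge 1$ be an integer such that $N$ is $r$-remote. Given $G$ (as a list of edges in arbitrary order, with classification and weights) and $r$, the program halts within time $$C\,g\,\log^{c}(g+2),\qquad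 g=\frac{\hat k}{r}\,m+r\,m$$ (that is, $\tilde O((\hat k/r)m+rm)$), and either (1) correctly reports that $G$ contains a negative-weight cycle, or (2) returns a valid price function that eliminates all edges of $N$. Moreover, $H$ is an $r$-hop reduction of $G$: for all $h\ge 0$ and $u,v\in V$, $$\mathrm{dist}_G^{h}(u,v)\ \ge\ \mathrm{dist}_H^{\lceil h/r\rceil}(u_0,v_0)\ \ge\ \mathrm{dist}_G(u,v);$$ $|V_H|+|E_H|\le C\,m$; and the program builds $H$, i.e. when it halts its memory holds an edge list of $H$ with weights and classification, in which $v_0$ has the same number as $v$. -/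

import Mathlib

/-- Weighted directed graphs: `V` is the type of vertices, `E` the type of edges (loops and parallel
edges are allowed), `neg` the set of the edges that are classified as negative edges.  The
classification does not change under reweighting: a negative edge may have any real weight. -/
structure WGraph (V E : Type) where
  src : E → V
  dst : E → V
  wt : E → ℝ
  neg : Set E

namespace WGraph

variable {V E : Type}

/-- The list of edges `p` is a (not necessarily simple) path from `u` to `v`. -/
def IsPath (G : WGraph V E) : V → List E → V → Prop
  | u, [], v => u = v
  | u, e :: p, v => G.src e = u ∧ G.IsPath (G.dst e) p v

/-- The weight of a path. -/
def weight (G : WGraph V E) (p : List E) : ℝ := (p.map G.wt).sum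

open Classical in
/-- The number of occurrences of negative edges on a path. -/
noncomputable def hops (G : WGraph V E) (p : List E) : ℕ := p.countP (fun e => e ∈ G.neg)

/-- The distance from `u` to `v`: `⊤` if there is no path, `⊥` if there are paths of arbitrarily
small weight. -/
noncomputable def dist (G : WGraph V E) (u v : V) : EReal :=
  ⨅ (p : List E) (_ : G.IsPath u p v), (G.weight p : EReal)

/-- The `h`-hop distance from `u` to `v`. -/
noncomputable def hopDist (G : WGraph V E) (h : ℕ) (u v : V) : EReal :=
  ⨅ (p : List E) (_ : G.IsPath u p v ∧ G.hops p ≤ h), (G.weight p : EReal)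

/-- The `h`-hop distance from a set `S` of vertices to `v`. -/
noncomputable def hopDistFrom (G : WGraph V E) (h : ℕ) (S : Set V) (v : V) : EReal :=
  ⨅ u ∈ S, G.hopDist h u v

/-- The negative `h`-hop reach of a set `S` of vertices. -/
def reach (G : WGraph V E) (h : ℕ) (S : Set V) : Set V := {v | G.hopDistFrom h S v < 0}

/-- The negative vertices: the tails of the negative edges. -/
def negVertices (G : WGraph V E) : Set V := G.src '' G.neg

/-- The set of negative edges is `r`-remote: the negative `r`-hop reach of its tails has at most
`n / r` elements, where `n` is the number of vertices. -/
def IsRemote (G : WGraph V E) (r : ℕ) : Prop :=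
  ((G.reach r G.negVertices).ncard : ℝ) ≤ (Nat.card V : ℝ) / r

/-- The number of edges leaving `v`. -/
noncomputable def outDegree (G : WGraph V E) (v : V) : ℕ := {e | G.src e = v}.ncard

/-- There is a closed path of negative weight. -/
def HasNegativeCycle (G : WGraph V E) : Prop :=
  ∃ (u : V) (p : List E), G.IsPath u p u ∧ G.weight p < 0

/-- The graph reweighted by the price function `φ`. -/
def reweight (G : WGraph V E) (φ : V → ℝ) : WGraph V E where
  src := G.src
  dst := G.dst
  wt e := G.wt e + φ (G.src e) - φ (G.dst e)
  neg := G.neg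

/-- `φ` is a valid price function: edges outside `neg` keep a nonnegative weight. -/
def IsValid (G : WGraph V E) (φ : V → ℝ) : Prop := ∀ e, e ∉ G.neg → 0 ≤ (G.reweight φ).wt e

/-- `φ` eliminates all negative edges. -/
def EliminatesAll (G : WGraph V E) (φ : V → ℝ) : Prop := ∀ e ∈ G.neg, 0 ≤ (G.reweight φ).wt e

/-- `H` is an `r`-hop reduction of `G`, where `ι` embeds the vertices of `G` into those of `H`. -/
def IsHopReduction {V' E' : Type} (r : ℕ) (G : WGraph V E) (H : WGraph V' E') (ι : V → V') : Prop :=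
  Function.Injective ι ∧ ∀ (h : ℕ) (u v : V),
    H.hopDist ⌈(h : ℚ) / r⌉₊ (ι u) (ι v) ≤ G.hopDist h u v ∧
    G.dist u v ≤ H.hopDist ⌈(h : ℚ) / r⌉₊ (ι u) (ι v)

/-! ### The layered graph -/

/-- The super-source distance `δ_j(v)`, the `j`-hop distance from the set of all vertices to `v`.
It is at most `0`; it is finite if `G` is finite and the edges outside `neg` have nonnegative
weight. -/
noncomputable def superDist (G : WGraph V E) (j : ℕ) (v : V) : ℝ :=
  (G.hopDistFrom j Set.univ v).toReal

/-- The set `R` of the vertices `v` with `δ_r(v) < 0`; these are the vertices that are copied. -/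
def copied (G : WGraph V E) (r : ℕ) : Set V := G.reach r Set.univ

/-- The vertices `v_j` of the layered graph: `v_0` for every vertex `v`, and `v_1, …, v_r` for
`v ∈ R`. -/
def LVertex (G : WGraph V E) (r : ℕ) : Type :=
  {x : V × ℕ // x.2 ≤ r ∧ (x.1 ∈ G.copied r ∨ x.2 = 0)}

/-- The copy in layer `0` of a vertex. -/
def layerZero (G : WGraph V E) (r : ℕ) (v : V) : G.LVertex r :=
  ⟨(v, 0), Nat.zero_le r, Or.inr rfl⟩

/-- The copies `(e, j)` of the edges `e`, one for every copy `u_j` of the tail `u` of `e`,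
except that negative edges have no copy that leaves layer `r`. -/
def LCopy (G : WGraph V E) (r : ℕ) : Type :=
  {x : E × ℕ // x.2 ≤ r ∧ (G.src x.1 ∈ G.copied r ∨ x.2 = 0) ∧ (x.1 ∈ G.neg → x.2 < r)}

/-- The self edges `(u_0, u_1), …, (u_{r-1}, u_r), (u_r, u_0)` for `u ∈ R`, given by `u` and the
layer that they leave. -/
def LSelf (G : WGraph V E) (r : ℕ) : Type :=
  {x : V × ℕ // x.1 ∈ G.copied r ∧ x.2 ≤ r}

open Classical in
/-- The head of the copy of the edge `e = (u, v)` that leaves layer `j`: it is `v_0` if `v ∉ R`, and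
for `v ∈ R` it is `v_{j+1}` if `e` is a negative edge and `v_j` otherwise. -/
noncomputable def copyHead (G : WGraph V E) (r : ℕ) (x : G.LCopy r) : G.LVertex r :=
  ⟨(G.dst x.1.1,
      if G.dst x.1.1 ∈ G.copied r then (if x.1.1 ∈ G.neg then x.1.2 + 1 else x.1.2) else 0), by
    obtain ⟨⟨e, j⟩, h1, h2, h3⟩ := x
    dsimp only at h1 h2 h3 ⊢
    split_ifs with hR hN
    · exact ⟨h3 hN, Or.inl hR⟩
    · exact ⟨h1, Or.inl hR⟩
    · exact ⟨Nat.zero_le r, Or.inr rfl⟩⟩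

/-- The head of the self edge that leaves `u_j`: it is `u_{j+1}` for `j < r` and `u_0` for
`j = r`. -/
def selfHead (G : WGraph V E) (r : ℕ) (x : G.LSelf r) : G.LVertex r :=
  ⟨(x.1.1, if x.1.2 < r then x.1.2 + 1 else 0), by
    obtain ⟨⟨u, j⟩, h1, h2⟩ := x
    dsimp only at h1 h2 ⊢
    split_ifs with hj
    · exact ⟨hj, Or.inl h1⟩
    · exact ⟨Nat.zero_le r, Or.inr rfl⟩⟩

/-- The tail of an edge of the layered graph. -/
def lSrc (G : WGraph V E) (r : ℕ) : G.LCopy r ⊕ G.LSelf r → G.LVertex r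
  | Sum.inl x => ⟨(G.src x.1.1, x.1.2), x.2.1, x.2.2.1⟩
  | Sum.inr x => ⟨x.1, x.2.2, Or.inl x.2.1⟩

/-- The head of an edge of the layered graph. -/
noncomputable def lDst (G : WGraph V E) (r : ℕ) : G.LCopy r ⊕ G.LSelf r → G.LVertex r
  | Sum.inl x => G.copyHead r x
  | Sum.inr x => G.selfHead r x

/-- The weight of the underlying edge of `G`, where self edges have weight `0`. -/
def lBase (G : WGraph V E) (r : ℕ) : G.LCopy r ⊕ G.LSelf r → ℝ
  | Sum.inl x => G.wt x.1.1
  | Sum.inr _ => 0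

/-- The weight `w_H(u_i, v_j) = w(u, v) + δ_i(u) - δ_j(v)` of an edge of the layered graph. -/
noncomputable def lWt (G : WGraph V E) (r : ℕ) (x : G.LCopy r ⊕ G.LSelf r) : ℝ :=
  G.lBase r x + G.superDist (G.lSrc r x).1.2 (G.lSrc r x).1.1
    - G.superDist (G.lDst r x).1.2 (G.lDst r x).1.1

/-- The layered graph `H`; its negative edges are the edges of negative weight. -/
noncomputable def layered (G : WGraph V E) (r : ℕ) :
    WGraph (G.LVertex r) (G.LCopy r ⊕ G.LSelf r) where
  src := G.lSrc r
  dst := G.lDst r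
  wt := G.lWt r
  neg := {x | G.lWt r x < 0}

end WGraph

/-! ### The real RAM

A deterministic real RAM, programmed in a structured language.  The memory consists of arrays of
natural numbers and arrays of real numbers.  A program is a finite object and names its arrays by
constants, so it uses a fixed number of arrays; the entries of an array are addressed by computed
natural numbers (indirect addressing).  Natural numbers can be added, subtracted (truncated at `0`)
and compared, real numbers can be added, subtracted, negated and compared.  There is no
multiplication, no division, no rounding, no conversion between the two kinds of numbers, and the
only real constant is `0`.  Every operation, test and memory access takes one unit of time. -/

namespace RealRAM

/-- The memory: entry `i` of the `a`-th array of natural or of real numbers. -/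
structure State where
  ints : ℕ → ℕ → ℕ
  reals : ℕ → ℕ → ℝ

/-- Expressions for natural numbers. -/
inductive IExpr where
  | const (c : ℕ)
  | load (a : ℕ) (i : IExpr)
  | add (x y : IExpr)
  | sub (x y : IExpr)

/-- Expressions for real numbers. -/
inductive RExpr where
  | zero
  | load (a : ℕ) (i : IExpr)
  | add (x y : RExpr)
  | sub (x y : RExpr)
  | neg (x : RExpr)

/-- Tests. -/
inductive BExpr where
  | ilt (x y : IExpr)
  | rlt (x y : RExpr)
  | not (b : BExpr)
  | and (b b' : BExpr)

/-- Programs. -/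
inductive Prog where
  | skip
  | iset (a : ℕ) (i : IExpr) (x : IExpr)
  | rset (a : ℕ) (i : IExpr) (x : RExpr)
  | seq (p q : Prog)
  | ite (b : BExpr) (p q : Prog)
  | loop (b : BExpr) (p : Prog)

def IExpr.eval (s : State) : IExpr → ℕ
  | const c => c
  | load a i => s.ints a (i.eval s)
  | add x y => x.eval s + y.eval s
  | sub x y => x.eval s - y.eval s

def RExpr.eval (s : State) : RExpr → ℝ
  | zero => 0
  | load a i => s.reals a (i.eval s)
  | add x y => x.eval s + y.eval s
  | sub x y => x.eval s - y.eval s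
  | neg x => -x.eval s

def BExpr.Holds (s : State) : BExpr → Prop
  | ilt x y => x.eval s < y.eval s
  | rlt x y => x.eval s < y.eval s
  | not b => ¬ b.Holds s
  | and b b' => b.Holds s ∧ b'.Holds s

/-- The time that the evaluation of an expression takes: the number of its operations. -/
def IExpr.cost : IExpr → ℕ
  | const _ => 1
  | load _ i => i.cost + 1
  | add x y => x.cost + y.cost + 1
  | sub x y => x.cost + y.cost + 1

def RExpr.cost : RExpr → ℕ
  | zero => 1
  | load _ i => i.cost + 1
  | add x y => x.cost + y.cost + 1
  | sub x y => x.cost + y.cost + 1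
  | neg x => x.cost + 1

def BExpr.cost : BExpr → ℕ
  | ilt x y => x.cost + y.cost + 1
  | rlt x y => x.cost + y.cost + 1
  | not b => b.cost + 1
  | and b b' => b.cost + b'.cost + 1

/-- Overwrite entry `i` of the `a`-th array of natural numbers. -/
def State.setInt (s : State) (a i x : ℕ) : State where
  ints := Function.update s.ints a (Function.update (s.ints a) i x)
  reals := s.reals

/-- Overwrite entry `i` of the `a`-th array of real numbers. -/
def State.setReal (s : State) (a i : ℕ) (x : ℝ) : State where
  ints := s.ints
  reals := Function.update s.reals a (Function.update (s.reals a) i x)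

/-- `Run p s t s'`: started in the state `s`, the program `p` halts after exactly `t` units of time
in the state `s'`. -/
inductive Run : Prog → State → ℕ → State → Prop where
  | skip (s : State) : Run Prog.skip s 1 s
  | iset (s : State) (a : ℕ) (i x : IExpr) :
      Run (Prog.iset a i x) s (i.cost + x.cost + 1) (s.setInt a (i.eval s) (x.eval s))
  | rset (s : State) (a : ℕ) (i : IExpr) (x : RExpr) :
      Run (Prog.rset a i x) s (i.cost + x.cost + 1) (s.setReal a (i.eval s) (x.eval s))
  | seq {p q : Prog} {s s' s'' : State} {t t' : ℕ} :
      Run p s t s' → Run q s' t' s'' → Run (Prog.seq p q) s (t + t') s''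
  | ite_true {b : BExpr} {p q : Prog} {s s' : State} {t : ℕ} :
      b.Holds s → Run p s t s' → Run (Prog.ite b p q) s (b.cost + 1 + t) s'
  | ite_false {b : BExpr} {p q : Prog} {s s' : State} {t : ℕ} :
      ¬ b.Holds s → Run q s t s' → Run (Prog.ite b p q) s (b.cost + 1 + t) s'
  | loop_true {b : BExpr} {p : Prog} {s s' s'' : State} {t t' : ℕ} :
      b.Holds s → Run p s t s' → Run (Prog.loop b p) s' t' s'' →
      Run (Prog.loop b p) s (b.cost + 1 + t + t') s''
  | loop_false {b : BExpr} {p : Prog} {s : State} :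
      ¬ b.Holds s → Run (Prog.loop b p) s (b.cost + 1) s

open Classical in
/-- The input: a graph with vertices `0, …, n - 1` as a list of `m` edges in arbitrary order, and
the parameter `r`.  Array `0` of natural numbers holds `n`, `m`, `r`; the arrays `1`, `2`, `3` hold
the tails, the heads and the classification (`1` for negative edges) of the edges; array `0` of
real numbers holds the weights.  All other entries are `0`. -/
noncomputable def inputState {n m : ℕ} (G : WGraph (Fin n) (Fin m)) (r : ℕ) : State where
  ints a i :=
    match a with
    | 0 => if i = 0 then n else if i = 1 then m else if i = 2 then r else 0
    | 1 => if h : i < m then (G.src ⟨i, h⟩ : ℕ) else 0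
    | 2 => if h : i < m then (G.dst ⟨i, h⟩ : ℕ) else 0
    | 3 => if h : i < m then (if (⟨i, h⟩ : Fin m) ∈ G.neg then 1 else 0) else 0
    | _ => 0
  reals a i :=
    match a with
    | 0 => if h : i < m then G.wt ⟨i, h⟩ else 0
    | _ => 0

open Classical in
/-- The graph `H` is stored, as an edge list in the format of the input, in the arrays
`a, …, a + 3` of natural numbers and the array `b` of real numbers; `ν` and `ε` number the vertices
and the edges of `H`. -/
structure Stores {V E : Type} {N M : ℕ} (s : State) (a b : ℕ) (H : WGraph V E)
    (ν : V ≃ Fin N) (ε : E ≃ Fin M) : Prop where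
  vertices : s.ints a 0 = N
  edges : s.ints a 1 = M
  tail (e : E) : s.ints (a + 1) (ε e) = ν (H.src e)
  head (e : E) : s.ints (a + 2) (ε e) = ν (H.dst e)
  flag (e : E) : s.ints (a + 3) (ε e) = if e ∈ H.neg then 1 else 0
  weight (e : E) : s.reals b (ε e) = H.wt e

/-- The verdict of a halted program: `1` means that it reports a negative cycle, `0` that it returns
a price function. -/
def verdict (s : State) : ℕ := s.ints 4 0

/-- The returned price function. -/
def price (s : State) (n : ℕ) : Fin n → ℝ := fun v => s.reals 1 v

end RealRAM

/-- The function `(k/r) m + r m`. -/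
noncomputable def hopReductionCost (k r m : ℕ) : ℝ := (k : ℝ) / r * m + (r : ℝ) * m

/-! The distances `δ_j` act as potentials on the layers. By the triangle inequality every copy of an
edge of `G` becomes nonnegative (`copy_nonneg`), and so does every upward self edge, because `δ_j`
decreases in `j` (`superDist_self_nonneg`). Only the return edges `(u_r, u_0)` can be negative in
`H`. A path of `G` is simulated in `H` by climbing one layer per negative edge and returning to
layer 0 only when layer `r` is exhausted, so one hop of `H` serves `r` hops of `G`
(`exists_simulation`). Conversely, paths of `H` project to `G`, and the potentials telescope and
vanish in layer 0 (`exists_projection`). Together this gives `isHopReduction_layered`.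

A negative path stays negative when the prefix before its first negative edge is dropped, so the
copied set `R` lies in the negative reach of the negative vertices, and `|R| ≤ n / r` by remoteness.
Each copied vertex has at most `D m / n` outgoing edges, so the `r` additional layers contain `O(m)`
vertices and edges in all.

A round relaxes all negative edges once and then runs Dijkstra's algorithm on the others; it turns
`h`-hop into `(h + 1)`-hop super-source distances in time `Õ(m)`. About `r` rounds on `G` tabulate
`δ_0, …, δ_r`, from which `H` is written down. About `|N| / r` rounds on `H` then give labels of the
vertices `v_0`. Without negative cycles `|N|` hops suffice in `G` (`exists_shortcut`), so these
labels are the super-source distances of `G`, and they eliminate every negative edge. The program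
tests all edges: if they pass, the labels are a correct answer; if one fails, there must be a
negative cycle (`solve_spec`).

The correctness of a round avoids paths: the new labels are the greatest function subject to the
inequalities of the round (`RoundRel`), and `eq_superDist_succ` identifies this function. Programs
are verified for total correctness with time bounds: loop-free code is executed symbolically, loops
carry an invariant and a potential, and a syntactic frame rule accounts for the untouched arrays. -/

namespace WGraph

/-! ### Paths, weights and hops -/

section Paths

variable {V E : Type} (G : WGraph V E)

theorem isPath_append (u w : V) (p q : List E) :
    G.IsPath u (p ++ q) w ↔ ∃ v, G.IsPath u p v ∧ G.IsPath v q w := by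
  induction p generalizing u with
  | nil => simp [IsPath]
  | cons e p ih => simp [IsPath, ih, and_assoc]

theorem isPath_singleton (u v : V) (e : E) :
    G.IsPath u [e] v ↔ G.src e = u ∧ G.dst e = v := by
  simp [IsPath]

theorem IsPath.append {u v w : V} {p q : List E} (hp : G.IsPath u p v) (hq : G.IsPath v q w) :
    G.IsPath u (p ++ q) w := (G.isPath_append u w p q).2 ⟨v, hp, hq⟩

@[simp] theorem weight_nil : G.weight [] = 0 := rfl

@[simp] theorem weight_append (p q : List E) : G.weight (p ++ q) = G.weight p + G.weight q := by
  simp [weight]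

@[simp] theorem weight_cons (e : E) (p : List E) : G.weight (e :: p) = G.wt e + G.weight p := by
  simp [weight]

@[simp] theorem hops_nil : G.hops [] = 0 := rfl

@[simp] theorem hops_append (p q : List E) : G.hops (p ++ q) = G.hops p + G.hops q := by
  simp [hops]

open Classical in
theorem hops_cons (e : E) (p : List E) :
    G.hops (e :: p) = (if e ∈ G.neg then 1 else 0) + G.hops p := by
  simp only [hops, List.countP_cons, decide_eq_true_eq]
  split_ifs <;> omega

theorem hops_cons_neg {e : E} (he : e ∈ G.neg) (p : List E) :
    G.hops (e :: p) = 1 + G.hops p := by simp [hops_cons, he]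

theorem hops_cons_not_neg {e : E} (he : e ∉ G.neg) (p : List E) :
    G.hops (e :: p) = G.hops p := by simp [hops_cons, he]

/-- The weight of a path is at least the number of hops times a lower bound for the edges. -/
theorem neg_mul_hops_le_weight (hG : ∀ e, e ∉ G.neg → 0 ≤ G.wt e) {B : ℝ} (hB : ∀ e, -B ≤ G.wt e)
    (p : List E) : -(B * G.hops p) ≤ G.weight p := by
  induction p with
  | nil => simp
  | cons e p ih =>
    by_cases he : e ∈ G.neg
    · rw [hops_cons_neg G he, weight_cons]
      push_cast
      linarith [hB e]
    · rw [hops_cons_not_neg G he, weight_cons]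
      linarith [hG e he]

theorem weight_nonneg_of_hops_eq_zero (hG : ∀ e, e ∉ G.neg → 0 ≤ G.wt e) (p : List E)
    (hp : G.hops p = 0) : 0 ≤ G.weight p := by
  induction p with
  | nil => simp
  | cons e p ih =>
    by_cases he : e ∈ G.neg
    · rw [hops_cons_neg G he] at hp; omega
    · rw [hops_cons_not_neg G he] at hp
      rw [weight_cons]
      exact add_nonneg (hG e he) (ih hp)

theorem hopDistFrom_univ_le {h : ℕ} {u v : V} {p : List E} (hp : G.IsPath u p v)
    (hh : G.hops p ≤ h) : G.hopDistFrom h Set.univ v ≤ (G.weight p : EReal) :=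
  (iInf₂_le u (Set.mem_univ u)).trans (iInf₂_le p ⟨hp, hh⟩)

theorem le_hopDistFrom_univ {h : ℕ} {v : V} {x : EReal}
    (H : ∀ u p, G.IsPath u p v → G.hops p ≤ h → x ≤ (G.weight p : EReal)) :
    x ≤ G.hopDistFrom h Set.univ v :=
  le_iInf₂ fun u _ => le_iInf₂ fun p hp => H u p hp.1 hp.2

theorem hopDistFrom_univ_nonpos (h : ℕ) (v : V) : G.hopDistFrom h Set.univ v ≤ 0 := by
  simpa using G.hopDistFrom_univ_le (h := h) (u := v) (v := v) (p := []) rfl (by simp)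

end Paths

/-! ### Super-source distances -/

section SuperDist

variable {V E : Type} [Finite E] (G : WGraph V E)

theorem exists_bound : ∃ B : ℝ, 0 ≤ B ∧ ∀ e, -B ≤ G.wt e := by
  obtain ⟨B, hB⟩ := (Set.finite_range fun e => -G.wt e).bddAbove
  refine ⟨max B 0, le_max_right _ _, fun e => ?_⟩
  have : -G.wt e ≤ B := hB ⟨e, rfl⟩
  linarith [le_max_left B 0]

variable (hG : ∀ e, e ∉ G.neg → 0 ≤ G.wt e)
include hG

/-- A path with at most `h` negative edges weighs at least `-(B * h)`, so the infimum is not `⊥`;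
the empty path keeps it at most `0`. Passing to real values therefore loses nothing. -/
theorem coe_superDist (h : ℕ) (v : V) :
    (G.superDist h v : EReal) = G.hopDistFrom h Set.univ v := by
  refine EReal.coe_toReal ?_ ?_
  · exact ne_top_of_le_ne_top EReal.zero_ne_top (G.hopDistFrom_univ_nonpos h v)
  · obtain ⟨B, hB0, hB⟩ := G.exists_bound
    have : ((-(B * h) : ℝ) : EReal) ≤ G.hopDistFrom h Set.univ v := by
      refine G.le_hopDistFrom_univ fun u p _ hh => ?_
      refine EReal.coe_le_coe_iff.2 (le_trans ?_ (G.neg_mul_hops_le_weight hG hB p))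
      have : (G.hops p : ℝ) ≤ h := by exact_mod_cast hh
      nlinarith
    intro hbot
    rw [hbot] at this
    exact EReal.coe_ne_bot _ (le_bot_iff.1 this)

theorem superDist_le {h : ℕ} {u v : V} {p : List E} (hp : G.IsPath u p v)
    (hh : G.hops p ≤ h) : G.superDist h v ≤ G.weight p := by
  rw [← EReal.coe_le_coe_iff, G.coe_superDist hG]
  exact G.hopDistFrom_univ_le hp hh

theorem le_superDist {h : ℕ} {v : V} {x : ℝ}
    (H : ∀ u p, G.IsPath u p v → G.hops p ≤ h → x ≤ G.weight p) : x ≤ G.superDist h v := by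
  rw [← EReal.coe_le_coe_iff, G.coe_superDist hG]
  exact G.le_hopDistFrom_univ fun u p hp hh => EReal.coe_le_coe_iff.2 (H u p hp hh)

theorem superDist_nonpos (h : ℕ) (v : V) : G.superDist h v ≤ 0 := by
  simpa using G.superDist_le hG (h := h) (u := v) (v := v) (p := []) rfl (by simp)

theorem superDist_zero (v : V) : G.superDist 0 v = 0 := by
  refine le_antisymm (G.superDist_nonpos hG 0 v) (G.le_superDist hG fun u p _ hh => ?_)
  exact G.weight_nonneg_of_hops_eq_zero hG p (by omega)

theorem superDist_antitone {h h' : ℕ} (hh : h ≤ h') (v : V) :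
    G.superDist h' v ≤ G.superDist h v :=
  G.le_superDist hG fun _ _ hp hh' => G.superDist_le hG hp (hh'.trans hh)

theorem superDist_dst_le {h h' : ℕ} {e : E} (hh : h + G.hops [e] ≤ h') :
    G.superDist h' (G.dst e) ≤ G.superDist h (G.src e) + G.wt e := by
  rw [← sub_le_iff_le_add]
  refine G.le_superDist hG fun u p hp hp' => ?_
  rw [sub_le_iff_le_add]
  have : G.IsPath u (p ++ [e]) (G.dst e) := hp.append G ((G.isPath_singleton _ _ _).2 ⟨rfl, rfl⟩)
  simpa using G.superDist_le hG this (h := h') (by rw [hops_append]; omega)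

theorem superDist_dst_le_not_neg (h : ℕ) {e : E} (he : e ∉ G.neg) :
    G.superDist h (G.dst e) ≤ G.superDist h (G.src e) + G.wt e :=
  G.superDist_dst_le hG (by simp [hops_cons, he])

theorem superDist_dst_le_succ (h : ℕ) (e : E) :
    G.superDist (h + 1) (G.dst e) ≤ G.superDist h (G.src e) + G.wt e :=
  G.superDist_dst_le hG (by rw [hops_cons]; split_ifs <;> simp)

theorem mem_copied_iff (r : ℕ) (v : V) : v ∈ G.copied r ↔ G.superDist r v < 0 := by
  rw [← EReal.coe_lt_coe_iff, G.coe_superDist hG]; rfl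

theorem superDist_eq_zero {r j : ℕ} (hj : j ≤ r) {v : V} (hv : v ∉ G.copied r) :
    G.superDist j v = 0 := by
  rw [G.mem_copied_iff hG, not_lt] at hv
  exact le_antisymm (G.superDist_nonpos hG j v) (hv.trans (G.superDist_antitone hG hj v))

/-- The step from the `h`-hop to the `(h + 1)`-hop super-source distances: a function that is
feasible and not too small is the next one. -/
theorem eq_superDist_succ (h : ℕ) (d : V → ℝ) (h1 : ∀ v, d v ≤ G.superDist h v)
    (h2 : ∀ e ∈ G.neg, d (G.dst e) ≤ G.superDist h (G.src e) + G.wt e)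
    (h3 : ∀ e, e ∉ G.neg → d (G.dst e) ≤ d (G.src e) + G.wt e)
    (h4 : ∀ f : V → ℝ, (∀ v, f v ≤ G.superDist h v) →
      (∀ e ∈ G.neg, f (G.dst e) ≤ G.superDist h (G.src e) + G.wt e) →
      (∀ e, e ∉ G.neg → f (G.dst e) ≤ f (G.src e) + G.wt e) → ∀ v, f v ≤ d v) (v : V) :
    d v = G.superDist (h + 1) v := by
  -- The upper bound on `d` is an induction on paths, from their last edge. For the lower bound, the
  -- `(h + 1)`-hop distance is itself one of the functions that `d` dominates.
  refine le_antisymm (G.le_superDist hG fun u p => ?_) (h4 _ ?_ ?_ ?_ v)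
  · induction p using List.reverseRecOn generalizing v with
    | nil =>
      intro hp _
      have := (h1 v).trans (G.superDist_nonpos hG h v)
      simpa using this
    | append_singleton p e ih =>
      rw [isPath_append]
      rintro ⟨x, hp, hx⟩ hh
      rw [isPath_singleton] at hx
      obtain ⟨rfl, rfl⟩ := hx
      rw [hops_append] at hh
      rw [weight_append]
      simp only [weight_cons, weight_nil, add_zero]
      -- If the last edge is negative, at most `h` hops remain for the prefix, and the old distances
      -- bound it; otherwise the induction hypothesis does.
      by_cases he : e ∈ G.neg
      · rw [hops_cons_neg G he] at hh
        have := G.superDist_le hG hp (h := h) (by omega)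
        linarith [h2 e he]
      · rw [hops_cons_not_neg G he] at hh
        linarith [h3 e he, ih _ hp (by simpa using hh)]
  · exact fun v => G.superDist_antitone hG (Nat.le_succ h) v
  · exact fun e _ => G.superDist_dst_le_succ hG h e
  · exact fun e he => G.superDist_dst_le_not_neg hG _ he

end SuperDist

/-! ### Shortening paths when there is no negative cycle -/

section Cycles

variable {V E : Type} [Finite E] (G : WGraph V E)

/-- Without negative cycles every path can be shortened to one on which no negative edge occurs
twice. -/
theorem exists_shortcut (hc : ¬ G.HasNegativeCycle) (u v : V) (p : List E) (hp : G.IsPath u p v) :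
    ∃ q, G.IsPath u q v ∧ G.weight q ≤ G.weight p ∧ G.hops q ≤ G.neg.ncard := by
  classical
  induction hl : p.length using Nat.strong_induction_on generalizing p with
  | _ l ih =>
  subst hl
  by_cases hnd : (p.filter (· ∈ G.neg)).Nodup
  · refine ⟨p, hp, le_rfl, ?_⟩
    have h1 : G.hops p = (p.filter (· ∈ G.neg)).toFinset.card := by
      rw [List.toFinset_card_of_nodup hnd, hops, List.countP_eq_length_filter]
    rw [h1, ← Set.ncard_coe_finset]
    refine Set.ncard_le_ncard ?_ (Set.toFinite _)
    intro e he
    simpa using (List.mem_filter.1 (List.mem_toFinset.1 he)).2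
  · obtain ⟨e, he⟩ : ∃ e, [e, e].Sublist p := by
      rw [List.nodup_iff_sublist] at hnd
      push Not at hnd
      obtain ⟨e, he⟩ := hnd
      exact ⟨e, he.trans List.filter_sublist⟩
    obtain ⟨a, b, rfl, ha, hb⟩ : ∃ a b, p = a ++ b ∧ e ∈ a ∧ e ∈ b := by
      have := List.cons_sublist_iff.1 he
      obtain ⟨a, b, h1, h2, h3⟩ := this
      exact ⟨a, b, h1, h2, by simpa using h3⟩
    obtain ⟨a1, a2, rfl⟩ := List.append_of_mem ha
    obtain ⟨b1, b2, rfl⟩ := List.append_of_mem hb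
    have hp' := hp
    simp only [isPath_append, IsPath] at hp
    obtain ⟨x, ⟨y, hy, hey, hx⟩, z, hz, hez, hv⟩ := hp
    -- The segment from just after the first occurrence of `e` up to and including the second is a
    -- closed path at the head of `e`. Cutting it out does not increase the weight.
    have hcyc : 0 ≤ G.weight (a2 ++ b1 ++ [e]) := by
      by_contra hlt
      refine hc ⟨G.dst e, _, ?_, not_le.1 hlt⟩
      simp only [isPath_append, IsPath]
      exact ⟨z, ⟨x, hx, hz⟩, hez, trivial⟩
    have hq : G.IsPath u (a1 ++ e :: b2) v := by
      simp only [isPath_append, IsPath]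
      exact ⟨y, hy, hey, hv⟩
    obtain ⟨q, h1, h2, h3⟩ := ih _ (by simp; omega) _ hq rfl
    refine ⟨q, h1, h2.trans ?_, h3⟩
    simp only [weight_append, weight_cons, weight_nil] at hcyc ⊢
    linarith

variable (hG : ∀ e, e ∉ G.neg → 0 ≤ G.wt e)
include hG

/-- By `exists_shortcut`, the bound of `|N|` hops is no restriction. -/
theorem superDist_le_of_no_cycle (hc : ¬ G.HasNegativeCycle) {u v : V} {p : List E}
    (hp : G.IsPath u p v) : G.superDist G.neg.ncard v ≤ G.weight p := by
  obtain ⟨q, h1, h2, h3⟩ := G.exists_shortcut hc u v p hp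
  exact (G.superDist_le hG h1 h3).trans h2

/-- Appending `e` to a path may exceed the hop bound, which `superDist_le_of_no_cycle` forgives.
These distances are thus a price function that eliminates all negative edges. -/
theorem superDist_feasible_of_no_cycle (hc : ¬ G.HasNegativeCycle) (e : E) :
    G.superDist G.neg.ncard (G.dst e) ≤ G.superDist G.neg.ncard (G.src e) + G.wt e := by
  rw [← sub_le_iff_le_add]
  refine G.le_superDist hG fun u p hp _ => ?_
  rw [sub_le_iff_le_add]
  have := G.superDist_le_of_no_cycle hG hc
    (hp.append G ((G.isPath_singleton (G.src e) (G.dst e) e).2 ⟨rfl, rfl⟩))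
  simpa using this

end Cycles

/-! ### The layered graph is a hop reduction -/

section Layered

variable {V E : Type} [Finite E] (G : WGraph V E) (r : ℕ)

omit [Finite E] in
theorem layered_not_neg {x : G.LCopy r ⊕ G.LSelf r} :
    x ∉ (G.layered r).neg ↔ 0 ≤ G.lWt r x := by
  simp [layered]

variable (hG : ∀ e, e ∉ G.neg → 0 ≤ G.wt e)

omit [Finite E] in
-- Edges of `H` are classified by the sign of their weight, so `H` satisfies the standing sign
-- hypothesis by construction, and the theory of `superDist` applies to `H` as well.
theorem layered_nonneg (x : G.LCopy r ⊕ G.LSelf r) (hx : x ∉ (G.layered r).neg) :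
    0 ≤ (G.layered r).wt x := (G.layered_not_neg r).1 hx

section
omit [Finite E]

/-- Paths of the layered graph project to paths of the graph; the weights agree up to the
potential of the ends. -/
theorem exists_projection (x y : G.LVertex r) (p : List (G.LCopy r ⊕ G.LSelf r))
    (hp : (G.layered r).IsPath x p y) :
    ∃ q, G.IsPath x.1.1 q y.1.1 ∧ (G.layered r).weight p =
      G.weight q + G.superDist x.1.2 x.1.1 - G.superDist y.1.2 y.1.1 := by
  induction p generalizing x with
  | nil => cases hp; exact ⟨[], rfl, by simp⟩
  | cons e p ih =>
    obtain ⟨rfl, hp⟩ := hp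
    obtain ⟨q, hq, hw⟩ := ih _ hp
    rcases e with e | e
    · refine ⟨e.1.1 :: q, ⟨rfl, hq⟩, ?_⟩
      rw [weight_cons, hw, weight_cons]
      simp only [layered, lWt, lBase]
      ring
    · refine ⟨q, hq, ?_⟩
      rw [weight_cons, hw]
      simp only [layered, lWt, lBase]
      ring

end

/-- The weight is `δ_j(u) - δ_{j+1}(u)`, and additional hops can only lower the distance. The
condition `j < r` excludes the return edge. -/
theorem superDist_self_nonneg (hG : ∀ e, e ∉ G.neg → 0 ≤ G.wt e) (x : G.LSelf r)
    (hx : x.1.2 < r) : Sum.inr x ∉ (G.layered r).neg := by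
  rw [layered_not_neg]
  have := G.superDist_antitone hG (Nat.le_succ x.1.2) x.1.1
  simpa [lWt, lBase, lSrc, lDst, selfHead, hx] using this

/-- Each case is a triangle inequality for `δ`. At a head that is not copied, `δ_j` vanishes for all
`j ≤ r`, so redirecting the edge to layer 0 does not change its weight; that negative edges only
leave layers below `r` keeps `j + 1` in this range. -/
theorem copy_nonneg (hG : ∀ e, e ∉ G.neg → 0 ≤ G.wt e) (x : G.LCopy r) :
    Sum.inl x ∉ (G.layered r).neg := by
  rw [layered_not_neg]
  obtain ⟨⟨e, j⟩, h1, h2, h3⟩ := x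
  dsimp only at h1 h2 h3
  simp only [lWt, lBase, lSrc, lDst, copyHead]
  by_cases hR : G.dst e ∈ G.copied r
  · by_cases hN : e ∈ G.neg
    · have := G.superDist_dst_le_succ hG j e
      simp only [hR, hN, if_true]; linarith
    · have := G.superDist_dst_le_not_neg hG j hN
      simp only [hR, hN, if_true, if_false]; linarith
  · have h0 := G.superDist_eq_zero hG (Nat.zero_le r) hR
    by_cases hN : e ∈ G.neg
    · have := G.superDist_dst_le_succ hG j e
      have h' := G.superDist_eq_zero hG (h3 hN) hR
      simp only [hR, if_false]; linarith
    · have := G.superDist_dst_le_not_neg hG j hN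
      have h' := G.superDist_eq_zero hG h1 hR
      simp only [hR, if_false]; linarith

omit [Finite E] in
-- The potentials telescope, so a simulation only has to keep track of the sum of the underlying
-- weights.
theorem layered_weight_eq {x y : G.LVertex r} {p : List (G.LCopy r ⊕ G.LSelf r)} {q : List E}
    (hw : ((p.map (G.lBase r)).sum : ℝ) = G.weight q) (hp : (G.layered r).IsPath x p y) :
    (G.layered r).weight p =
      G.weight q + G.superDist x.1.2 x.1.1 - G.superDist y.1.2 y.1.1 := by
  rw [← hw]
  clear hw
  induction p generalizing x with
  | nil => cases hp; simp
  | cons e p ih =>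
    obtain ⟨rfl, hp⟩ := hp
    rw [weight_cons, ih hp, List.map_cons, List.sum_cons]
    simp only [layered, lWt]
    ring

/-- Climbing to layer `r` costs no hop, and the step from there to layer `0` one. -/
theorem exists_path_to_zero (hG : ∀ e, e ∉ G.neg → 0 ≤ G.wt e) (v : V) (hv : v ∈ G.copied r)
    (j : ℕ) (hj : j ≤ r) :
    ∃ p, (G.layered r).IsPath ⟨(v, j), hj, Or.inl hv⟩ p (G.layerZero r v) ∧
      (G.layered r).hops p ≤ 1 ∧ (p.map (G.lBase r)).sum = 0 := by
  obtain ⟨i, rfl⟩ := Nat.exists_eq_add_of_le hj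
  induction i generalizing j with
  | zero =>
    refine ⟨[Sum.inr ⟨(v, j), hv, le_rfl⟩], ⟨rfl, ?_⟩, ?_, ?_⟩
    · simp [layered, lDst, selfHead, IsPath, layerZero]
      rfl
    · rw [hops_cons]; split_ifs <;> simp
    · simp [lBase]
  | succ i ih =>
    have e1 : j + (i + 1) = j + 1 + i := by omega
    -- The types of vertices and edges depend on the number of layers; a separate variable with an
    -- equation allows substitution in them.
    have key : ∀ r', r' = j + 1 + i → ∀ (hv : v ∈ G.copied r') (hj : j ≤ r'),
      ∃ p, (G.layered r').IsPath ⟨(v, j), hj, Or.inl hv⟩ p (G.layerZero r' v) ∧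
      (G.layered r').hops p ≤ 1 ∧ (p.map (G.lBase r')).sum = 0 := by
      rintro _ rfl hv hj
      obtain ⟨p, h1, h2, h3⟩ := ih (j + 1) hv (by omega)
      have hlt : j < j + 1 + i := by omega
      let f : G.LSelf (j + 1 + i) := ⟨(v, j), hv, hj⟩
      refine ⟨Sum.inr f :: p, ⟨rfl, ?_⟩, ?_, ?_⟩
      · simpa [layered, lDst, selfHead, hlt, f] using h1
      · rw [hops_cons_not_neg _ (G.superDist_self_nonneg _ hG f hlt)]
        exact h2
      · simpa [lBase] using h3
    exact key _ e1 hv hj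

/-- Simulation of a path of the graph in the layered graph. -/
theorem exists_simulation (hG : ∀ e, e ∉ G.neg → 0 ≤ G.wt e) (hr : 1 ≤ r) (u v : V) (q : List E)
    (hq : G.IsPath u q v) (x : G.LVertex r) (hx : x.1.1 = u) :
    ∃ (y : G.LVertex r) (p : List (G.LCopy r ⊕ G.LSelf r)), y.1.1 = v ∧
      (G.layered r).IsPath x p y ∧ (p.map (G.lBase r)).sum = G.weight q ∧
      r * (G.layered r).hops p + y.1.2 ≤ G.hops q + x.1.2 := by
  induction q generalizing u x with
  | nil => cases hq; exact ⟨x, [], hx, rfl, by simp, by simp⟩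
  | cons e q ih =>
    obtain ⟨rfl, hq⟩ := hq
    -- The case in which the copy of `e` in the current layer exists. It costs no hop of `H`, and it
    -- raises the layer only if `e` is negative, and then by at most the one hop that `e` adds in
    -- `G`.
    have step : ∀ (x : G.LVertex r), x.1.1 = G.src e → (e ∈ G.neg → x.1.2 < r) →
        ∃ (y : G.LVertex r) (p : List (G.LCopy r ⊕ G.LSelf r)), y.1.1 = v ∧
        (G.layered r).IsPath x p y ∧ (p.map (G.lBase r)).sum = G.weight (e :: q) ∧
        r * (G.layered r).hops p + y.1.2 ≤ G.hops (e :: q) + x.1.2 := by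
      rintro ⟨⟨u, i⟩, hi, hi'⟩ hu hN
      dsimp only at hu hN hi hi'
      subst hu
      let f : G.LCopy r := ⟨(e, i), hi, hi', hN⟩
      obtain ⟨y, p, h1, h2, h3, h4⟩ := ih _ hq (G.copyHead r f) rfl
      refine ⟨y, Sum.inl f :: p, h1, ⟨rfl, h2⟩, by simp [lBase, h3, f], ?_⟩
      rw [hops_cons_not_neg _ (G.copy_nonneg r hG f)]
      refine h4.trans ?_
      simp only [copyHead, hops_cons, f]
      split_ifs <;> omega
    by_cases hN : e ∈ G.neg → x.1.2 < r
    · exact step x hx hN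
    · push Not at hN
      obtain ⟨hN, hlt⟩ := hN
      obtain ⟨⟨u, i⟩, hi, hi'⟩ := x
      dsimp only at hx hlt hi hi'
      -- A negative edge cannot leave layer `r`. Returning to layer 0 first takes at most one hop of
      -- `H`, which counts `r` in the bound; the drop by `r` layers pays for it.
      obtain rfl : i = r := le_antisymm hi hlt
      have hu : u ∈ G.copied i := hi'.resolve_right (by omega)
      obtain ⟨y, p, h1, h2, h3, h4⟩ := step (G.layerZero i u) hx (fun _ => hr)
      refine ⟨y, Sum.inr ⟨(u, i), hu, le_rfl⟩ :: p, h1, ⟨rfl, ?_⟩, ?_, ?_⟩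
      · simpa [layered, lDst, selfHead, layerZero] using h2
      · simpa [lBase] using h3
      · have : (G.layered i).hops (Sum.inr ⟨(u, i), hu, le_rfl⟩ :: p) ≤
            1 + (G.layered i).hops p := by
          rw [hops_cons]; split_ifs <;> omega
        have := Nat.mul_le_mul_left i this
        simp only [layerZero] at h4 ⊢
        rw [Nat.mul_add] at this
        omega

/-- If the simulation ends in a layer `j > 0`, then `r * hops + j ≤ k * r` forces fewer than `k`
hops, and the spare one brings the path back to layer 0, where the potential vanishes. -/
theorem exists_layered_path (hG : ∀ e, e ∉ G.neg → 0 ≤ G.wt e) (hr : 1 ≤ r) {h k : ℕ}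
    (hk : h ≤ k * r) {u v : V} {q : List E} (hq : G.IsPath u q v) (hh : G.hops q ≤ h) :
    ∃ p, (G.layered r).IsPath (G.layerZero r u) p (G.layerZero r v) ∧
      (G.layered r).weight p = G.weight q ∧ (G.layered r).hops p ≤ k := by
  obtain ⟨⟨⟨y, j⟩, hj, hj'⟩, p, hy, h1, h2, h3⟩ :=
    G.exists_simulation r hG hr u v q hq (G.layerZero r u) rfl
  dsimp only at hj hj' hy h3
  subst hy
  have h0 : ∀ w : V, G.superDist 0 w = 0 := G.superDist_zero hG
  have h3' : r * (G.layered r).hops p + j ≤ k * r := by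
    have : (G.layerZero r u).1.2 = 0 := rfl
    omega
  have fin : ∀ p', (G.layered r).IsPath (G.layerZero r u) p' (G.layerZero r y) →
      (p'.map (G.lBase r)).sum = G.weight q → (G.layered r).weight p' = G.weight q := by
    intro p' hp' hw
    rw [G.layered_weight_eq r hw hp']
    simp [layerZero, h0]
  rcases Nat.eq_zero_or_pos j with rfl | hpos
  · refine ⟨p, h1, fin p h1 h2, ?_⟩
    rw [Nat.mul_comm k r] at h3'
    exact Nat.le_of_mul_le_mul_left (by omega) hr
  · have hu : y ∈ G.copied r := hj'.resolve_right (by omega)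
    obtain ⟨p', h4, h5, h6⟩ := G.exists_path_to_zero r hG y hu j hj
    have h7 := h1.append _ h4
    refine ⟨p ++ p', h7, fin _ h7 (by simp [h2, h6]), ?_⟩
    rw [hops_append]
    have : (G.layered r).hops p < k := by
      refine Nat.lt_of_mul_lt_mul_left (a := r) ?_
      rw [Nat.mul_comm r k]; omega
    omega

theorem isHopReduction_layered (hG : ∀ e, e ∉ G.neg → 0 ≤ G.wt e) (hr : 1 ≤ r) :
    IsHopReduction r G (G.layered r) (G.layerZero r) := by
  refine ⟨fun u v h => ?_, fun h u v => ⟨?_, ?_⟩⟩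
  · exact congrArg (fun x : G.LVertex r => x.1.1) h
  · refine le_iInf₂ fun q hq => ?_
    have hk : h ≤ ⌈(h : ℚ) / r⌉₊ * r := by
      have h1 := Nat.le_ceil ((h : ℚ) / r)
      have hr' : (0 : ℚ) < r := by exact_mod_cast hr
      rw [div_le_iff₀ hr'] at h1
      exact_mod_cast h1
    obtain ⟨p, h1, h2, h3⟩ := G.exists_layered_path r hG hr hk hq.1 hq.2
    rw [← h2]
    exact iInf₂_le p ⟨h1, h3⟩
  · refine le_iInf₂ fun p hp => ?_
    obtain ⟨q, h1, h2⟩ := G.exists_projection r _ _ p hp.1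
    rw [h2]
    simp only [layerZero, G.superDist_zero hG, add_zero, sub_zero]
    exact iInf₂_le q h1

/-- Without negative cycles the super-source distances in the layered graph, with sufficiently many
hops, are the super-source distances in the graph. -/
theorem superDist_layered_of_no_cycle [Finite (G.LCopy r ⊕ G.LSelf r)]
    (hG : ∀ e, e ∉ G.neg → 0 ≤ G.wt e) (hr : 1 ≤ r)
    (hc : ¬ G.HasNegativeCycle) {k : ℕ} (hk : G.neg.ncard ≤ k * r) (v : V) :
    (G.layered r).superDist k (G.layerZero r v) = G.superDist G.neg.ncard v := by
  refine le_antisymm (G.le_superDist hG fun u q hq hh => ?_)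
    ((G.layered r).le_superDist (G.layered_nonneg r) fun x p hp _ => ?_)
  · obtain ⟨p, h1, h2, h3⟩ := G.exists_layered_path r hG hr hk hq hh
    rw [← h2]
    exact (G.layered r).superDist_le (G.layered_nonneg r) h1 h3
  · obtain ⟨q, h1, h2⟩ := G.exists_projection r _ _ p hp
    -- A path of `H` may start in any layer. The potential at its start is an infimum over paths of
    -- `G` that end there; prefixed to `q` they become paths to `v`, none of them lighter than the
    -- distance of `v`.
    have h3 : G.superDist G.neg.ncard v - G.weight q ≤ G.superDist x.1.2 x.1.1 := by
      refine G.le_superDist hG fun w p' hp' _ => ?_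
      have := G.superDist_le_of_no_cycle hG hc (hp'.append G h1)
      rw [weight_append] at this
      have e : (G.layerZero r v).1.1 = v := rfl
      rw [e] at this
      linarith
    rw [h2]
    simp only [layerZero, G.superDist_zero hG]
    linarith

end Layered

/-! ### Remoteness bounds the set of copied vertices -/

section Remote

variable {V E : Type} (G : WGraph V E)

/-- A path of negative weight contains a negative edge. Dropping the nonnegative edges before the
first one keeps the weight negative and makes the path start at a negative vertex. -/
theorem copied_subset_reach (hG : ∀ e, e ∉ G.neg → 0 ≤ G.wt e) (r : ℕ) :
    G.copied r ⊆ G.reach r G.negVertices := by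
  intro v hv
  have hv : G.hopDistFrom r Set.univ v < 0 := hv
  simp only [hopDistFrom, hopDist, iInf_lt_iff] at hv
  obtain ⟨u, -, p, ⟨hp, hh⟩, hw'⟩ := hv
  have hw : G.weight p < 0 := by exact_mod_cast hw'
  clear hw'
  have key : ∃ u' ∈ G.negVertices, ∃ p', G.IsPath u' p' v ∧ G.hops p' ≤ r ∧ G.weight p' < 0 := by
    induction p generalizing u with
    | nil => simp at hw
    | cons e p ih =>
      by_cases he : e ∈ G.neg
      · exact ⟨u, ⟨e, he, hp.1⟩, e :: p, hp, hh, hw⟩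
      · rw [hops_cons_not_neg G he] at hh
        rw [weight_cons] at hw
        exact ih _ hp.2 hh (by linarith [hG e he])
  obtain ⟨u', hu', p', h1, h2, h3⟩ := key
  show G.hopDistFrom r G.negVertices v < 0
  refine lt_of_le_of_lt ((iInf₂_le u' hu').trans (iInf₂_le p' ⟨h1, h2⟩)) ?_
  exact_mod_cast h3

end Remote

end WGraph

namespace RealRAM

/-! ### A program logic for total correctness with time bounds -/

infixr:60 " ;; " => Prog.seq

namespace State

variable (s : State) (a i x b : ℕ) (y : ℝ)

@[simp] theorem setInt_ints :
    (s.setInt a i x).ints b = if b = a then Function.update (s.ints a) i x else s.ints b := by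
  simp only [setInt, Function.update_apply]

@[simp] theorem setInt_reals : (s.setInt a i x).reals = s.reals := rfl

@[simp] theorem setReal_ints : (s.setReal a i y).ints = s.ints := rfl

@[simp] theorem setReal_reals :
    (s.setReal a i y).reals b =
      if b = a then Function.update (s.reals a) i y else s.reals b := by
  simp only [setReal, Function.update_apply]

end State

namespace Prog

/-- The arrays of natural numbers to which a program may write. -/
def wi : Prog → ℕ → Bool
  | skip, _ => false
  | iset a _ _, b => a == b
  | rset _ _ _, _ => false
  | seq p q, b => p.wi b || q.wi b
  | ite _ p q, b => p.wi b || q.wi b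
  | loop _ p, b => p.wi b

/-- The arrays of real numbers to which a program may write. -/
def wr : Prog → ℕ → Bool
  | skip, _ => false
  | iset _ _ _, _ => false
  | rset a _ _, b => a == b
  | seq p q, b => p.wr b || q.wr b
  | ite _ p q, b => p.wr b || q.wr b
  | loop _ p, b => p.wr b

/-- A program without loops. -/
def loopFree : Prog → Bool
  | skip => true
  | iset _ _ _ => true
  | rset _ _ _ => true
  | seq p q => p.loopFree && q.loopFree
  | ite _ p q => p.loopFree && q.loopFree
  | loop _ _ => false

/-- A bound for the running time of a program without loops. -/
def cost : Prog → ℕ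
  | skip => 1
  | iset _ i x => i.cost + x.cost + 1
  | rset _ i x => i.cost + x.cost + 1
  | seq p q => p.cost + q.cost
  | ite b p q => b.cost + 1 + (p.cost + q.cost)
  | loop _ _ => 0

open Classical in
/-- The effect of a program without loops. -/
noncomputable def exec : Prog → State → State
  | skip, s => s
  | iset a i x, s => s.setInt a (i.eval s) (x.eval s)
  | rset a i x, s => s.setReal a (i.eval s) (x.eval s)
  | seq p q, s => q.exec (p.exec s)
  | ite b p q, s => if b.Holds s then p.exec s else q.exec s
  | loop _ _, s => s

end Prog

/-- `s'` agrees with `s` outside the arrays to which `p` may write. -/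
def Frame (p : Prog) (s s' : State) : Prop :=
  (∀ a, p.wi a = false → s'.ints a = s.ints a) ∧ ∀ a, p.wr a = false → s'.reals a = s.reals a

theorem Frame.refl (p : Prog) (s : State) : Frame p s s := ⟨fun _ _ => rfl, fun _ _ => rfl⟩

theorem Frame.trans {p : Prog} {s s' s'' : State} (h : Frame p s s') (h' : Frame p s' s'') :
    Frame p s s'' :=
  ⟨fun a ha => (h'.1 a ha).trans (h.1 a ha), fun a ha => (h'.2 a ha).trans (h.2 a ha)⟩

theorem Frame.mono {p q : Prog} {s s' : State} (h : Frame p s s')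
    (hi : ∀ a, q.wi a = false → p.wi a = false) (hr : ∀ a, q.wr a = false → p.wr a = false) :
    Frame q s s' :=
  ⟨fun a ha => h.1 a (hi a ha), fun a ha => h.2 a (hr a ha)⟩

theorem Frame.seq_left {p q : Prog} {s s' : State} (h : Frame p s s') : Frame (p ;; q) s s' :=
  h.mono (fun a ha => by simp [Prog.wi] at ha; exact ha.1)
    (fun a ha => by simp [Prog.wr] at ha; exact ha.1)

theorem Frame.seq_right {p q : Prog} {s s' : State} (h : Frame q s s') : Frame (p ;; q) s s' :=
  h.mono (fun a ha => by simp [Prog.wi] at ha; exact ha.2)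
    (fun a ha => by simp [Prog.wr] at ha; exact ha.2)

/-- The frame is read off the syntax, so that a specification need only mention the arrays of
interest; that an array is unchanged is then checked by `rfl`. -/
theorem Run.frame {p : Prog} {s s' : State} {t : ℕ} (h : Run p s t s') : Frame p s s' := by
  induction h with
  | skip s => exact Frame.refl _ _
  | iset s a i x =>
    refine ⟨fun b hb => ?_, fun _ _ => rfl⟩
    have : b ≠ a := by rintro rfl; simp [Prog.wi] at hb
    simp [this]
  | rset s a i x =>
    refine ⟨fun _ _ => rfl, fun b hb => ?_⟩
    have : b ≠ a := by rintro rfl; simp [Prog.wr] at hb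
    simp [this]
  | seq _ _ h1 h2 => exact h1.seq_left.trans h2.seq_right
  | ite_true _ _ h1 =>
    exact h1.mono (fun a ha => by simp [Prog.wi] at ha; exact ha.1)
      (fun a ha => by simp [Prog.wr] at ha; exact ha.1)
  | ite_false _ _ h1 =>
    exact h1.mono (fun a ha => by simp [Prog.wi] at ha; exact ha.2)
      (fun a ha => by simp [Prog.wr] at ha; exact ha.2)
  | loop_true _ _ _ h1 h2 => exact (h1.mono (fun _ h => h) (fun _ h => h)).trans h2
  | loop_false _ => exact Frame.refl _ _

/-- Started in `s`, the program `p` halts within time `T` in a state with property `Q`. -/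
def Ter (p : Prog) (s : State) (T : ℕ) (Q : State → Prop) : Prop :=
  ∃ t s', Run p s t s' ∧ t ≤ T ∧ Q s'

namespace Ter

variable {p q : Prog} {s : State} {T T' : ℕ} {Q Q' : State → Prop}

theorem mono (h : Ter p s T Q) (hT : T ≤ T') (hQ : ∀ s', Frame p s s' → Q s' → Q' s') :
    Ter p s T' Q' := by
  obtain ⟨t, s', h1, h2, h3⟩ := h
  exact ⟨t, s', h1, h2.trans hT, hQ s' h1.frame h3⟩

/-- Loop-free code is verified by symbolic execution: `Prog.exec` is unfolded by `simp`, and the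
static cost is computed. -/
theorem exec (hp : p.loopFree = true) (hT : p.cost ≤ T) (hQ : Q (p.exec s)) : Ter p s T Q := by
  suffices H : ∃ t ≤ p.cost, Run p s t (p.exec s) by
    obtain ⟨t, h1, h2⟩ := H
    exact ⟨t, _, h2, h1.trans hT, hQ⟩
  clear hT hQ
  induction p generalizing s with
  | skip => exact ⟨1, le_rfl, Run.skip s⟩
  | iset a i x => exact ⟨_, le_rfl, Run.iset s a i x⟩
  | rset a i x => exact ⟨_, le_rfl, Run.rset s a i x⟩
  | seq p q h1 h2 =>
    simp only [Prog.loopFree, Bool.and_eq_true] at hp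
    obtain ⟨t1, h3, h4⟩ := h1 (s := s) hp.1
    obtain ⟨t2, h5, h6⟩ := h2 (s := p.exec s) hp.2
    exact ⟨_, Nat.add_le_add h3 h5, Run.seq h4 h6⟩
  | ite b p q h1 h2 =>
    simp only [Prog.loopFree, Bool.and_eq_true] at hp
    by_cases hb : b.Holds s
    · obtain ⟨t1, h3, h4⟩ := h1 (s := s) hp.1
      refine ⟨b.cost + 1 + t1, by simp only [Prog.cost]; omega, ?_⟩
      simp only [Prog.exec, if_pos hb]
      exact Run.ite_true hb h4
    · obtain ⟨t1, h3, h4⟩ := h2 (s := s) hp.2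
      refine ⟨b.cost + 1 + t1, by simp only [Prog.cost]; omega, ?_⟩
      simp only [Prog.exec, if_neg hb]
      exact Run.ite_false hb h4
  | loop b p _ => simp [Prog.loopFree] at hp

theorem seq (h : Ter p s T Q) (h' : ∀ s', Frame p s s' → Q s' → Ter q s' T' Q') :
    Ter (p ;; q) s (T + T') Q' := by
  obtain ⟨t, s', h1, h2, h3⟩ := h
  obtain ⟨t', s'', h4, h5, h6⟩ := h' s' h1.frame h3
  exact ⟨t + t', s'', Run.seq h1 h4, Nat.add_le_add h2 h5, h6⟩

theorem ite {b : BExpr} (h1 : b.Holds s → Ter p s T Q) (h2 : ¬ b.Holds s → Ter q s T Q) :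
    Ter (Prog.ite b p q) s (b.cost + 1 + T) Q := by
  by_cases hb : b.Holds s
  · obtain ⟨t, s', h3, h4, h5⟩ := h1 hb
    exact ⟨_, s', Run.ite_true hb h3, by omega, h5⟩
  · obtain ⟨t, s', h3, h4, h5⟩ := h2 hb
    exact ⟨_, s', Run.ite_false hb h3, by omega, h5⟩

/-- The rule for loops, with an invariant `I` and a potential `Φ` that pays for the time. -/
theorem loop {b : BExpr} (I : State → Prop) (Φ : State → ℕ) (h0 : I s)
    (h : ∀ s', Frame p s s' → I s' → b.Holds s' →
      ∃ T, Ter p s' T fun s'' => I s'' ∧ T + b.cost + 1 + Φ s'' ≤ Φ s') :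
    Ter (Prog.loop b p) s (Φ s + b.cost + 1) fun s' => I s' ∧ ¬ b.Holds s' := by
  induction hn : Φ s using Nat.strong_induction_on generalizing s with
  | _ n ih =>
  subst hn
  by_cases hb : b.Holds s
  · obtain ⟨T, t, s', h1, h2, h3, h4⟩ := h s (Frame.refl _ _) h0 hb
    obtain ⟨t', s'', h5, h6, h7⟩ := ih (Φ s') (by omega) h3
      (fun s'' hf => h s'' (h1.frame.trans hf)) rfl
    exact ⟨_, s'', Run.loop_true hb h1 h5, by omega, h7⟩
  · exact ⟨_, s, Run.loop_false hb, by omega, h0, hb⟩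

end Ter

/-- One unrolling of a loop, for loops that are verified by induction on a list. -/
theorem Ter.loop_cons {b : BExpr} {p : Prog} {s : State} {T T' : ℕ} {Q Q' : State → Prop}
    (hb : b.Holds s) (h : Ter p s T Q)
    (h' : ∀ s', Frame p s s' → Q s' → Ter (Prog.loop b p) s' T' Q') :
    Ter (Prog.loop b p) s (b.cost + 1 + T + T') Q' := by
  obtain ⟨t, s', h1, h2, h3⟩ := h
  obtain ⟨t', s'', h4, h5, h6⟩ := h' s' h1.frame h3
  exact ⟨_, s'', Run.loop_true hb h1 h4, by omega, h6⟩

theorem Ter.loop_nil {b : BExpr} {p : Prog} {s : State} {Q : State → Prop}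
    (hb : ¬ b.Holds s) (h : Q s) : Ter (Prog.loop b p) s (b.cost + 1) Q :=
  ⟨_, s, Run.loop_false hb, le_rfl, h⟩

/-- A scalar variable: entry `0` of an array. -/
def var (a : ℕ) : IExpr := IExpr.load a (IExpr.const 0)

theorem eval_var (a : ℕ) (s : State) : (var a).eval s = s.ints a 0 := rfl

/-- Assignment to a scalar variable. -/
def assign (a : ℕ) (x : IExpr) : Prog := Prog.iset a (IExpr.const 0) x

/-- `for i = 0, …, lim - 1 do body`. -/
def forUp (i lim : ℕ) (body : Prog) : Prog :=
  assign i (IExpr.const 0) ;;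
    Prog.loop (BExpr.ilt (var i) (var lim)) (body ;; assign i ((var i).add (IExpr.const 1)))

/-- The invariant is demanded after the counter has been advanced. A pass costs `12` beyond its
body, `6` for the test and `6` for the increment; the final `9` pays for the initialisation and the
last test. -/
theorem Ter.forUp {i lim : ℕ} {body : Prog} {s : State} {N : ℕ} (T : ℕ → ℕ)
    (Inv : ℕ → State → Prop) (hN : s.ints lim 0 = N) (hi : body.wi i = false)
    (hl : body.wi lim = false) (hil : lim ≠ i) (h0 : Inv 0 (s.setInt i 0 0))
    (hs : ∀ j s', j < N → Frame (RealRAM.forUp i lim body) s s' → s'.ints i 0 = j →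
      s'.ints lim 0 = N → Inv j s' →
      Ter body s' (T j) fun s'' => Inv (j + 1) (s''.setInt i 0 (j + 1))) :
    Ter (RealRAM.forUp i lim body) s ((∑ j ∈ Finset.range N, (T j + 12)) + 9)
      (fun s' => Inv N s' ∧ s'.ints i 0 = N) := by
  have hb5 : (BExpr.ilt (var i) (var lim)).cost = 5 := rfl
  have e1 : Ter (assign i (IExpr.const 0)) s 3 (fun s' => s' = s.setInt i 0 0) :=
    Ter.exec rfl le_rfl rfl
  refine Ter.mono (Ter.seq (T' := (∑ j ∈ Finset.range N, (T j + 12)) + 6) e1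
    (Q' := fun s' => Inv N s' ∧ s'.ints i 0 = N) ?_) (by omega) fun _ _ h => h
  rintro s1 hf1 rfl
  let I : State → Prop := fun s' => s'.ints lim 0 = N ∧ ∃ j ≤ N, s'.ints i 0 = j ∧ Inv j s'
  let Φ : State → ℕ := fun s' => ∑ j ∈ Finset.Ico (s'.ints i 0) N, (T j + 12)
  have := Ter.loop (b := BExpr.ilt (var i) (var lim))
    (p := body ;; assign i ((var i).add (IExpr.const 1))) (s := s.setInt i 0 0) I Φ
    ⟨by simpa [hil] using hN, 0, Nat.zero_le _, by simp, h0⟩ ?_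
  · refine this.mono ?_ ?_
    · simp [Φ, hb5]
    · rintro s' - ⟨⟨h1, j, hj, h2, h3⟩, h4⟩
      have h4 : ¬ s'.ints i 0 < s'.ints lim 0 := h4
      obtain rfl : j = N := by omega
      exact ⟨h3, h2⟩
  · rintro s' hf ⟨h1, j, hj, h2, h3⟩ hb
    have hb : s'.ints i 0 < s'.ints lim 0 := hb
    have hjN : j < N := by omega
    have := hs j s' hjN (hf1.seq_left.trans (Frame.seq_right ⟨hf.1, hf.2⟩)) h2 h1 h3
    refine ⟨T j + 6, Ter.mono (Ter.seq (T' := 6) this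
      (Q' := fun s'' => I s'' ∧ T j + 6 + 5 + 1 + Φ s'' ≤ Φ s') ?_) le_rfl ?_⟩
    · rintro s2 hf2 hI
      refine Ter.exec rfl le_rfl ?_
      have e2 : s2.ints i 0 = j := by rw [hf2.1 i hi, h2]
      have e3 : (assign i ((var i).add (IExpr.const 1))).exec s2 = s2.setInt i 0 (j + 1) := by
        simp [assign, Prog.exec, var, IExpr.eval, e2]
      rw [e3]
      refine ⟨⟨?_, j + 1, hjN, by simp, hI⟩, ?_⟩
      · simp [hil, hf2.1 lim hl, h1]
      · simp only [Φ, State.setInt_ints, if_true, Function.update_self, h2]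
        rw [← Finset.sum_Ico_consecutive _ (Nat.le_succ j) hjN]
        simp
    · rintro s2 - h
      exact h

theorem Ter.forUp_const {i lim : ℕ} {body : Prog} {s : State} {N : ℕ} (T : ℕ)
    (Inv : ℕ → State → Prop) (hN : s.ints lim 0 = N) (hi : body.wi i = false)
    (hl : body.wi lim = false) (hil : lim ≠ i) (h0 : Inv 0 (s.setInt i 0 0))
    (hs : ∀ j s', j < N → Frame (RealRAM.forUp i lim body) s s' → s'.ints i 0 = j →
      s'.ints lim 0 = N → Inv j s' →
      Ter body s' T fun s'' => Inv (j + 1) (s''.setInt i 0 (j + 1))) :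
    Ter (RealRAM.forUp i lim body) s (N * (T + 12) + 9)
      (fun s' => Inv N s' ∧ s'.ints i 0 = N) := by
  have := Ter.forUp (fun _ => T) Inv hN hi hl hil h0 hs
  simpa using this

end RealRAM

namespace RealRAM

/-! ### Tournament trees

The tree over the leaves `0, …, n - 1` has the nodes `1, …, 2 n - 1`; the children of node `i` are
`2 i` and `2 i + 1`, and leaf `v` is node `n + v`.  Every node holds a leaf below it that has the
smallest key. -/

/-- `j` is `i` or an ancestor of `i`. -/
def AncOf (i j : ℕ) : Prop := ∃ k, j = i / 2 ^ k

/-- The tree is correct outside the nodes in `P`. -/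
structure TreeInv {α : Type} [LinearOrder α] (n : ℕ) (win : ℕ → ℕ) (key : ℕ → α) (P : ℕ → Prop) :
    Prop where
  leaf : ∀ v < n, win (n + v) = v
  anc : ∀ i, 1 ≤ i → i < 2 * n → win i < n ∧ AncOf (n + win i) i
  best : ∀ i, 1 ≤ i → i < n → ¬ P i →
    key (win i) ≤ key (win (2 * i)) ∧ key (win i) ≤ key (win (2 * i + 1))

theorem AncOf.half {i j : ℕ} (h : AncOf i j) : AncOf i (j / 2) := by
  obtain ⟨k, rfl⟩ := h
  exact ⟨k + 1, by rw [pow_succ, Nat.div_div_eq_div_mul]⟩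

theorem AncOf.eq_or {i j : ℕ} (h : AncOf i j) : j = i ∨ AncOf (i / 2) j := by
  obtain ⟨k, rfl⟩ := h
  rcases k with _ | k
  · left; simp
  · right
    exact ⟨k, by rw [pow_succ', Nat.div_div_eq_div_mul]⟩

namespace TreeInv

variable {α : Type} [LinearOrder α] {n : ℕ} {win : ℕ → ℕ} {key key' : ℕ → α}

/-- Only node `i` and its parent look at the entry of `i`. Once `i` is repaired, the possible faults
are confined to the proper ancestors. -/
theorem step {i x : ℕ} (h : TreeInv n win key (AncOf i)) (h1 : 1 ≤ i) (hn : i < n)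
    (hx : x = win (2 * i) ∨ x = win (2 * i + 1))
    (hk : key x ≤ key (win (2 * i)) ∧ key x ≤ key (win (2 * i + 1))) :
    TreeInv n (Function.update win i x) key (AncOf (i / 2)) := by
  refine ⟨fun v hv => ?_, fun j hj hj' => ?_, fun j hj hj' hP => ?_⟩
  · rw [Function.update_of_ne (by omega)]
    exact h.leaf v hv
  · by_cases hji : j = i
    · subst hji
      rw [Function.update_self]
      rcases hx with rfl | rfl
      · obtain ⟨h2, h3⟩ := h.anc (2 * j) (by omega) (by omega)
        refine ⟨h2, ?_⟩
        have := h3.half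
        rwa [Nat.mul_div_cancel_left _ (by norm_num)] at this
      · obtain ⟨h2, h3⟩ := h.anc (2 * j + 1) (by omega) (by omega)
        refine ⟨h2, ?_⟩
        have := h3.half
        rwa [show (2 * j + 1) / 2 = j by omega] at this
    · rw [Function.update_of_ne hji]
      exact h.anc j hj hj'
  · by_cases hji : j = i
    · subst hji
      rw [Function.update_self, Function.update_of_ne (by omega), Function.update_of_ne (by omega)]
      exact hk
    · have hA : ¬ AncOf i j := fun hA => hA.eq_or.elim hji hP
      have hne : i / 2 ≠ j := by
        rintro rfl
        exact hP ⟨0, by simp⟩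
      rw [Function.update_of_ne hji, Function.update_of_ne (by omega),
        Function.update_of_ne (by omega)]
      exact h.best j hj hj' hA

/-- A node holds a leaf below it, so only ancestors of leaf `v` can notice its new key, directly or
through a child. The leaf itself has nothing to compare, so repair starts at its parent. -/
theorem change_key {v : ℕ} (h : TreeInv n win key fun _ => False)
    (hk : ∀ x, x ≠ v → key' x = key x) : TreeInv n win key' (AncOf ((n + v) / 2)) := by
  refine ⟨h.leaf, h.anc, fun j hj hj' hP => ?_⟩
  have hA : ∀ i, 1 ≤ i → i < 2 * n → AncOf i j ∨ (i = j) → win i ≠ v := by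
    rintro i hi hi' hij rfl
    have h1 := (h.anc i hi hi').2
    have h2 : AncOf (n + win i) j := by
      rcases hij with hij | rfl
      · obtain ⟨k, hk⟩ := h1
        obtain ⟨k', rfl⟩ := hij
        exact ⟨k + k', by rw [pow_add, ← Nat.div_div_eq_div_mul, ← hk]⟩
      · exact h1
    rcases h2.eq_or with h3 | h3
    · omega
    · exact hP h3
  have e0 := hA j hj (by omega) (Or.inr rfl)
  have e1 := hA (2 * j) (by omega) (by omega) (Or.inl ⟨1, by omega⟩)
  have e2 := hA (2 * j + 1) (by omega) (by omega) (Or.inl ⟨1, by omega⟩)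
  rw [hk _ e0, hk _ e1, hk _ e2]
  exact h.best j hj hj' id

theorem congr_pred {P Q : ℕ → Prop} (h : TreeInv n win key P)
    (hPQ : ∀ i, 1 ≤ i → i < n → P i → Q i) : TreeInv n win key Q :=
  ⟨h.leaf, h.anc, fun i hi hi' hQ => h.best i hi hi' fun hP => hQ (hPQ i hi hi' hP)⟩

/-- From a leaf to the root, the keys of the winners never increase. -/
theorem root_le (h : TreeInv n win key fun _ => False) {v : ℕ} (hv : v < n) :
    key (win 1) ≤ key v := by
  have H : ∀ j, 1 ≤ j → j < 2 * n → key (win 1) ≤ key (win j) := by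
    intro j
    induction j using Nat.strong_induction_on with
    | _ j ih =>
    intro h1 h2
    rcases Nat.eq_or_lt_of_le h1 with rfl | h1
    · exact le_rfl
    · have h3 := h.best (j / 2) (by omega) (by omega) id
      refine (ih (j / 2) (by omega) (by omega) (by omega)).trans ?_
      rcases Nat.mod_two_eq_zero_or_one j with hj | hj
      · have e : 2 * (j / 2) = j := by omega
        rw [e] at h3; exact h3.1
      · have e : 2 * (j / 2) + 1 = j := by omega
        rw [e] at h3; exact h3.2
  have := H (n + v) (by omega) (by omega)
  rwa [h.leaf v hv] at this

end TreeInv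

/-- The key of a vertex: its label, or `⊤` if it is finished. -/
noncomputable def vkey (dn : ℕ → ℕ) (d : ℕ → ℝ) (v : ℕ) : WithTop ℝ :=
  if dn v = 0 then (d v : WithTop ℝ) else ⊤

/-! ### Programs for tournament trees

Working memory: the scalars `10`, `11` are the numbers of vertices and edges; the arrays `12`, `13`,
`14` of natural numbers and `10` of real numbers hold tails, heads, classification and weights;
`15` and `16` hold the adjacency lists (`0` is the end of a list, `e + 1` the edge `e`), `17` the
numbers `⌊i / 2⌋`, `18` the tree, `19` marks the finished vertices; the arrays `11` and `12` of real
numbers hold the labels and a copy of them. -/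

/-- Recompute the tree node held by the scalar `23`. -/
def recompute : Prog :=
  assign 24 (.load 18 ((var 23).add (var 23))) ;;
  assign 25 (.load 18 (((var 23).add (var 23)).add (.const 1))) ;;
  .ite (.and (.ilt (.load 19 (var 24)) (.const 1))
      (.not (.and (.ilt (.load 19 (var 25)) (.const 1))
        (.rlt (.load 11 (var 25)) (.load 11 (var 24))))))
    (.iset 18 (var 23) (var 24)) (.iset 18 (var 23) (var 25))

theorem recompute_spec (s : State) :
    Ter recompute s 60 fun s' => s'.ints 23 = s.ints 23 ∧
      ∃ x, s'.ints 18 = Function.update (s.ints 18) (s.ints 23 0) x ∧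
      (x = s.ints 18 (2 * s.ints 23 0) ∨ x = s.ints 18 (2 * s.ints 23 0 + 1)) ∧
      (vkey (s.ints 19) (s.reals 11) x ≤
        vkey (s.ints 19) (s.reals 11) (s.ints 18 (2 * s.ints 23 0)) ∧
       vkey (s.ints 19) (s.reals 11) x ≤
        vkey (s.ints 19) (s.reals 11) (s.ints 18 (2 * s.ints 23 0 + 1))) := by
  refine Ter.exec rfl (by decide) ?_
  simp only [recompute, assign, Prog.exec, BExpr.Holds, IExpr.eval, RExpr.eval, eval_var]
  simp only [State.setInt_ints, State.setInt_reals, Nat.reduceEqDiff, if_true, if_false,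
    Function.update_self, ← two_mul]
  set l := s.ints 18 (2 * s.ints 23 0)
  set q := s.ints 18 (2 * s.ints 23 0 + 1)
  split_ifs with h
  · refine ⟨by simp, l, by simp, Or.inl rfl, le_rfl, ?_⟩
    obtain ⟨h1, h2⟩ := h
    have h1 : s.ints 19 l = 0 := by omega
    by_cases h3 : s.ints 19 q = 0
    · have : ¬ s.reals 11 q < s.reals 11 l := fun h4 => h2 ⟨by omega, h4⟩
      simp only [vkey, h1, h3, if_true]
      exact WithTop.coe_le_coe.2 (not_lt.1 this)
    · simp [vkey, h3]
  · refine ⟨by simp, q, by simp, Or.inr rfl, ?_, le_rfl⟩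
    by_cases h3 : s.ints 19 l = 0
    · rw [not_and, not_not] at h
      obtain ⟨h4, h5⟩ := h (by omega)
      have h4 : s.ints 19 q = 0 := by omega
      simp only [vkey, h3, h4, if_true]
      exact WithTop.coe_le_coe.2 h5.le
    · simp [vkey, h3]

/-- Recompute the tree node held by the scalar `23` and all its ancestors. -/
def climb : Prog :=
  .loop (.ilt (.const 0) (var 23)) (recompute ;; assign 23 (.load 17 (var 23)))

/-- The bit length of the node is the potential that makes a climb logarithmic. -/
theorem size_half_lt {i : ℕ} (hi : 0 < i) : Nat.size (i / 2) + 1 ≤ Nat.size i := by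
  have h1 : 0 < Nat.size i := Nat.size_pos.2 hi
  obtain ⟨S, hS⟩ := Nat.exists_eq_add_of_lt h1
  have h2 := Nat.lt_size_self i
  rw [hS, zero_add, pow_succ] at h2
  have : Nat.size (i / 2) ≤ S := Nat.size_le.2 (by omega)
  omega

theorem climb_spec {s : State} {n : ℕ} (hh : ∀ i < 2 * n, s.ints 17 i = i / 2)
    (hn : s.ints 23 0 < n)
    (ht : TreeInv n (s.ints 18) (vkey (s.ints 19) (s.reals 11)) (AncOf (s.ints 23 0))) :
    Ter climb s (80 * Nat.size n + 10) fun s' =>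
      TreeInv n (s'.ints 18) (vkey (s.ints 19) (s.reals 11)) fun _ => False := by
  have hc : (BExpr.ilt (.const 0) (var 23)).cost = 4 := rfl
  refine (Ter.loop (fun s' => s'.ints 23 0 < n ∧
    TreeInv n (s'.ints 18) (vkey (s.ints 19) (s.reals 11)) (AncOf (s'.ints 23 0)))
    (fun s' => 80 * Nat.size (s'.ints 23 0)) ⟨hn, ht⟩ ?_).mono ?_ ?_
  · rintro s1 hf ⟨h1, h2⟩ hb
    have hb : 0 < s1.ints 23 0 := hb
    refine ⟨70, ((recompute_spec s1).seq (T' := 10) ?_).mono (by norm_num) fun _ _ h => h⟩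
    rintro s2 hf2 ⟨h3, x, h4, h5, h6⟩
    refine Ter.exec rfl (by decide) ?_
    simp only [assign, Prog.exec, IExpr.eval, eval_var, State.setInt_ints, Nat.reduceEqDiff, if_true,
      if_false, Function.update_self, hc]
    rw [hf2.1 17 rfl, hf.1 17 rfl, h3, hh _ (by omega), h4]
    have e1 := hf.1 19 rfl
    have e2 := hf.2 11 rfl
    rw [e1, e2] at h6
    refine ⟨⟨by omega, h2.step hb h1 h5 h6⟩, ?_⟩
    have := size_half_lt hb
    omega
  · have := Nat.size_le_size hn.le
    rw [hc]; omega
  · rintro s' - ⟨⟨h1, h2⟩, h3⟩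
    have h3 : ¬ 0 < s'.ints 23 0 := h3
    -- The climb has ended at `0`, for which `AncOf` yields only `0` itself; hence no node of the
    -- tree is exempt any more.
    refine h2.congr_pred ?_
    rintro i hi - ⟨k, hk⟩
    rw [show s'.ints 23 0 = 0 by omega, Nat.zero_div] at hk
    omega

end RealRAM

namespace RealRAM

/-! ### Adjacency lists -/

/-- The linked list that starts at `h` consists of the edges in the list. -/
def Chain (nx : ℕ → ℕ) : ℕ → List ℕ → Prop
  | h, [] => h = 0
  | h, e :: L => h = e + 1 ∧ Chain nx (nx e) L

/-- The edges `e < m` that leave `v`, in decreasing order. -/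
def adj (src : ℕ → ℕ) (v : ℕ) : ℕ → List ℕ
  | 0 => []
  | m + 1 => if src m = v then m :: adj src v m else adj src v m

theorem mem_adj {src : ℕ → ℕ} {v m e : ℕ} : e ∈ adj src v m ↔ e < m ∧ src e = v := by
  induction m with
  | zero => simp [adj]
  | succ m ih =>
    rw [adj]
    split_ifs with h
    · rw [List.mem_cons, ih]
      constructor
      · rintro (rfl | h1)
        · exact ⟨by omega, h⟩
        · exact ⟨by omega, h1.2⟩
      · rintro ⟨h1, h2⟩
        rcases Nat.lt_succ_iff_lt_or_eq.1 h1 with h3 | h3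
        · exact Or.inr ⟨h3, h2⟩
        · exact Or.inl h3
    · rw [ih]
      constructor
      · rintro ⟨h1, h2⟩; exact ⟨by omega, h2⟩
      · rintro ⟨h1, h2⟩
        refine ⟨?_, h2⟩
        rcases Nat.lt_succ_iff_lt_or_eq.1 h1 with h3 | h3
        · exact h3
        · subst h3; exact absurd h2 h

theorem sum_length_adj {src : ℕ → ℕ} {n m : ℕ} (h : ∀ e < m, src e < n) :
    ∑ v ∈ Finset.range n, (adj src v m).length = m := by
  induction m with
  | zero => simp [adj]
  | succ m ih =>
    have e1 : ∀ v, (adj src v (m + 1)).length =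
        (adj src v m).length + if src m = v then 1 else 0 := by
      intro v; rw [adj]; split_ifs <;> simp
    simp only [e1, Finset.sum_add_distrib, Finset.sum_ite_eq]
    rw [ih fun e he => h e (by omega), if_pos (Finset.mem_range.2 (h m (by omega)))]

theorem Chain.update {nx : ℕ → ℕ} {h e x : ℕ} {L : List ℕ} (hc : Chain nx h L) (he : e ∉ L) :
    Chain (Function.update nx e x) h L := by
  induction L generalizing h with
  | nil => exact hc
  | cons a L ih =>
    obtain ⟨h1, h2⟩ := hc
    simp only [List.mem_cons, not_or] at he
    refine ⟨h1, ?_⟩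
    rw [Function.update_of_ne (Ne.symm he.1)]
    exact ih h2 he.2

/-! ### The invariant of Dijkstra's algorithm -/

/-- The invariant of Dijkstra's algorithm for the initial labels `a`, the finished vertices `dn` and
the labels `d`, where the edges in `P` have yet to be relaxed. -/
structure DInv (n m : ℕ) (src dst fl : ℕ → ℕ) (w a : ℕ → ℝ) (dn : ℕ → ℕ) (d : ℕ → ℝ)
    (P : ℕ → Prop) : Prop where
  low : ∀ f : ℕ → ℝ, (∀ v < n, f v ≤ a v) →
    (∀ e < m, fl e = 0 → f (dst e) ≤ f (src e) + w e) → ∀ v < n, f v ≤ d v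
  le : ∀ v < n, d v ≤ a v
  ord : ∀ x < n, ∀ y < n, dn x ≠ 0 → dn y = 0 → d x ≤ d y
  feas : ∀ e < m, fl e = 0 → dn (src e) ≠ 0 → ¬ P e → d (dst e) ≤ d (src e) + w e

namespace DInv

variable {n m : ℕ} {src dst fl : ℕ → ℕ} {w a : ℕ → ℝ} {dn : ℕ → ℕ} {d : ℕ → ℝ} {P : ℕ → Prop}

/-- The labels stay, so only the order and the feasibility are at stake. Minimality of `u` preserves
the order and makes `u` maximal among the finished vertices; the edges leaving `u` become pending.
-/
theorem pick (h : DInv n m src dst fl w a dn d fun _ => False) {u : ℕ} (hu : u < n)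
    (hdu : dn u = 0) (hmin : ∀ y < n, dn y = 0 → d u ≤ d y) :
    DInv n m src dst fl w a (Function.update dn u 1) d (fun e => e ∈ adj src u m) ∧
      ∀ x < n, Function.update dn u 1 x ≠ 0 → d x ≤ d u := by
  refine ⟨⟨h.low, h.le, fun x hx y hy h1 h2 => ?_, fun e he hf h1 h2 => ?_⟩, fun x hx h1 => ?_⟩
  · rw [Function.update_apply] at h1 h2
    split_ifs at h2 with hyu
    split_ifs at h1 with hxu
    · rw [hxu]; exact hmin y hy h2
    · exact h.ord x hx y hy h1 h2
  · have : src e ≠ u := fun hs => h2 (mem_adj.2 ⟨he, hs⟩)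
    rw [Function.update_of_ne this] at h1
    exact h.feas e he hf h1 id
  · rw [Function.update_apply] at h1
    split_ifs at h1 with hxu
    · rw [hxu]
    · exact h.ord x hx u hu h1 hdu

theorem skip {e : ℕ} {L : List ℕ} (h : DInv n m src dst fl w a dn d fun e' => e' ∈ e :: L)
    (he : fl e = 0 → d (dst e) ≤ d (src e) + w e) :
    DInv n m src dst fl w a dn d fun e' => e' ∈ L := by
  refine ⟨h.low, h.le, h.ord, fun e' he' hf h1 h2 => ?_⟩
  by_cases hee : e' = e
  · subst hee; exact he hf
  · exact h.feas e' he' hf h1 (by simp [hee, h2])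

/-- Finished labels are at most `d u`, hence at most `d u + w e` as `w e` is nonnegative, so a
strict improvement can only hit an unfinished head. The new label is still at least `d u`, which
preserves the order. A competitor `f` has `f (dst e) ≤ f u + w e ≤ d u + w e`, which preserves
`low`. -/
theorem relax {e u : ℕ} {L : List ℕ} (h : DInv n m src dst fl w a dn d fun e' => e' ∈ e :: L)
    (hu : u < n) (hmax : ∀ x < n, dn x ≠ 0 → d x ≤ d u) (hem : e < m) (hf : fl e = 0)
    (hw : 0 ≤ w e) (hse : src e = u) (hde : dst e < n) (hlt : d u + w e < d (dst e)) :
    dn (dst e) = 0 ∧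
    DInv n m src dst fl w a dn (Function.update d (dst e) (d u + w e)) (fun e' => e' ∈ L) := by
  have h0 : dn (dst e) = 0 := by
    by_contra h0
    linarith [hmax _ hde h0]
  have hle : ∀ v, Function.update d (dst e) (d u + w e) v ≤ d v := by
    intro v
    rw [Function.update_apply]
    split_ifs with hv
    · rw [hv]; exact hlt.le
    · exact le_rfl
  refine ⟨h0, ⟨fun f h1 h2 v hv => ?_, fun v hv => (hle v).trans (h.le v hv),
    fun x hx y hy h1 h2 => ?_, fun e' he' hf' h1 h2 => ?_⟩⟩
  · rw [Function.update_apply]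
    split_ifs with hvd
    · rw [hvd]
      have := h2 e hem hf
      rw [hse] at this
      linarith [h.low f h1 h2 u hu]
    · exact h.low f h1 h2 v hv
  · have hx' : x ≠ dst e := by rintro rfl; exact h1 h0
    rw [Function.update_of_ne hx', Function.update_apply]
    split_ifs with hy'
    · linarith [hmax x hx h1]
    · exact h.ord x hx y hy h1 h2
  · have hx' : src e' ≠ dst e := by intro h3; rw [h3] at h1; exact h1 h0
    rw [Function.update_of_ne hx']
    by_cases hee : e' = e
    · subst hee
      rw [Function.update_self, hse]
    · exact (hle _).trans (h.feas e' he' hf' h1 (by simp [hee, h2]))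

end DInv

/-! ### Dijkstra's algorithm -/

/-- The working graph: it has `n` vertices and `m` edges. -/
structure Work (s : State) (n m : ℕ) : Prop where
  pos : 0 < n
  verts : s.ints 10 0 = n
  edges : s.ints 11 0 = m
  src : ∀ e < m, s.ints 12 e < n
  dst : ∀ e < m, s.ints 13 e < n
  nonneg : ∀ e < m, s.ints 14 e = 0 → 0 ≤ s.reals 10 e

theorem Work.frame {p : Prog} {s s' : State} {n m : ℕ} (h : Work s n m) (hf : Frame p s s')
    (hp : (p.wi 10 || p.wi 11 || p.wi 12 || p.wi 13 || p.wi 14 || p.wr 10) = false) :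
    Work s' n m := by
  simp only [Bool.or_eq_false_iff] at hp
  obtain ⟨⟨⟨⟨⟨h0, h1⟩, h2⟩, h3⟩, h4⟩, h5⟩ := hp
  obtain ⟨k0, k1, k2, k3, k4, k5⟩ := h
  exact ⟨k0, by rw [hf.1 _ h0, k1], by rw [hf.1 _ h1, k2], by rwa [hf.1 _ h2],
    by rwa [hf.1 _ h3], by rwa [hf.1 _ h4, hf.2 _ h5]⟩

/-- Relax the edge held by the scalar `20`, whose tail is the scalar `22`. -/
def relaxEdge : Prog :=
  .ite (.and (.ilt (.load 14 (var 20)) (.const 1))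
      (.rlt (.add (.load 11 (var 22)) (.load 10 (var 20))) (.load 11 (.load 13 (var 20)))))
    (.rset 11 (.load 13 (var 20)) (.add (.load 11 (var 22)) (.load 10 (var 20))) ;;
      assign 23 (.load 17 ((var 10).add (.load 13 (var 20)))) ;; climb)
    .skip

/-- Relax the edges in the adjacency list that starts at the scalar `26`. -/
def relaxList : Prog :=
  .loop (.ilt (.const 0) (var 26))
    (assign 20 ((var 26).sub (.const 1)) ;; relaxEdge ;; assign 26 (.load 16 (var 20)))

/-- The arrays that Dijkstra's algorithm does not change. -/
structure Static (s0 s : State) : Prop where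
  ints : ∀ a < 18, 10 ≤ a → s.ints a = s0.ints a
  real : s.reals 10 = s0.reals 10

theorem Static.frame {p : Prog} {s0 s s' : State} (h : Static s0 s) (hf : Frame p s s')
    (hi : ∀ a < 18, 10 ≤ a → p.wi a = false) (hr : p.wr 10 = false) : Static s0 s' :=
  ⟨fun a h1 h2 => (hf.1 a (hi a h1 h2)).trans (h.ints a h1 h2), (hf.2 10 hr).trans h.real⟩

/-- The state during Dijkstra's algorithm, with respect to the state `s0` at its start. -/
structure DState (n m : ℕ) (s0 s : State) (P : ℕ → Prop) : Prop where
  stat : Static s0 s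
  inv : DInv n m (s0.ints 12) (s0.ints 13) (s0.ints 14) (s0.reals 10) (s0.reals 11) (s.ints 19)
    (s.reals 11) P
  tree : TreeInv n (s.ints 18) (vkey (s.ints 19) (s.reals 11)) fun _ => False

/-- The vertex `u` is finished, and no finished vertex has a larger label. -/
structure Last (n : ℕ) (s : State) (u : ℕ) : Prop where
  lt : u < n
  done : s.ints 19 u ≠ 0
  max : ∀ x < n, s.ints 19 x ≠ 0 → s.reals 11 x ≤ s.reals 11 u

theorem relaxEdge_spec {n m : ℕ} {s0 s : State} {e u : ℕ} {L : List ℕ} (hW : Work s0 n m)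
    (hh : ∀ i < 2 * n, s0.ints 17 i = i / 2) (hD : DState n m s0 s fun e' => e' ∈ e :: L)
    (hu : Last n s u) (h20 : s.ints 20 0 = e) (h22 : s.ints 22 0 = u) (he : e < m)
    (hse : s0.ints 12 e = u) :
    Ter relaxEdge s (80 * Nat.size n + 70) fun s' =>
      DState n m s0 s' (fun e' => e' ∈ L) ∧ Last n s' u := by
  have e10 := hD.stat.ints 10 (by norm_num) (by norm_num)
  have e13 := hD.stat.ints 13 (by norm_num) (by norm_num)
  have e14 := hD.stat.ints 14 (by norm_num) (by norm_num)
  have e17 := hD.stat.ints 17 (by norm_num) (by norm_num)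
  have ew := hD.stat.real
  refine (Ter.ite (T := 80 * Nat.size n + 50) (fun hb => ?_) (fun hb => ?_)).mono
    (by simp only [BExpr.cost, IExpr.cost, RExpr.cost, var]; omega) fun _ _ h => h
  · simp only [BExpr.Holds, IExpr.eval, RExpr.eval, eval_var, h20, h22, e14, e13, ew] at hb
    obtain ⟨hb1, hb2⟩ := hb
    have hf0 : s0.ints 14 e = 0 := by omega
    obtain ⟨h0, hI⟩ := hD.inv.relax hu.lt hu.max he hf0 (hW.nonneg e he hf0) hse (hW.dst e he) hb2
    have hne : u ≠ s0.ints 13 e := fun h => hu.done (by rw [h]; exact h0)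
    -- Lowering one label can spoil the tree only from the parent of that leaf upwards, which is the
    -- path that `climb` repairs.
    have hT := hD.tree.change_key (v := s0.ints 13 e) (key' := vkey (s.ints 19)
      (Function.update (s.reals 11) (s0.ints 13 e) (s.reals 11 u + s0.reals 10 e))) (by
        intro x hx
        simp [vkey, Function.update_of_ne hx])
    refine (Ter.seq (T := 12) (Q := fun s1 => s1 = s.setReal 11 (s0.ints 13 e)
      (s.reals 11 u + s0.reals 10 e)) ?_ (T' := 80 * Nat.size n + 30) ?_).mono (by omega)
      fun _ _ h => h
    · refine Ter.exec rfl (by decide) ?_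
      simp only [Prog.exec, IExpr.eval, RExpr.eval, eval_var, h20, h22, e13, ew]
    rintro s1 hf1 rfl
    refine (Ter.seq (T := 20) (Q := fun s2 => s2 = (s.setReal 11 (s0.ints 13 e)
      (s.reals 11 u + s0.reals 10 e)).setInt 23 0 ((n + s0.ints 13 e) / 2)) ?_
      (T' := 80 * Nat.size n + 10) ?_).mono (by omega) fun _ _ h => h
    · refine Ter.exec rfl (by decide) ?_
      have := hW.dst e he
      simp only [assign, Prog.exec, IExpr.eval, eval_var, State.setReal_ints, h20, e13,
        e10, e17, hW.verts]
      rw [hh _ (by omega)]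
    rintro s2 hf2 rfl
    refine (climb_spec (n := n) ?_ ?_ ?_).mono le_rfl ?_
    · simpa [e17] using hh
    · have := hW.dst e he
      simp; omega
    · simpa using hT
    · intro s3 hf3 hT3
      have e19 : s3.ints 19 = s.ints 19 := by rw [hf3.1 19 rfl]; simp
      have e11 : s3.reals 11 = Function.update (s.reals 11) (s0.ints 13 e)
          (s.reals 11 u + s0.reals 10 e) := by rw [hf3.2 11 rfl]; simp
      refine ⟨⟨?_, ?_, ?_⟩, ⟨hu.lt, ?_, ?_⟩⟩
      · exact ((hD.stat.frame hf1 (by decide) rfl).frame hf2 (by decide) rfl).frame hf3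
          (by decide) rfl
      · rw [e19, e11]; exact hI
      · rw [e19, e11]; simpa using hT3
      · rw [e19]; exact hu.done
      · rw [e19, e11]
        intro x hx hx'
        have : x ≠ s0.ints 13 e := by rintro rfl; exact hx' h0
        rw [Function.update_of_ne this, Function.update_of_ne hne]
        exact hu.max x hx hx'
  · refine Ter.exec rfl (by simp [Prog.cost]) ?_
    simp only [Prog.exec]
    refine ⟨⟨hD.stat, hD.inv.skip fun hf => ?_, hD.tree⟩, hu⟩
    simp only [BExpr.Holds, IExpr.eval, RExpr.eval, eval_var, h20, h22, e14, e13, ew, hf] at hb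
    rw [hse]
    by_contra hlt
    exact hb ⟨by norm_num, not_le.1 hlt⟩

/-- Relaxations never change a finished label, so `u` remains the last finished vertex along the
whole list, which is the induction hypothesis. -/
theorem relaxList_spec {n m : ℕ} {s0 s : State} {u : ℕ} {L : List ℕ} (hW : Work s0 n m)
    (hh : ∀ i < 2 * n, s0.ints 17 i = i / 2) (hD : DState n m s0 s fun e' => e' ∈ L)
    (hu : Last n s u) (h22 : s.ints 22 0 = u) (hL : ∀ e ∈ L, e < m ∧ s0.ints 12 e = u)
    (hc : Chain (s0.ints 16) (s.ints 26 0) L) :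
    Ter relaxList s (L.length * (80 * Nat.size n + 100) + 10) fun s' =>
      DState n m s0 s' fun _ => False := by
  induction L generalizing s with
  | nil =>
    have hc : s.ints 26 0 = 0 := hc
    refine (Ter.loop_nil (Q := fun s' => DState n m s0 s' fun _ => False) ?_ ?_).mono
      (by simp only [BExpr.cost, IExpr.cost, var]; omega) fun _ _ h => h
    · simp [BExpr.Holds, IExpr.eval, eval_var, hc]
    · exact ⟨hD.stat, by simpa using hD.inv, hD.tree⟩
  | cons e L ih =>
    obtain ⟨h1, h2⟩ := hc
    have hL' := hL e List.mem_cons_self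
    have hbc : (BExpr.ilt (.const 0) (var 26)).cost = 4 := rfl
    refine (Ter.loop_cons (T := 80 * Nat.size n + 90) (Q := fun s' => DState n m s0 s'
      (fun e' => e' ∈ L) ∧ Last n s' u ∧ s'.ints 26 0 = s0.ints 16 e)
      (T' := L.length * (80 * Nat.size n + 100) + 10) ?_ ?_ ?_).mono ?_ fun _ _ h => h
    · simp [BExpr.Holds, IExpr.eval, eval_var, h1]
    · refine (Ter.seq (T := 6) (Q := fun s1 => s1 = s.setInt 20 0 e) (Ter.exec rfl (by decide) ?_)
        (T' := 80 * Nat.size n + 80) ?_).mono (by omega) fun _ _ h => h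
      · simp [assign, Prog.exec, IExpr.eval, eval_var, h1]
      rintro s1 hf1 rfl
      refine (Ter.seq (relaxEdge_spec (L := L) hW hh (s := s.setInt 20 0 e) (e := e) (u := u)
        ⟨hD.stat.frame hf1 (by decide) rfl, by simpa using hD.inv, by simpa using hD.tree⟩
        ⟨hu.lt, by simpa using hu.done, by simpa using hu.max⟩ (by simp) (by simp [h22]) hL'.1
        hL'.2) (T' := 10) ?_).mono (by omega) fun _ _ h => h
      rintro s2 hf2 ⟨h3, h4⟩
      have e20 : s2.ints 20 0 = e := by rw [hf2.1 20 rfl]; simp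
      have e16 := h3.stat.ints 16 (by norm_num) (by norm_num)
      refine Ter.exec rfl (by decide) ?_
      simp only [assign, Prog.exec, IExpr.eval, eval_var, e20, e16]
      refine ⟨⟨?_, by simpa using h3.inv, by simpa using h3.tree⟩,
        ⟨hu.lt, by simpa using h4.done, by simpa using h4.max⟩, by simp⟩
      exact ⟨fun a ha ha' => by
        rw [State.setInt_ints, if_neg (by omega)]; exact h3.stat.ints a ha ha', h3.stat.real⟩
    · rintro s1 hf1 ⟨h3, h4, h5⟩
      refine ih h3 h4 ?_ (fun e' he' => hL e' (List.mem_cons_of_mem _ he')) (by rwa [h5])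
      rw [hf1.1 22 rfl, h22]
    · rw [List.length_cons, hbc, Nat.add_mul L.length 1, one_mul]; omega

/-- The main loop: finish the vertex with the smallest label until all vertices are finished. -/
def mainLoop : Prog :=
  .loop (.ilt (.load 19 (.load 18 (.const 1))) (.const 1))
    (assign 22 (.load 18 (.const 1)) ;; .iset 19 (var 22) (.const 1) ;;
      assign 23 (.load 17 ((var 10).add (var 22))) ;; climb ;;
      assign 26 (.load 15 (var 22)) ;; relaxList)

theorem mainLoop_spec {n m : ℕ} {s0 s : State} (hW : Work s0 n m)
    (hh : ∀ i < 2 * n, s0.ints 17 i = i / 2)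
    (hc : ∀ v < n, Chain (s0.ints 16) (s0.ints 15 v) (adj (s0.ints 12) v m))
    (hD : DState n m s0 s fun _ => False) :
    Ter mainLoop s ((n + m) * (160 * Nat.size n + 200) + 10) fun s' =>
      DState n m s0 s' (fun _ => False) ∧ ∀ v < n, s'.ints 19 v ≠ 0 := by
  set Z := 80 * Nat.size n + 100 with hZ
  have hbc : (BExpr.ilt (.load 19 (.load 18 (.const 1))) (.const 1)).cost = 5 := rfl
  -- Every unfinished vertex is charged `Z` for its own turn and `Z` for each outgoing edge. The
  -- adjacency lists partition the edges, so the potential never exceeds `(n + m) * Z`.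
  let c : ℕ → ℕ := fun v => (adj (s0.ints 12) v m).length * Z + Z
  let Φ : State → ℕ := fun s' => ∑ v ∈ Finset.range n, if s'.ints 19 v = 0 then c v else 0
  refine (Ter.loop (fun s' => DState n m s0 s' fun _ => False) Φ hD ?_).mono ?_ ?_
  · intro s1 hf1 h1 hb
    set u := s1.ints 18 1 with hu
    have hdu : s1.ints 19 u = 0 := by
      have : s1.ints 19 u < 1 := hb
      omega
    have hun : u < n := (h1.tree.anc 1 le_rfl (by have := hW.pos; omega)).1
    have hmin : ∀ y < n, s1.ints 19 y = 0 → s1.reals 11 u ≤ s1.reals 11 y := by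
      intro y hy hy'
      have := h1.tree.root_le hy
      simpa [vkey, ← hu, hdu, hy'] using this
    obtain ⟨hI, hmax⟩ := h1.inv.pick hun hdu hmin
    have hT := h1.tree.change_key (v := u)
      (key' := vkey (Function.update (s1.ints 19) u 1) (s1.reals 11)) (by
        intro x hx
        simp [vkey, Function.update_of_ne hx])
    have e10 := h1.stat.ints 10 (by norm_num) (by norm_num)
    have e15 := h1.stat.ints 15 (by norm_num) (by norm_num)
    have e17 := h1.stat.ints 17 (by norm_num) (by norm_num)
    refine ⟨(adj (s0.ints 12) u m).length * Z + (80 * Nat.size n + 70), ?_⟩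
    refine (Ter.seq (T := 4) (Q := fun s2 => s2 = s1.setInt 22 0 u) (Ter.exec rfl (by decide) ?_)
      (T' := (adj (s0.ints 12) u m).length * Z + (80 * Nat.size n + 60)) ?_).mono (by omega)
      fun _ _ h => h
    · simp [assign, Prog.exec, IExpr.eval, hu]
    rintro s2 hf2 rfl
    refine (Ter.seq (T := 4) (Q := fun s3 => s3 = (s1.setInt 22 0 u).setInt 19 u 1)
      (Ter.exec rfl (by decide) ?_)
      (T' := (adj (s0.ints 12) u m).length * Z + (80 * Nat.size n + 50)) ?_).mono (by omega)
      fun _ _ h => h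
    · simp [Prog.exec, IExpr.eval, eval_var]
    rintro s3 hf3 rfl
    refine (Ter.seq (T := 10) (Q := fun s4 => s4 = ((s1.setInt 22 0 u).setInt 19 u 1).setInt 23 0
      ((n + u) / 2)) (Ter.exec rfl (by decide) ?_)
      (T' := (adj (s0.ints 12) u m).length * Z + (80 * Nat.size n + 40)) ?_).mono (by omega)
      fun _ _ h => h
    · simp only [assign, Prog.exec, IExpr.eval, eval_var, State.setInt_ints, Nat.reduceEqDiff,
        if_true, if_false, e10, e17, hW.verts, Function.update_self]
      rw [hh _ (by omega)]
    rintro s4 hf4 rfl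
    refine (Ter.seq (climb_spec (n := n) ?_ ?_ ?_)
      (T' := (adj (s0.ints 12) u m).length * Z + 20) ?_).mono (by omega) fun _ _ h => h
    · simpa [e17] using hh
    · simp; omega
    · simpa using hT
    rintro s5 hf5 hT5
    have e19 : s5.ints 19 = Function.update (s1.ints 19) u 1 := by rw [hf5.1 19 rfl]; simp
    have e11 : s5.reals 11 = s1.reals 11 := by rw [hf5.2 11 rfl]; simp
    have e22 : s5.ints 22 0 = u := by rw [hf5.1 22 rfl]; simp
    have st5 := (((h1.stat.frame hf2 (by decide) rfl).frame hf3 (by decide) rfl).frame hf4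
      (by decide) rfl).frame hf5 (by decide) rfl
    have e15 := st5.ints 15 (by norm_num) (by norm_num)
    refine (Ter.seq (T := 5) (Q := fun s6 => s6 = s5.setInt 26 0 (s0.ints 15 u))
      (Ter.exec rfl (by decide) ?_)
      (T' := (adj (s0.ints 12) u m).length * Z + 10) ?_).mono (by omega) fun _ _ h => h
    · simp [assign, Prog.exec, IExpr.eval, eval_var, e22, e15]
    rintro s6 hf6 rfl
    refine (relaxList_spec (u := u) hW hh (L := adj (s0.ints 12) u m)
      ⟨st5.frame hf6 (by decide) rfl, ?_, ?_⟩ ⟨hun, ?_, ?_⟩ ?_ ?_ ?_).mono (by rw [← hZ]) ?_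
    · simpa [e19, e11] using hI
    · simpa [e19, e11] using hT5
    · simp [e19]
    · simpa [e19, e11] using hmax
    · simpa using e22
    · exact fun e he => mem_adj.1 he
    · simpa using hc u hun
    · intro s7 hf7 h7
      refine ⟨h7, ?_⟩
      have e19' : s7.ints 19 = Function.update (s1.ints 19) u 1 := by
        rw [hf7.1 19 rfl]; simpa using e19
      have hur : u ∈ Finset.range n := Finset.mem_range.2 hun
      simp only [Φ]
      rw [← Finset.add_sum_erase _ _ hur, ← Finset.add_sum_erase (Finset.range n) (fun v =>
        if s1.ints 19 v = 0 then c v else 0) hur]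
      have : ∀ v ∈ (Finset.range n).erase u, (if s7.ints 19 v = 0 then c v else 0) =
          if s1.ints 19 v = 0 then c v else 0 := by
        intro v hv
        rw [e19', Function.update_of_ne (Finset.ne_of_mem_erase hv)]
      rw [Finset.sum_congr rfl this, e19', hbc]
      simp only [Function.update_self, hdu, if_true, c]
      simp only [one_ne_zero, if_false]
      omega
  · have : Φ s ≤ (n + m) * Z := by
      calc Φ s ≤ ∑ v ∈ Finset.range n, c v := by
            refine Finset.sum_le_sum fun v _ => ?_
            split_ifs <;> simp
        _ = (n + m) * Z := by
            simp only [c, Finset.sum_add_distrib, ← Finset.sum_mul, sum_length_adj hW.src]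
            simp; ring
    rw [hbc]
    have h2 : (n + m) * Z ≤ (n + m) * (160 * Nat.size n + 200) :=
      Nat.mul_le_mul_left _ (by omega)
    omega
  · rintro s1 hf1 ⟨h1, hb⟩
    refine ⟨h1, fun v hv hv' => ?_⟩
    have hb : ¬ s1.ints 19 (s1.ints 18 1) < 1 := hb
    have := h1.tree.root_le hv
    have h0 : s1.ints 19 (s1.ints 18 1) ≠ 0 := by omega
    -- The winner at the root is finished, so the smallest key is `⊤`, which an unfinished vertex
    -- would undercut.
    simp [vkey, hv', h0] at this

end RealRAM

namespace RealRAM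

/-! ### One round: relax the negative edges, then run Dijkstra's algorithm -/

/-- Copy the labels to array `12`. -/
def snapshot : Prog := forUp 21 10 (.rset 12 (var 21) (.load 11 (var 21)))

theorem snapshot_spec {n m : ℕ} {s : State} (hW : Work s n m) :
    Ter snapshot s (n * 30 + 9) fun s' => ∀ v < n, s'.reals 12 v = s.reals 11 v := by
  refine (Ter.forUp_const 18 (fun j s' => ∀ v < j, s'.reals 12 v = s.reals 11 v) hW.verts rfl rfl
    (by norm_num) (by simp) ?_).mono (by omega) fun _ _ h => h.1
  rintro j s1 hj hf h21 - hI
  refine Ter.exec rfl (by decide) ?_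
  simp only [Prog.exec, RExpr.eval, eval_var, h21, State.setInt_reals,
    State.setReal_reals, if_true, hf.2 11 rfl]
  intro v hv
  rw [Function.update_apply]
  split_ifs with h
  · rw [h]
  · exact hI v (by omega)

/-- Relax the negative edges, with the labels of the tails taken from array `12`. -/
def relaxNeg : Prog :=
  forUp 20 11 (.ite (.and (.ilt (.const 0) (.load 14 (var 20)))
      (.rlt (.add (.load 12 (.load 12 (var 20))) (.load 10 (var 20)))
        (.load 11 (.load 13 (var 20)))))
    (.rset 11 (.load 13 (var 20)) (.add (.load 12 (.load 12 (var 20))) (.load 10 (var 20))))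
    .skip)

/-- `d` is the greatest function that is at most `a` and respects the negative edges. -/
structure NegRel (n m : ℕ) (src dst fl : ℕ → ℕ) (w a d : ℕ → ℝ) : Prop where
  le : ∀ v < n, d v ≤ a v
  neg : ∀ e < m, fl e ≠ 0 → d (dst e) ≤ a (src e) + w e
  low : ∀ f : ℕ → ℝ, (∀ v < n, f v ≤ a v) →
    (∀ e < m, fl e ≠ 0 → f (dst e) ≤ a (src e) + w e) → ∀ v < n, f v ≤ d v

/-- The bound that an edge imposes involves only the old labels `a`, so the edges can be processed
one at a time in any order. -/
theorem NegRel.step {n m : ℕ} {src dst fl : ℕ → ℕ} {w a d d' : ℕ → ℝ}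
    (h : NegRel n m src dst fl w a d) (h1 : ∀ v, d' v ≤ d v)
    (h2 : fl m ≠ 0 → d' (dst m) ≤ a (src m) + w m)
    (h3 : ∀ v, d' v = d v ∨ (v = dst m ∧ fl m ≠ 0 ∧ d' v = a (src m) + w m)) :
    NegRel n (m + 1) src dst fl w a d' := by
  refine ⟨fun v hv => (h1 v).trans (h.le v hv), fun e he hf => ?_, fun f h4 h5 v hv => ?_⟩
  · rcases Nat.lt_succ_iff_lt_or_eq.1 he with he | rfl
    · exact (h1 _).trans (h.neg e he hf)
    · exact h2 hf
  · rcases h3 v with h6 | ⟨rfl, h6, h7⟩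
    · rw [h6]
      exact h.low f h4 (fun e he => h5 e (by omega)) v hv
    · rw [h7]
      exact h5 m (by omega) h6

/-- Since tails are read from the snapshot, a label lowered in this pass is not passed on through a
second negative edge; this is what limits a round to one more hop. -/
theorem relaxNeg_spec {n m : ℕ} {s : State} (hW : Work s n m)
    (h0 : ∀ v < n, s.reals 12 v = s.reals 11 v) :
    Ter relaxNeg s (m * 100 + 9) fun s' =>
      NegRel n m (s.ints 12) (s.ints 13) (s.ints 14) (s.reals 10) (s.reals 11) (s'.reals 11) := by
  refine (Ter.forUp_const 88 (fun j s' => NegRel n j (s.ints 12) (s.ints 13) (s.ints 14)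
    (s.reals 10) (s.reals 11) (s'.reals 11)) hW.edges rfl rfl
    (by norm_num) ?_ ?_).mono (by omega) fun _ _ h => h.1
  · exact ⟨fun v _ => le_rfl, fun e he => by omega, fun f hf _ => hf⟩
  rintro j s1 hj hf h20 - hI
  refine Ter.exec rfl (by decide) ?_
  simp only [Prog.exec, BExpr.Holds, IExpr.eval, RExpr.eval, eval_var, h20, hf.1 12 rfl,
    hf.1 13 rfl, hf.1 14 rfl, hf.2 10 rfl, hf.2 12 rfl, State.setInt_reals]
  rw [h0 _ (hW.src j hj)]
  split_ifs with h
  · obtain ⟨h1, h2⟩ := h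
    simp only [State.setReal_reals, if_true]
    refine hI.step (fun v => ?_) (fun _ => ?_) (fun v => ?_)
    · rw [Function.update_apply]
      split_ifs with hv
      · rw [hv]; exact h2.le
      · exact le_rfl
    · rw [Function.update_self]
    · rw [Function.update_apply]
      split_ifs with hv
      · exact Or.inr ⟨hv, by omega, rfl⟩
      · exact Or.inl rfl
  · refine hI.step (fun _ => le_rfl) (fun h1 => ?_) fun _ => Or.inl rfl
    rw [not_and, not_lt] at h
    exact h (by omega)

/-- Build the adjacency lists. -/
def buildLists : Prog :=
  forUp 21 10 (.iset 15 (var 21) (.const 0)) ;;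
  forUp 20 11 (.iset 16 (var 20) (.load 15 (.load 12 (var 20))) ;;
    .iset 15 (.load 12 (var 20)) ((var 20).add (.const 1)))

/-- Every edge is pushed to the front of the list of its tail, whence the decreasing order in `adj`.
The link that is overwritten belongs to an edge that is not yet in any list. -/
theorem buildLists_spec {n m : ℕ} {s : State} (hW : Work s n m) :
    Ter buildLists s ((n + m) * 40 + 18) fun s' =>
      ∀ v < n, Chain (s'.ints 16) (s'.ints 15 v) (adj (s.ints 12) v m) := by
  have e1 : Ter (forUp 21 10 (.iset 15 (var 21) (.const 0))) s (n * 40 + 9) fun s' =>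
      ∀ v < n, s'.ints 15 v = 0 := by
    refine (Ter.forUp_const 28 (fun j s' => ∀ v < j, s'.ints 15 v = 0) hW.verts rfl rfl
      (by norm_num) (by simp) ?_).mono (by omega) fun _ _ h => h.1
    rintro j s1 hj hf h21 - hI
    refine Ter.exec rfl (by decide) ?_
    simp only [Prog.exec, IExpr.eval, eval_var, h21, State.setInt_ints, Nat.reduceEqDiff, if_true,
      if_false]
    intro v hv
    rw [Function.update_apply]
    split_ifs with h
    · rfl
    · exact hI v (by omega)
  refine (e1.seq (T' := m * 40 + 9) ?_).mono (by ring_nf; omega) fun _ _ h => h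
  intro s1 hf1 h1
  have hW1 := hW.frame hf1 rfl
  refine (Ter.forUp_const 28 (fun j s' => ∀ v < n, Chain (s'.ints 16) (s'.ints 15 v)
    (adj (s.ints 12) v j)) hW1.edges rfl rfl (by norm_num) ?_ ?_).mono (by omega) fun _ _ h => h.1
  · intro v hv
    simpa [adj, Chain] using h1 v hv
  rintro j s2 hj hf h20 - hI
  refine Ter.exec rfl (by decide) ?_
  have e12 : s2.ints 12 = s.ints 12 := (hf.1 12 rfl).trans (hf1.1 12 rfl)
  simp only [Prog.exec, IExpr.eval, eval_var, h20, e12, State.setInt_ints, Nat.reduceEqDiff,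
    if_true, if_false]
  intro v hv
  have hnot : j ∉ adj (s.ints 12) v j := fun h => by simpa using (mem_adj.1 h).1
  rw [adj, Function.update_apply]
  by_cases h : s.ints 12 j = v
  · rw [if_pos h, if_pos h.symm]
    refine ⟨rfl, ?_⟩
    rw [Function.update_self, h]
    exact (hI v hv).update hnot
  · rw [if_neg h, if_neg (Ne.symm h)]
    exact (hI v hv).update hnot

/-- Tabulate `⌊i / 2⌋` for `i < 2 n`. -/
def buildHalf : Prog :=
  forUp 21 10 (.iset 17 ((var 21).add (var 21)) (var 21) ;;
    .iset 17 (((var 21).add (var 21)).add (.const 1)) (var 21))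

/-- The machine cannot divide, so the parents in the tree are looked up in a table. -/
theorem buildHalf_spec {n m : ℕ} {s : State} (hW : Work s n m) :
    Ter buildHalf s (n * 40 + 9) fun s' => ∀ i < 2 * n, s'.ints 17 i = i / 2 := by
  refine (Ter.forUp_const 28 (fun j s' => ∀ i < 2 * j, s'.ints 17 i = i / 2) hW.verts rfl rfl
    (by norm_num) (by simp) ?_).mono (by omega) fun _ _ h => h.1
  rintro j s1 hj hf h21 - hI
  refine Ter.exec rfl (by decide) ?_
  simp only [Prog.exec, IExpr.eval, eval_var, h21, State.setInt_ints, Nat.reduceEqDiff, if_true,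
    if_false]
  intro i hi
  rw [Function.update_apply, Function.update_apply]
  split_ifs with h h'
  · omega
  · omega
  · exact hI i (by omega)

/-- Build the tournament tree; no vertex is finished. -/
def buildTree : Prog :=
  forUp 21 10 (.iset 19 (var 21) (.const 0) ;; .iset 18 ((var 10).add (var 21)) (var 21)) ;;
  forUp 21 10 (assign 23 ((var 10).sub ((var 21).add (.const 1))) ;; recompute)

/-- Nodes are recomputed in decreasing order, so both children are correct when a node is reached.
-/
theorem buildTree_spec {n m : ℕ} {s : State} (hW : Work s n m) :
    Ter buildTree s (n * 150 + 18) fun s' => (∀ v < n, s'.ints 19 v = 0) ∧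
      TreeInv n (s'.ints 18) (vkey (s'.ints 19) (s'.reals 11)) fun _ => False := by
  have e1 : Ter (forUp 21 10 (.iset 19 (var 21) (.const 0) ;;
      .iset 18 ((var 10).add (var 21)) (var 21))) s (n * 40 + 9) fun s' =>
      (∀ v < n, s'.ints 19 v = 0) ∧ ∀ v < n, s'.ints 18 (n + v) = v := by
    refine (Ter.forUp_const 28 (fun j s' => (∀ v < j, s'.ints 19 v = 0) ∧
      ∀ v < j, s'.ints 18 (n + v) = v) hW.verts rfl rfl
      (by norm_num) (by simp) ?_).mono (by omega) fun _ _ h => h.1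
    intro j s1 hj hf h21 h10 hI
    refine Ter.exec rfl (by decide) ?_
    simp only [Prog.exec, IExpr.eval, eval_var, h21, h10, State.setInt_ints, Nat.reduceEqDiff,
      if_true, if_false]
    refine ⟨fun v hv => ?_, fun v hv => ?_⟩
    · rw [Function.update_apply]
      split_ifs with h
      · rfl
      · exact hI.1 v (by omega)
    · rw [Function.update_apply]
      split_ifs with h
      · omega
      · exact hI.2 v (by omega)
  refine (e1.seq (T' := n * 110 + 9) ?_).mono (by omega) fun _ _ h => h
  intro s1 hf1 ⟨h1, h2⟩
  have hW1 := hW.frame hf1 rfl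
  set key := vkey (s1.ints 19) (s1.reals 11) with hkey
  refine (Ter.forUp_const 98 (fun j s' => (∀ v < n, s'.ints 18 (n + v) = v) ∧
    (∀ i, 1 ≤ i → n ≤ i + j → i < 2 * n → s'.ints 18 i < n ∧ AncOf (n + s'.ints 18 i) i) ∧
    (∀ i, 1 ≤ i → n ≤ i + j → i < n → key (s'.ints 18 i) ≤ key (s'.ints 18 (2 * i)) ∧
      key (s'.ints 18 i) ≤ key (s'.ints 18 (2 * i + 1)))) hW1.verts rfl rfl (by norm_num) ?_
      ?_).mono (by omega) ?_
  · refine ⟨by simpa using h2, fun i hi hi' hi2 => ?_, fun i _ _ _ => by omega⟩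
    obtain ⟨v, rfl⟩ := Nat.exists_eq_add_of_le (show n ≤ i by omega)
    simp only [State.setInt_ints, Nat.reduceEqDiff, if_false]
    rw [h2 v (by omega)]
    exact ⟨by omega, 0, by simp⟩
  · rintro j s2 hj hf h21 h10 ⟨h3, h4, h5⟩
    refine (Ter.seq (T := 10) (Q := fun s3 => s3 = s2.setInt 23 0 (n - (j + 1)))
      (Ter.exec rfl (by decide) ?_) (T' := 60) ?_).mono (by omega) fun _ _ h => h
    · simp only [assign, Prog.exec, IExpr.eval, eval_var, h21, h10]
    rintro s3 hf3 rfl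
    refine (recompute_spec _).mono le_rfl ?_
    rintro s4 hf4 ⟨-, x, h6, h7, h8⟩
    simp only [State.setInt_ints, Nat.reduceEqDiff, if_true, if_false, Function.update_self,
      State.setInt_reals] at h6 h7 h8 ⊢
    rw [hf.1 19 rfl, hf.2 11 rfl, ← hkey] at h8
    rw [h6]
    -- In the last pass this is `0`, which is not a node of the tree; the invariant only concerns
    -- nodes from `1` on, so the extra pass is harmless.
    set i0 := n - (j + 1) with hi0
    refine ⟨fun v hv => ?_, fun i hi hi' hi2 => ?_, fun i hi hi' hi2 => ?_⟩
    · rw [Function.update_of_ne (by omega)]; exact h3 v hv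
    · rw [Function.update_apply]
      split_ifs with h
      · rcases h7 with rfl | rfl
        · obtain ⟨k1, k2⟩ := h4 (2 * i0) (by omega) (by omega) (by omega)
          refine ⟨k1, ?_⟩
          have := k2.half
          rwa [show 2 * i0 / 2 = i by omega] at this
        · obtain ⟨k1, k2⟩ := h4 (2 * i0 + 1) (by omega) (by omega) (by omega)
          refine ⟨k1, ?_⟩
          have := k2.half
          rwa [show (2 * i0 + 1) / 2 = i by omega] at this
      · exact h4 i hi (by omega) hi2
    · rw [Function.update_of_ne (show 2 * i ≠ i0 by omega),
        Function.update_of_ne (show 2 * i + 1 ≠ i0 by omega), Function.update_apply]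
      split_ifs with h
      · rw [h]; exact h8
      · exact h5 i hi (by omega) hi2
  · rintro s2 hf2 ⟨⟨h3, h4, h5⟩, -⟩
    rw [hf2.1 19 rfl, hf2.2 11 rfl]
    exact ⟨h1, h3, fun i hi hi' => h4 i hi (by omega) hi', fun i hi hi' _ => h5 i hi (by omega) hi'⟩

/-- Relax the negative edges, then run Dijkstra's algorithm. -/
def round : Prog :=
  snapshot ;; relaxNeg ;; buildLists ;; buildHalf ;; buildTree ;; mainLoop

/-- `d` are the labels after one round that starts with the labels `a`. -/
structure RoundRel (n m : ℕ) (src dst fl : ℕ → ℕ) (w a d : ℕ → ℝ) : Prop where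
  le : ∀ v < n, d v ≤ a v
  neg : ∀ e < m, fl e ≠ 0 → d (dst e) ≤ a (src e) + w e
  feas : ∀ e < m, fl e = 0 → d (dst e) ≤ d (src e) + w e
  low : ∀ f : ℕ → ℝ, (∀ v < n, f v ≤ a v) →
    (∀ e < m, fl e ≠ 0 → f (dst e) ≤ a (src e) + w e) →
    (∀ e < m, fl e = 0 → f (dst e) ≤ f (src e) + w e) → ∀ v < n, f v ≤ d v

/-- Relaxation gives the greatest function subject to the negative edges, and Dijkstra's algorithm
the greatest function below that one subject to the remaining edges. The composition is the greatest
function subject to both. -/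
theorem round_spec {n m : ℕ} {s : State} (hW : Work s n m) :
    Ter round s ((n + m) * (160 * Nat.size n + 700) + 73) fun s' =>
      RoundRel n m (s.ints 12) (s.ints 13) (s.ints 14) (s.reals 10) (s.reals 11)
        (s'.reals 11) := by
  have hT : (n + m) * (160 * Nat.size n + 700) = (n + m) * (160 * Nat.size n + 200) +
    (n + m) * 500 := by ring
  refine ((snapshot_spec hW).seq (T' := (n + m) * (160 * Nat.size n + 200) + (n + m) * 470 + 64)
    ?_).mono (by omega) fun _ _ h => h
  intro s1 hf1 h1
  have hW1 := hW.frame hf1 rfl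
  refine ((relaxNeg_spec hW1 (fun v hv => by rw [h1 v hv, hf1.2 11 rfl])).seq
    (T' := (n + m) * (160 * Nat.size n + 200) + (n + m) * 370 + 55) ?_).mono (by omega)
    fun _ _ h => h
  intro s2 hf2 h2
  rw [hf1.1 12 rfl, hf1.1 13 rfl, hf1.1 14 rfl, hf1.2 10 rfl, hf1.2 11 rfl] at h2
  have hW2 := hW1.frame hf2 rfl
  refine ((buildLists_spec hW2).seq
    (T' := (n + m) * (160 * Nat.size n + 200) + (n + m) * 330 + 37) ?_).mono (by omega)
    fun _ _ h => h
  intro s3 hf3 h3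
  have hW3 := hW2.frame hf3 rfl
  refine ((buildHalf_spec hW3).seq
    (T' := (n + m) * (160 * Nat.size n + 200) + (n + m) * 290 + 28) ?_).mono (by omega)
    fun _ _ h => h
  intro s4 hf4 h4
  have hW4 := hW3.frame hf4 rfl
  refine ((buildTree_spec hW4).seq
    (T' := (n + m) * (160 * Nat.size n + 200) + (n + m) * 140 + 10) ?_).mono (by omega)
    fun _ _ h => h
  rintro s5 hf5 ⟨h5, h6⟩
  have hW5 := hW4.frame hf5 rfl
  refine (mainLoop_spec (s0 := s5) hW5 ?_ ?_ ⟨⟨fun _ _ _ => rfl, rfl⟩, ?_, h6⟩).mono (by omega) ?_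
  · rw [hf5.1 17 rfl]; exact h4
  · rw [hf5.1 16 rfl, hf5.1 15 rfl, hf5.1 12 rfl, hf4.1 16 rfl, hf4.1 15 rfl, hf4.1 12 rfl,
      hf3.1 12 rfl]
    exact h3
  · exact ⟨fun f hf _ => hf, fun v _ => le_rfl, fun x hx y _ hxd => absurd (h5 x hx) hxd,
      fun e he _ hd => absurd (h5 _ (hW5.src e he)) hd⟩
  · rintro s6 hf6 ⟨h7, h8⟩
    have key := h7.inv
    have e12 : s5.ints 12 = s.ints 12 := by
      rw [hf5.1 12 rfl, hf4.1 12 rfl, hf3.1 12 rfl, hf2.1 12 rfl, hf1.1 12 rfl]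
    have e13 : s5.ints 13 = s.ints 13 := by
      rw [hf5.1 13 rfl, hf4.1 13 rfl, hf3.1 13 rfl, hf2.1 13 rfl, hf1.1 13 rfl]
    have e14 : s5.ints 14 = s.ints 14 := by
      rw [hf5.1 14 rfl, hf4.1 14 rfl, hf3.1 14 rfl, hf2.1 14 rfl, hf1.1 14 rfl]
    have e10 : s5.reals 10 = s.reals 10 := by
      rw [hf5.2 10 rfl, hf4.2 10 rfl, hf3.2 10 rfl, hf2.2 10 rfl, hf1.2 10 rfl]
    have e11 : s5.reals 11 = s2.reals 11 := by
      rw [hf5.2 11 rfl, hf4.2 11 rfl, hf3.2 11 rfl]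
    rw [e12, e13, e14, e10, e11] at key
    refine ⟨fun v hv => (key.le v hv).trans (h2.le v hv), fun e he hf => ?_, fun e he hf => ?_,
      fun f k1 k2 k3 => key.low f (h2.low f k1 k2) k3⟩
    · exact (key.le _ (hW.dst e he)).trans (h2.neg e he hf)
    · exact key.feas e he hf (h8 _ (hW.src e he)) id

end RealRAM

namespace RealRAM

/-! ### The working graph -/

/-- Copy the graph stored in the arrays `a, …, a + 3` and `b` to the working memory. -/
def copyGraph (a b : ℕ) : Prog :=
  assign 10 (.load a (.const 0)) ;; assign 11 (.load a (.const 1)) ;;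
  forUp 20 11 (.iset 12 (var 20) (.load (a + 1) (var 20)) ;;
    .iset 13 (var 20) (.load (a + 2) (var 20)) ;; .iset 14 (var 20) (.load (a + 3) (var 20)) ;;
    .rset 10 (var 20) (.load b (var 20)))

open Classical in
/-- The working memory holds the graph `H`. -/
structure Rep {V E : Type} {N M : ℕ} (s : State) (H : WGraph V E) (ν : V ≃ Fin N)
    (ε : E ≃ Fin M) : Prop where
  verts : s.ints 10 0 = N
  edges : s.ints 11 0 = M
  tail (e : E) : s.ints 12 (ε e) = ν (H.src e)
  head (e : E) : s.ints 13 (ε e) = ν (H.dst e)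
  flag (e : E) : s.ints 14 (ε e) = if e ∈ H.neg then 1 else 0
  weight (e : E) : s.reals 10 (ε e) = H.wt e

section

variable {V E : Type} {N M : ℕ} {H : WGraph V E} {ν : V ≃ Fin N} {ε : E ≃ Fin M} {s : State}

theorem copyGraph_spec {a b : ℕ} (hab : a = 0 ∧ b = 0 ∨ a = 5 ∧ b = 2)
    (h : Stores s a b H ν ε) :
    Ter (copyGraph a b) s (M * 60 + 30) fun s' => Rep s' H ν ε := by
  have key : Ter (copyGraph a b) s (M * 60 + 30) fun s' => s'.ints 10 0 = N ∧ s'.ints 11 0 = M ∧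
      ∀ e < M, s'.ints 12 e = s.ints (a + 1) e ∧ s'.ints 13 e = s.ints (a + 2) e ∧
        s'.ints 14 e = s.ints (a + 3) e ∧ s'.reals 10 e = s.reals b e := by
    refine (Ter.seq (T := 5) (Q := fun s1 => s1 = s.setInt 10 0 N)
      (Ter.exec rfl (by simp [assign, Prog.cost, IExpr.cost]) ?_)
      (T' := M * 60 + 20) ?_).mono (by omega) fun _ _ h => h
    · simp only [assign, Prog.exec, IExpr.eval, h.vertices]
    rintro s1 hf1 rfl
    refine (Ter.seq (T := 5) (Q := fun s1 => s1 = (s.setInt 10 0 N).setInt 11 0 M)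
      (Ter.exec rfl (by simp [assign, Prog.cost, IExpr.cost]) ?_) (T' := M * 60 + 15) ?_).mono (by omega) fun _ _ h => h
    · simp only [assign, Prog.exec, IExpr.eval, State.setInt_ints]
      rw [if_neg (by omega), h.edges]
    rintro s2 hf2 rfl
    refine (Ter.forUp_const 48 (fun j s' => ∀ e < j, s'.ints 12 e = s.ints (a + 1) e ∧
      s'.ints 13 e = s.ints (a + 2) e ∧ s'.ints 14 e = s.ints (a + 3) e ∧
      s'.reals 10 e = s.reals b e) (N := M) (by simp) rfl rfl (by norm_num) (by simp) ?_).mono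
      (by omega) ?_
    · rintro j s3 hj hf h20 - hI
      refine Ter.exec rfl (by simp [Prog.cost, IExpr.cost, RExpr.cost, var]) ?_
      have e1 : s3.ints (a + 1) = s.ints (a + 1) ∧ s3.ints (a + 2) = s.ints (a + 2) ∧
          s3.ints (a + 3) = s.ints (a + 3) ∧ s3.reals b = s.reals b := by
        rcases hab with ⟨rfl, rfl⟩ | ⟨rfl, rfl⟩
        · exact ⟨hf.1 1 rfl, hf.1 2 rfl, hf.1 3 rfl, hf.2 0 rfl⟩
        · exact ⟨hf.1 6 rfl, hf.1 7 rfl, hf.1 8 rfl, hf.2 2 rfl⟩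
      obtain ⟨e1, e2, e3, e4⟩ := e1
      have n1 : a + 2 ≠ 12 := by omega
      have n2 : a + 3 ≠ 12 := by omega
      have n3 : a + 3 ≠ 13 := by omega
      simp only [Prog.exec, IExpr.eval, RExpr.eval, eval_var, h20, State.setInt_ints,
        State.setReal_reals, State.setInt_reals, State.setReal_ints, Nat.reduceEqDiff, if_true,
        if_false, e1, e2, e3, e4, n1, n2, n3]
      intro e he
      simp only [Function.update_apply]
      by_cases hej : e = j
      · simp [hej]
      · simpa [hej] using hI e (by omega)
    · rintro s3 hf3 ⟨h3, -⟩
      refine ⟨?_, ?_, h3⟩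
      · rw [hf3.1 10 rfl]; simp
      · rw [hf3.1 11 rfl]; simp
  refine key.mono le_rfl ?_
  rintro s' - ⟨h1, h2, h3⟩
  refine ⟨h1, h2, fun e => ?_, fun e => ?_, fun e => ?_, fun e => ?_⟩
  · rw [(h3 _ (ε e).2).1, h.tail]
  · rw [(h3 _ (ε e).2).2.1, h.head]
  · rw [(h3 _ (ε e).2).2.2.1, h.flag]
  · rw [(h3 _ (ε e).2).2.2.2, h.weight]

theorem Rep.frame {p : Prog} {s' : State} (h : Rep s H ν ε) (hf : Frame p s s')
    (hp : (p.wi 10 || p.wi 11 || p.wi 12 || p.wi 13 || p.wi 14 || p.wr 10) = false) :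
    Rep s' H ν ε := by
  simp only [Bool.or_eq_false_iff] at hp
  obtain ⟨⟨⟨⟨⟨h0, h1⟩, h2⟩, h3⟩, h4⟩, h5⟩ := hp
  obtain ⟨k0, k1, k2, k3, k4, k5⟩ := h
  exact ⟨by rw [hf.1 _ h0, k0], by rw [hf.1 _ h1, k1], by rwa [hf.1 _ h2],
    by rwa [hf.1 _ h3], by rwa [hf.1 _ h4], by rwa [hf.2 _ h5]⟩

theorem Rep.exists_edge (ε : E ≃ Fin M) {i : ℕ} (hi : i < M) : ∃ e, (ε e : ℕ) = i :=
  ⟨ε.symm ⟨i, hi⟩, by simp⟩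

theorem Rep.flag_eq_zero (h : Rep s H ν ε) (e : E) : s.ints 14 (ε e) = 0 ↔ e ∉ H.neg := by
  rw [h.flag]; split_ifs with he <;> simp [he]

theorem Rep.work (h : Rep s H ν ε) (hH : ∀ e, e ∉ H.neg → 0 ≤ H.wt e) (hN : 0 < N) :
    Work s N M := by
  refine ⟨hN, h.verts, h.edges, fun i hi => ?_, fun i hi => ?_, fun i hi => ?_⟩ <;>
    obtain ⟨e, rfl⟩ := Rep.exists_edge ε hi
  · rw [h.tail]; exact (ν _).2
  · rw [h.head]; exact (ν _).2
  · rw [h.flag_eq_zero, h.weight]; exact hH e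

/-- One round turns the `h`-hop distances into the `(h + 1)`-hop distances. -/
theorem round_superDist [Finite E] (h : Rep s H ν ε) (hH : ∀ e, e ∉ H.neg → 0 ≤ H.wt e)
    (hN : 0 < N) {k : ℕ} (hk : ∀ x, s.reals 11 (ν x) = H.superDist k x) :
    Ter round s ((N + M) * (160 * Nat.size N + 700) + 73) fun s' =>
      ∀ x, s'.reals 11 (ν x) = H.superDist (k + 1) x := by
  refine (round_spec (h.work hH hN)).mono le_rfl ?_
  rintro s' - hR
  refine H.eq_superDist_succ hH k (fun x => s'.reals 11 (ν x)) (fun x => ?_) (fun e he => ?_)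
    (fun e he => ?_) (fun f h1 h2 h3 x => ?_)
  · rw [← hk]; exact hR.le _ (ν x).2
  · have := hR.neg _ (ε e).2 (by rw [Ne, h.flag_eq_zero]; exact not_not.2 he)
    rwa [h.head, h.tail, h.weight, hk] at this
  · have := hR.feas _ (ε e).2 ((h.flag_eq_zero e).2 he)
    rwa [h.head, h.tail, h.weight] at this
  -- The specification of a round ranges over functions on `ℕ`; `f` is transported along the
  -- numbering, and the value `0` from `N` on is irrelevant.
  · let f' : ℕ → ℝ := fun v => if hv : v < N then f (ν.symm ⟨v, hv⟩) else 0
    have hf' : ∀ x, f' (ν x) = f x := fun x => by simp [f']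
    have := hR.low f' (fun v hv => ?_) (fun i hi => ?_) (fun i hi => ?_) (ν x) (ν x).2
    · rwa [hf'] at this
    · obtain ⟨y, rfl⟩ := Rep.exists_edge ν hv
      rw [hf', hk]; exact h1 y
    · obtain ⟨e, rfl⟩ := Rep.exists_edge ε hi
      rw [Ne, h.flag_eq_zero, not_not, h.head, h.tail, h.weight, hf', hk]
      exact h2 e
    · obtain ⟨e, rfl⟩ := Rep.exists_edge ε hi
      rw [h.flag_eq_zero, h.head, h.tail, h.weight, hf', hf']
      exact h3 e

/-- Set all labels to `0`. -/
def zeroLabels : Prog := forUp 21 10 (.rset 11 (var 21) .zero)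

theorem zeroLabels_spec {n : ℕ} (hn : s.ints 10 0 = n) :
    Ter zeroLabels s (n * 30 + 9) fun s' => ∀ v < n, s'.reals 11 v = 0 := by
  refine (Ter.forUp_const 18 (fun j s' => ∀ v < j, s'.reals 11 v = 0) hn rfl rfl
    (by norm_num) (by simp) ?_).mono (by omega) fun _ _ h => h.1
  rintro j s1 hj hf h21 - hI
  refine Ter.exec rfl (by decide) ?_
  simp only [Prog.exec, RExpr.eval, eval_var, h21, State.setInt_reals, State.setReal_reals,
    if_true]
  intro v hv
  rw [Function.update_apply]
  split_ifs with h
  · rfl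
  · exact hI v (by omega)

/-- Save the labels to the row of the table `13` that starts at the scalar `31`. -/
def saveRow : Prog := forUp 21 10 (.rset 13 ((var 31).add (var 21)) (.load 11 (var 21)))

theorem saveRow_spec {n o : ℕ} (hn : s.ints 10 0 = n) (ho : s.ints 31 0 = o) :
    Ter saveRow s (n * 30 + 9) fun s' => (∀ v < n, s'.reals 13 (o + v) = s.reals 11 v) ∧
      ∀ i < o, s'.reals 13 i = s.reals 13 i := by
  refine (Ter.forUp_const 18 (fun j s' => (∀ v < j, s'.reals 13 (o + v) = s.reals 11 v) ∧
      ∀ i < o, s'.reals 13 i = s.reals 13 i) hn rfl rfl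
    (by norm_num) (by simp) ?_).mono (by omega) fun _ _ h => h.1
  rintro j s1 hj hf h21 - ⟨h1, h2⟩
  refine Ter.exec rfl (by decide) ?_
  simp only [Prog.exec, IExpr.eval, RExpr.eval, eval_var, h21, State.setInt_reals,
    State.setReal_reals, if_true, hf.1 31 rfl, hf.2 11 rfl, ho]
  refine ⟨fun v hv => ?_, fun i hi => ?_⟩
  · rw [Function.update_apply]
    split_ifs with h
    · rw [show v = j by omega]
    · exact h1 v (by omega)
  · rw [Function.update_of_ne (by omega)]; exact h2 i hi

/-- Compute the table of the super-source distances with `0, …, r` hops, where the scalar `33` is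
`r + 1`; the scalar `34` becomes the start of the last row. -/
def levels : Prog :=
  zeroLabels ;; assign 31 (.const 0) ;;
  forUp 32 33 (saveRow ;; assign 34 (var 31) ;; assign 31 ((var 31).add (var 10)) ;; round)

/-- Row `j` starts at `j * N`; as there is no multiplication, the start is advanced by `N` in every
pass. A row is saved before its round, so the round after row `r` is superfluous and its result is
not tabulated. -/
theorem levels_spec [Finite E] (h : Rep s H ν ε) (hH : ∀ e, e ∉ H.neg → 0 ≤ H.wt e)
    (hN : 0 < N) {r : ℕ} (hr : s.ints 33 0 = r + 1) :
    Ter levels s ((r + 1) * ((N + M) * (160 * Nat.size N + 700) + N * 30 + 120) + N * 30 + 30)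
      fun s' => s'.ints 34 0 = r * N ∧
        ∀ j ≤ r, ∀ x, s'.reals 13 (j * N + ν x) = H.superDist j x := by
  set Z := (N + M) * (160 * Nat.size N + 700) with hZ
  refine ((zeroLabels_spec h.verts).seq (T' := (r + 1) * (Z + N * 30 + 120) + 20) ?_).mono
    (by omega) fun _ _ h => h
  intro s1 hf1 h1
  refine (Ter.seq (T := 5) (Q := fun s2 => s2 = s1.setInt 31 0 0) (Ter.exec rfl (by decide) rfl)
    (T' := (r + 1) * (Z + N * 30 + 120) + 15) ?_).mono (by omega) fun _ _ h => h
  rintro s2 hf2 rfl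
  have hR2 := (h.frame hf1 rfl).frame hf2 rfl
  -- The scalar `34` lags one row behind `31`; the conditional makes its clause trivial for `j = 0`,
  -- when no row has been saved.
  refine (Ter.forUp_const (Z + N * 30 + 108) (fun j s' => s'.ints 31 0 = j * N ∧
    (∀ x, s'.reals 11 (ν x) = H.superDist j x) ∧ s'.ints 34 0 = (if j = 0 then s'.ints 34 0 else
      (j - 1) * N) ∧ ∀ i < j, ∀ x, s'.reals 13 (i * N + ν x) = H.superDist i x)
    (N := r + 1) ?_ rfl rfl (by norm_num) ?_ ?_).mono ?_ ?_
  · rw [hf2.1 33 rfl, hf1.1 33 rfl, hr]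
  · refine ⟨by simp, fun x => ?_, by simp, by simp⟩
    rw [H.superDist_zero hH]
    simpa using h1 _ (ν x).2
  · rintro j s3 hj hf h32 h33 ⟨h2, h3, -, h4⟩
    have hR3 := hR2.frame hf rfl
    refine ((saveRow_spec hR3.verts h2).seq (T' := Z + 99) ?_).mono (by omega) fun _ _ h => h
    rintro s4 hf4 ⟨h5, h6⟩
    refine (Ter.seq (T := 5) (Q := fun s5 => s5 = s4.setInt 34 0 (j * N))
      (Ter.exec rfl (by decide) ?_) (T' := Z + 94) ?_).mono (by omega) fun _ _ h => h
    · simp only [assign, Prog.exec, eval_var, hf4.1 31 rfl, h2, IExpr.eval]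
    rintro s5 hf5 rfl
    refine (Ter.seq (T := 10) (Q := fun s6 => s6 = (s4.setInt 34 0 (j * N)).setInt 31 0
      ((j + 1) * N)) (Ter.exec rfl (by decide) ?_) (T' := Z + 84) ?_).mono (by omega)
      fun _ _ h => h
    · simp only [assign, Prog.exec, eval_var, IExpr.eval, State.setInt_ints, Nat.reduceEqDiff,
        if_false, hf4.1 31 rfl, hf4.1 10 rfl, h2, hR3.verts, Nat.succ_mul]
    rintro s6 hf6 rfl
    have hR6 := ((hR3.frame hf4 rfl).frame hf5 rfl).frame hf6 rfl
    refine (round_superDist hR6 hH hN (k := j) ?_).mono (by omega) ?_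
    · intro x
      simp only [State.setInt_reals]
      rw [hf4.2 11 rfl]; exact h3 x
    · intro s7 hf7 h7
      refine ⟨?_, ?_, ?_, ?_⟩
      · simp [hf7.1 31 rfl]
      · simpa using h7
      · simp [hf7.1 34 rfl]
      · intro i hi x
        simp only [State.setInt_reals]
        rw [hf7.2 13 rfl]
        simp only [State.setInt_reals]
        rcases Nat.lt_succ_iff_lt_or_eq.1 hi with hi | rfl
        · rw [h6, h4 i hi]
          have : (i + 1) * N ≤ j * N := Nat.mul_le_mul_right _ hi
          have h8 := (ν x).2
          rw [Nat.add_mul] at this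
          omega
        · rw [h5 _ (ν x).2, h3]
  · have : (r + 1) * (Z + N * 30 + 120) = (r + 1) * (Z + N * 30 + 108 + 12) := by ring
    omega
  · rintro s3 - ⟨⟨-, -, h2, h3⟩, -⟩
    exact ⟨by simpa using h2, fun j hj => h3 j (by omega)⟩

/-- Count the negative edges. -/
def countNeg : Prog :=
  assign 35 (.const 0) ;;
  forUp 20 11 (.ite (.ilt (.const 0) (.load 14 (var 20)))
    (assign 35 ((var 35).add (.const 1))) .skip)

theorem countNeg_spec (h : Rep s H ν ε) :
    Ter countNeg s (M * 50 + 20) fun s' => s'.ints 35 0 = H.neg.ncard := by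
  classical
  refine (Ter.seq (T := 5) (Q := fun s2 => s2 = s.setInt 35 0 0) (Ter.exec rfl (by decide) rfl)
    (T' := M * 50 + 15) ?_).mono (by omega) fun _ _ h => h
  rintro s1 hf1 rfl
  have hR := h.frame hf1 rfl
  refine (Ter.forUp_const 38 (fun j s' => s'.ints 35 0 =
    ((Finset.range j).filter fun i => s.ints 14 i ≠ 0).card) hR.edges rfl rfl (by norm_num)
    (by simp) ?_).mono (by omega) ?_
  · rintro j s2 hj hf h20 - hI
    have e14 : s2.ints 14 = s.ints 14 := (hf.1 14 rfl).trans (hf1.1 14 rfl)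
    refine Ter.exec rfl (by decide) ?_
    simp only [assign, Prog.exec, BExpr.Holds, IExpr.eval, eval_var, h20, e14]
    rw [Finset.range_add_one, Finset.filter_insert]
    split_ifs with h1 h2 h2
    · rw [Finset.card_insert_of_notMem (by simp)]
      simp [hI]
    · omega
    · omega
    · simpa using hI
  · rintro s2 - ⟨h1, -⟩
    rw [h1, ← Set.ncard_coe_finset]
    symm
    refine Set.ncard_congr (fun e _ => (ε e : ℕ)) ?_ ?_ ?_
    · intro e he
      have := h.flag_eq_zero e
      simp [this, he]
    · intro e e' _ _ hee
      exact ε.injective (Fin.ext hee)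
    · intro i hi
      simp only [Finset.coe_filter, Finset.mem_range, Set.mem_ofPred_eq] at hi
      obtain ⟨e, rfl⟩ := Rep.exists_edge ε hi.1
      refine ⟨e, ?_, rfl⟩
      have := hi.2
      rw [Ne, h.flag_eq_zero, not_not] at this
      exact this

/-- Compute super-source distances with at least `k / r` hops, where the scalars `35` and `30` are
`k` and `r`. -/
def iterate : Prog :=
  zeroLabels ;; assign 36 (.const 0) ;;
  .loop (.ilt (var 36) (var 35)) (round ;; assign 36 ((var 36).add (var 30)))

/-- The quotient is never computed: a counter grows by `r` per round until it reaches `k`. A round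
begins only while `q * r < k`, so there are at most `k / r + 1` of them. -/
theorem iterate_spec [Finite E] (h : Rep s H ν ε) (hH : ∀ e, e ∉ H.neg → 0 ≤ H.wt e)
    (hN : 0 < N) {r k : ℕ} (hr : s.ints 30 0 = r) (hr1 : 1 ≤ r) (hk : s.ints 35 0 = k) :
    Ter iterate s ((k / r + 1) * ((N + M) * (160 * Nat.size N + 700) + 100) + N * 30 + 30)
      fun s' => ∃ q, k ≤ q * r ∧ ∀ x, s'.reals 11 (ν x) = H.superDist q x := by
  set Z := (N + M) * (160 * Nat.size N + 700) with hZ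
  refine ((zeroLabels_spec h.verts).seq (T' := (k / r + 1) * (Z + 100) + 20) ?_).mono
    (by omega) fun _ _ h => h
  intro s1 hf1 h1
  refine (Ter.seq (T := 5) (Q := fun s2 => s2 = s1.setInt 36 0 0) (Ter.exec rfl (by decide) rfl)
    (T' := (k / r + 1) * (Z + 100) + 15) ?_).mono (by omega) fun _ _ h => h
  rintro s2 hf2 rfl
  have hR2 := (h.frame hf1 rfl).frame hf2 rfl
  have hbc : (BExpr.ilt (var 36) (var 35)).cost = 5 := rfl
  refine (Ter.loop (fun s' => ∃ q, s'.ints 36 0 = q * r ∧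
    ∀ x, s'.reals 11 (ν x) = H.superDist q x)
    (fun s' => (k / r + 1 - s'.ints 36 0 / r) * (Z + 100)) ⟨0, by simp, fun x => ?_⟩ ?_).mono ?_ ?_
  · rw [H.superDist_zero hH]
    simpa using h1 _ (ν x).2
  · rintro s3 hf ⟨q, h2, h3⟩ hb
    have h35 : s3.ints 35 0 = k := by rw [hf.1 35 rfl, hf2.1 35 rfl, hf1.1 35 rfl, hk]
    have h30 : s3.ints 30 0 = r := by rw [hf.1 30 rfl, hf2.1 30 rfl, hf1.1 30 rfl, hr]
    have hb : s3.ints 36 0 < s3.ints 35 0 := hb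
    rw [h2, h35] at hb
    have hq : q ≤ k / r := (Nat.le_div_iff_mul_le hr1).2 hb.le
    refine ⟨Z + 83, ((round_superDist (hR2.frame hf rfl) hH hN h3).seq (T' := 10) ?_).mono
      (by omega) fun _ _ h => h⟩
    intro s4 hf4 h4
    refine Ter.exec rfl (by decide) ?_
    simp only [assign, Prog.exec, eval_var, IExpr.eval, State.setInt_ints, State.setInt_reals,
      if_true, Function.update_self, hf4.1 36 rfl, hf4.1 30 rfl, h2, h30]
    refine ⟨⟨q + 1, by ring, h4⟩, ?_⟩
    rw [show q * r + r = (q + 1) * r by ring, Nat.mul_div_cancel _ hr1, Nat.mul_div_cancel _ hr1,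
      show k / r + 1 - q = (k / r + 1 - (q + 1)) + 1 by omega, Nat.add_mul _ 1, one_mul, hbc]
    omega
  · simp only [State.setInt_ints, if_true, Function.update_self, Nat.zero_div, Nat.sub_zero, hbc]
    omega
  · rintro s3 hf ⟨⟨q, h2, h3⟩, hb⟩
    have h35 : s3.ints 35 0 = k := by rw [hf.1 35 rfl, hf2.1 35 rfl, hf1.1 35 rfl, hk]
    have hb : ¬ s3.ints 36 0 < s3.ints 35 0 := hb
    exact ⟨q, by omega, h3⟩

end

/-- Return the labels of the first vertices as prices, and check that they eliminate all negative
edges of the input. -/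
def finish : Prog :=
  forUp 21 0 (.rset 1 (var 21) (.load 11 (var 21))) ;;
  assign 4 (.const 0) ;; assign 37 (.load 0 (.const 1)) ;;
  forUp 20 37 (.ite (.rlt (.sub (.add (.load 0 (var 20)) (.load 1 (.load 1 (var 20))))
      (.load 1 (.load 2 (var 20)))) .zero) (assign 4 (.const 1)) .skip)

/-- The verdict merely records whether all reweighted edges are nonnegative; `solve_spec` settles
what a failure means. -/
theorem finish_spec {s : State} {n m : ℕ} (hn : s.ints 0 0 = n) (hm : s.ints 0 1 = m) :
    Ter finish s (n * 30 + m * 60 + 50) fun s' => (∀ v < n, s'.reals 1 v = s.reals 11 v) ∧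
      ((s'.ints 4 0 = 1 ∧ ∃ e < m, s.reals 0 e + s'.reals 1 (s.ints 1 e) -
          s'.reals 1 (s.ints 2 e) < 0) ∨
        (s'.ints 4 0 = 0 ∧ ∀ e < m, 0 ≤ s.reals 0 e + s'.reals 1 (s.ints 1 e) -
          s'.reals 1 (s.ints 2 e))) := by
  have e1 : Ter (forUp 21 0 (.rset 1 (var 21) (.load 11 (var 21)))) s (n * 30 + 9) fun s' =>
      ∀ v < n, s'.reals 1 v = s.reals 11 v := by
    refine (Ter.forUp_const 18 (fun j s' => ∀ v < j, s'.reals 1 v = s.reals 11 v) hn rfl rfl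
      (by norm_num) (by simp) ?_).mono (by omega) fun _ _ h => h.1
    rintro j s1 hj hf h21 - hI
    refine Ter.exec rfl (by decide) ?_
    simp only [Prog.exec, RExpr.eval, eval_var, h21, State.setInt_reals,
      State.setReal_reals, if_true, hf.2 11 rfl]
    intro v hv
    rw [Function.update_apply]
    split_ifs with h
    · rw [h]
    · exact hI v (by omega)
  refine (e1.seq (T' := m * 60 + 40) ?_).mono (by omega) fun _ _ h => h
  intro s1 hf1 h1
  refine (Ter.seq (T := 5) (Q := fun s2 => s2 = s1.setInt 4 0 0) (Ter.exec rfl (by decide) rfl)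
    (T' := m * 60 + 35) ?_).mono (by omega) fun _ _ h => h
  rintro s2 hf2 rfl
  refine (Ter.seq (T := 6) (Q := fun s3 => s3 = (s1.setInt 4 0 0).setInt 37 0 m)
    (Ter.exec rfl (by decide) ?_) (T' := m * 60 + 20) ?_).mono (by omega) fun _ _ h => h
  · simp [assign, Prog.exec, IExpr.eval, hf1.1 0 rfl, hm]
  rintro s3 hf3 rfl
  have f1 : ∀ j, j = 1 ∨ j = 2 → s1.ints j = s.ints j := by
    rintro j (rfl | rfl)
    · exact hf1.1 1 rfl
    · exact hf1.1 2 rfl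
  refine (Ter.forUp_const 48 (fun j s' => ((s'.ints 4 0 = 1 ∧ ∃ e < j, s.reals 0 e +
      s1.reals 1 (s.ints 1 e) - s1.reals 1 (s.ints 2 e) < 0) ∨
    (s'.ints 4 0 = 0 ∧ ∀ e < j, 0 ≤ s.reals 0 e + s1.reals 1 (s.ints 1 e) -
      s1.reals 1 (s.ints 2 e)))) (N := m) (by simp) rfl rfl (by norm_num) (by simp) ?_).mono
    (by omega) ?_
  · rintro j s4 hj hf h20 - hI
    have g1 : s4.ints 1 = s.ints 1 := by rw [hf.1 1 rfl]; simpa using f1 1 (Or.inl rfl)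
    have g2 : s4.ints 2 = s.ints 2 := by rw [hf.1 2 rfl]; simpa using f1 2 (Or.inr rfl)
    have g3 : s4.reals 0 = s.reals 0 := by rw [hf.2 0 rfl]; exact hf1.2 0 rfl
    have g4 : s4.reals 1 = s1.reals 1 := by rw [hf.2 1 rfl]; rfl
    refine Ter.exec rfl (by decide) ?_
    simp only [assign, Prog.exec, BExpr.Holds, IExpr.eval, RExpr.eval, eval_var, h20, g1, g2, g3,
      g4]
    split_ifs with h2
    · left
      exact ⟨by simp, j, by omega, h2⟩
    · rcases hI with ⟨h3, e, he, h4⟩ | ⟨h3, h4⟩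
      · left
        exact ⟨by simpa using h3, e, by omega, h4⟩
      · right
        refine ⟨by simpa using h3, fun e he => ?_⟩
        rcases Nat.lt_succ_iff_lt_or_eq.1 he with he | rfl
        · exact h4 e he
        · exact not_lt.1 h2
  · rintro s4 hf4 ⟨h2, -⟩
    have e5 : s4.reals 1 = s1.reals 1 := by rw [hf4.2 1 rfl]; rfl
    rw [e5]
    exact ⟨h1, h2⟩

theorem stores_inputState {n m : ℕ} (G : WGraph (Fin n) (Fin m)) (r : ℕ) :
    Stores (inputState G r) 0 0 G (Equiv.refl _) (Equiv.refl _) := by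
  refine ⟨rfl, rfl, fun e => ?_, fun e => ?_, fun e => ?_, fun e => ?_⟩ <;> simp [inputState]

end RealRAM

namespace RealRAM

/-! ### Construction of the layered graph -/

/-- Vertices and edges of `H` are numbered by a counter as they are created; this is the step of
that counter. -/
theorem bijOn_insert {α : Type} {f f' : α → ℕ} {S : Set α} {N : ℕ} {x : α}
    (h : Set.BijOn f S (Set.Iio N)) (hf : ∀ y ∈ S, f' y = f y) (hfx : f' x = N) :
    Set.BijOn f' (insert x S) (Set.Iio (N + 1)) := by
  have h1 : Set.BijOn f' S (Set.Iio N) := h.congr fun y hy => (hf y hy).symm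
  have h2 := h1.insert (a := x) (by rw [hfx]; simp)
  rw [hfx] at h2
  convert h2 using 1
  ext i
  simp only [Set.mem_Iio, Set.mem_insert_iff]
  omega

theorem bijOn_congr {α : Type} {f f' : α → ℕ} {S S' : Set α} {N N' : ℕ}
    (h : Set.BijOn f S (Set.Iio N)) (hf : ∀ x, f' x = f x) (hS : ∀ x, x ∈ S' ↔ x ∈ S)
    (hN : N' = N) : Set.BijOn f' S' (Set.Iio N') := by
  rw [show f' = f from funext hf, show S' = S from Set.ext hS, hN]
  exact h

theorem exists_equiv_of_bijOn {α β : Type} {f : α → ℕ} {S : Set α} {N : ℕ}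
    (h : Set.BijOn f S (Set.Iio N)) (g : β → α) (hg : Function.Injective g)
    (hS : ∀ a, a ∈ S ↔ ∃ b, g b = a) : ∃ ε : β ≃ Fin N, ∀ b, (ε b : ℕ) = f (g b) := by
  have hm : ∀ b, f (g b) < N := fun b => h.mapsTo ((hS _).2 ⟨b, rfl⟩)
  refine ⟨Equiv.ofBijective (fun b => ⟨f (g b), hm b⟩) ⟨fun b b' hb => ?_, fun i => ?_⟩,
    fun b => rfl⟩
  · exact hg (h.injOn ((hS _).2 ⟨b, rfl⟩) ((hS _).2 ⟨b', rfl⟩) (congrArg Fin.val hb))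
  · obtain ⟨a, ha, hai⟩ := h.surjOn (show (i : ℕ) ∈ Set.Iio N from i.2)
    obtain ⟨b, rfl⟩ := (hS a).1 ha
    exact ⟨b, Fin.ext hai⟩

open Classical in
-- Evaluates the time of loops whose passes are expensive only at the elements of `S`, such as the
-- copied vertices.
theorem sum_indicator_eq_ncard {n : ℕ} (S : Set (Fin n)) :
    ∑ j ∈ Finset.range n, (if ∃ v ∈ S, (v : ℕ) = j then 1 else 0) = S.ncard := by
  rw [← Fin.sum_univ_eq_sum_range (fun j => if ∃ v ∈ S, (v : ℕ) = j then 1 else 0) n]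
  have : ∀ i : Fin n, (∃ v ∈ S, (v : ℕ) = i) ↔ i ∈ S := fun i =>
    ⟨fun ⟨v, hv, h⟩ => by rwa [← Fin.ext h], fun h => ⟨i, h, rfl⟩⟩
  simp only [this]
  rw [Finset.sum_boole, Set.ncard_eq_toFinset_card']
  simp

section

variable {n m : ℕ} {G : WGraph (Fin n) (Fin m)} {r : ℕ} {s : State}

/-- The memory holds the graph and the table of its super-source distances. -/
structure Tables (G : WGraph (Fin n) (Fin m)) (r : ℕ) (s : State) : Prop where
  rep : Rep s G (Equiv.refl _) (Equiv.refl _)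
  h30 : s.ints 30 0 = r
  h33 : s.ints 33 0 = r + 1
  h34 : s.ints 34 0 = r * n
  tab : ∀ j ≤ r, ∀ v : Fin n, s.reals 13 (j * n + v) = G.superDist j v

theorem Tables.frame {p : Prog} {s' : State} (h : Tables G r s) (hf : Frame p s s')
    (hp : (p.wi 10 || p.wi 11 || p.wi 12 || p.wi 13 || p.wi 14 || p.wr 10) = false)
    (hp' : (p.wi 30 || p.wi 33 || p.wi 34 || p.wr 13) = false) : Tables G r s' := by
  have h1 := h.rep.frame hf hp
  simp only [Bool.or_eq_false_iff] at hp'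
  obtain ⟨⟨⟨k0, k1⟩, k2⟩, k3⟩ := hp'
  exact ⟨h1, by rw [hf.1 _ k0, h.h30], by rw [hf.1 _ k1, h.h33], by rw [hf.1 _ k2, h.h34],
    by rw [hf.2 _ k3]; exact h.tab⟩

theorem Tables.copied_iff (h : Tables G r s) (hG : ∀ e, e ∉ G.neg → 0 ≤ G.wt e) (v : Fin n) :
    s.reals 13 (r * n + v) < 0 ↔ v ∈ G.copied r := by
  rw [h.tab r le_rfl, G.mem_copied_iff hG]

/-- The tables are stored row by row, with `v_j` at position `j * n + v`; distinct copies do not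
collide. -/
theorem mul_add_injective {i j : ℕ} {u v : Fin n} (h : i * n + u = j * n + v) : u = v ∧ i = j := by
  have hn : 0 < n := u.pos
  have h1 : (i * n + u) % n = (j * n + v) % n := by rw [h]
  have h2 : (i * n + u) / n = (j * n + v) / n := by rw [h]
  rw [Nat.mul_add_mod', Nat.mul_add_mod', Nat.mod_eq_of_lt u.2, Nat.mod_eq_of_lt v.2] at h1
  rw [Nat.mul_comm i, Nat.mul_comm j, Nat.mul_add_div hn, Nat.mul_add_div hn,
    Nat.div_eq_of_lt u.2, Nat.div_eq_of_lt v.2] at h2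
  exact ⟨Fin.ext h1, by omega⟩

/-- Number the vertices of the layered graph: entry `j n + v` of array `38` becomes the number of
`v_j`, and the scalar `39` the number of vertices. -/
def buildIds : Prog :=
  forUp 21 10 (.iset 38 (var 21) (var 21)) ;; assign 39 (var 10) ;;
  forUp 21 10 (.ite (.rlt (.load 13 ((var 34).add (var 21))) .zero)
    (assign 41 (var 21) ;;
      forUp 46 30 (assign 41 ((var 41).add (var 10)) ;; .iset 38 (var 41) (var 39) ;;
        assign 39 ((var 39).add (.const 1))))
    .skip)

/-- The number of the copy `x` of a vertex. -/
def idOf (n : ℕ) (s : State) (x : Fin n × ℕ) : ℕ := s.ints 38 (x.2 * n + x.1)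

/-- Layer 0 is numbered first, by the identity, so that `v_0` keeps the number of `v`. The higher
copies follow vertex by vertex. -/
theorem buildIds_spec (h : Tables G r s) (hG : ∀ e, e ∉ G.neg → 0 ≤ G.wt e) :
    Ter buildIds s (n * 200 + (G.copied r).ncard * (r * 60) + 40) fun s' =>
      Set.BijOn (idOf n s') {x | x.2 ≤ r ∧ (x.1 ∈ G.copied r ∨ x.2 = 0)}
        (Set.Iio (s'.ints 39 0)) ∧ ∀ v < n, s'.ints 38 v = v := by
  classical
  have e1 : Ter (forUp 21 10 (.iset 38 (var 21) (var 21))) s (n * 40 + 9) fun s' =>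
      ∀ v < n, s'.ints 38 v = v := by
    refine (Ter.forUp_const 28 (fun j s' => ∀ v < j, s'.ints 38 v = v) h.rep.verts rfl rfl
      (by norm_num) (by simp) ?_).mono (by omega) fun _ _ h => h.1
    rintro j s1 hj hf h21 - hI
    refine Ter.exec rfl (by decide) ?_
    simp only [Prog.exec, eval_var, h21, State.setInt_ints, Nat.reduceEqDiff, if_true, if_false]
    intro v hv
    rw [Function.update_apply]
    split_ifs with h
    · omega
    · exact hI v (by omega)
  refine (e1.seq (T' := n * 160 + (G.copied r).ncard * (r * 60) + 20) ?_).mono (by omega)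
    fun _ _ h => h
  intro s1 hf1 h1
  have hT1 := h.frame hf1 rfl rfl
  refine (Ter.seq (T := 5) (Q := fun s2 => s2 = s1.setInt 39 0 n) (Ter.exec rfl (by decide) ?_)
    (T' := n * 160 + (G.copied r).ncard * (r * 60) + 9) ?_).mono (by omega) fun _ _ h => h
  · simp only [assign, Prog.exec, eval_var, IExpr.eval, hT1.rep.verts]
  rintro s2 hf2 rfl
  have hT2 := hT1.frame hf2 rfl rfl
  refine (Ter.forUp (fun j => (if ∃ v ∈ G.copied r, (v : ℕ) = j then 1 else 0) * (r * 60) + 60)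
    (fun j s' => Set.BijOn (idOf n s') {x | x.2 = 0 ∨ ((x.1 : ℕ) < j ∧ x.1 ∈ G.copied r ∧
      1 ≤ x.2 ∧ x.2 ≤ r)} (Set.Iio (s'.ints 39 0)) ∧ ∀ v < n, s'.ints 38 v = v)
    hT2.rep.verts rfl rfl (by norm_num) ?_ ?_).mono ?_ ?_
  · simp only [State.setInt_ints, Nat.reduceEqDiff, if_false, if_true, Function.update_self]
    refine ⟨⟨fun x hx => ?_, fun x hx y hy hxy => ?_, fun i hi => ?_⟩, h1⟩
    · have hx : x.2 = 0 := by simpa using hx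
      simp [idOf, hx, h1]
    · have hx : x.2 = 0 := by simpa using hx
      have hy : y.2 = 0 := by simpa using hy
      simp only [idOf, hx, hy, State.setInt_ints, Nat.reduceEqDiff, if_false, zero_mul, zero_add]
        at hxy
      rw [h1 _ x.1.2, h1 _ y.1.2] at hxy
      exact Prod.ext (Fin.ext hxy) (hx.trans hy.symm)
    · exact ⟨(⟨i, hi⟩, 0), Or.inl rfl, by simpa [idOf] using h1 i hi⟩
  · rintro j s3 hj hf h21 h10 ⟨hI, hz⟩
    have hT3 := hT2.frame hf rfl rfl
    have hcop := hT3.copied_iff hG ⟨j, hj⟩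
    have hex : (∃ v ∈ G.copied r, (v : ℕ) = j) ↔ (⟨j, hj⟩ : Fin n) ∈ G.copied r :=
      ⟨fun ⟨v, hv, h⟩ => by subst h; exact hv, fun h => ⟨_, h, rfl⟩⟩
    have hh : ∀ s', (BExpr.rlt (.load 13 ((var 34).add (var 21))) .zero).Holds s' ↔
        s'.reals 13 (s'.ints 34 0 + s'.ints 21 0) < 0 := fun s' => Iff.rfl
    refine (Ter.ite (T := (if ∃ v ∈ G.copied r, (v : ℕ) = j then 1 else 0) * (r * 60) + 40)
      (fun hb => ?_) (fun hb => ?_)).mono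
        (by simp only [BExpr.cost, RExpr.cost, IExpr.cost, var]; omega) fun _ _ h => h
    · rw [hh, hT3.h34, h21] at hb
      have hR := hcop.1 hb
      rw [if_pos (hex.2 hR)]
      refine (Ter.seq (T := 5) (Q := fun s4 => s4 = s3.setInt 41 0 j)
        (Ter.exec rfl (by decide) ?_) (T' := r * 60 + 9) ?_).mono (by omega) fun _ _ h => h
      · simp only [assign, Prog.exec, eval_var, IExpr.eval, h21]
      rintro s4 hf4 rfl
      have hT4 := hT3.frame hf4 rfl rfl
      refine (Ter.forUp_const 48 (fun i s' => Set.BijOn (idOf n s') {x | (x.2 = 0 ∨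
        ((x.1 : ℕ) < j ∧ x.1 ∈ G.copied r ∧ 1 ≤ x.2 ∧ x.2 ≤ r)) ∨ ((x.1 : ℕ) = j ∧ 1 ≤ x.2 ∧
        x.2 ≤ i)} (Set.Iio (s'.ints 39 0)) ∧ (∀ v < n, s'.ints 38 v = v) ∧
        s'.ints 41 0 = i * n + j) hT4.h30 rfl rfl (by norm_num) ?_ ?_).mono (by omega) ?_
      · refine ⟨?_, by simpa using hz, by simp⟩
        refine bijOn_congr hI (fun x => by simp [idOf]) (fun x => ?_) (by simp)
        by_cases hp : x.1 ∈ G.copied r <;>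
          simp only [Set.mem_ofPred_eq, hp, true_and, false_and, and_false, or_false] <;> omega
      · rintro i s5 hi hf5 h46 - ⟨h3, h4, h5⟩
        have hT5 := hT4.frame hf5 rfl rfl
        refine Ter.exec rfl (by decide) ?_
        simp only [assign, Prog.exec, eval_var, IExpr.eval, State.setInt_ints, Nat.reduceEqDiff,
          if_true, if_false, Function.update_self, h5, hT5.rep.verts]
        have hpos : i * n + j + n = (i + 1) * n + j := by ring
        refine ⟨?_, fun v hv => ?_, by rw [hpos]⟩
        · have hins := bijOn_insert (x := ((⟨j, hj⟩ : Fin n), i + 1)) (f' := idOf n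
            (s5.setInt 38 ((i + 1) * n + j) (s5.ints 39 0))) h3 ?_ (by simp [idOf])
          · refine bijOn_congr hins (fun x => by simp [idOf, hpos]) (fun x => ?_) rfl
            · by_cases hp : x.1 ∈ G.copied r <;>
                simp only [Set.mem_ofPred_eq, Set.mem_insert_iff, Prod.ext_iff, Fin.ext_iff, hp,
                  true_and, false_and, and_false, or_false] <;> omega
          · intro y hy
            simp only [idOf, State.setInt_ints, if_true]
            rw [Function.update_of_ne]
            intro h6
            obtain ⟨h7, h8⟩ := mul_add_injective (v := ⟨j, hj⟩) h6
            simp only [Set.mem_ofPred_eq, h7, h8] at hy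
            omega
        · rw [Function.update_of_ne]
          · exact h4 v hv
          -- Positions in rows above `0` are at least `n`, so the identity on layer 0 is not
          -- overwritten.
          · have : n ≤ (i + 1) * n := Nat.le_mul_of_pos_left n (by omega)
            omega
      · rintro s5 - ⟨⟨h3, h4, -⟩, -⟩
        refine ⟨?_, by simpa using h4⟩
        refine bijOn_congr h3 (fun x => by simp [idOf]) (fun x => ?_) (by simp)
        have : (x.1 : ℕ) = j → x.1 ∈ G.copied r := fun h => by
          have : x.1 = ⟨j, hj⟩ := Fin.ext h
          rw [this]; exact hR
        simp only [Set.mem_ofPred_eq]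
        constructor
        · rintro (h6 | ⟨h6, h7, h8⟩)
          · exact Or.inl (Or.inl h6)
          · rcases Nat.lt_succ_iff_lt_or_eq.1 h6 with h6 | h6
            · exact Or.inl (Or.inr ⟨h6, h7, h8⟩)
            · exact Or.inr ⟨h6, h8⟩
        · rintro ((h6 | ⟨h6, h7⟩) | ⟨h6, h7⟩)
          · exact Or.inl h6
          · exact Or.inr ⟨by omega, h7⟩
          · exact Or.inr ⟨by omega, this h6, h7⟩
    · rw [hh, hT3.h34, h21, hcop] at hb
      refine Ter.exec rfl (by simp [Prog.cost]) ?_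
      simp only [Prog.exec]
      refine ⟨?_, by simpa using hz⟩
      refine bijOn_congr hI (fun x => by simp [idOf]) (fun x => ?_) (by simp)
      have : (x.1 : ℕ) = j → x.1 ∉ G.copied r := fun h => by
        have : x.1 = ⟨j, hj⟩ := Fin.ext h
        rw [this]; exact hb
      simp only [Set.mem_ofPred_eq]
      constructor
      · rintro (h6 | ⟨h6, h7, h8⟩)
        · exact Or.inl h6
        · rcases Nat.lt_succ_iff_lt_or_eq.1 h6 with h6 | h6
          · exact Or.inr ⟨h6, h7, h8⟩
          · exact absurd h7 (this h6)
      · rintro (h6 | ⟨h6, h7⟩)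
        · exact Or.inl h6
        · exact Or.inr ⟨by omega, h7⟩
  · have : ∑ j ∈ Finset.range n, ((if ∃ v ∈ G.copied r, (v : ℕ) = j then 1 else 0) * (r * 60) +
        60 + 12) = (G.copied r).ncard * (r * 60) + n * 72 := by
      rw [← sum_indicator_eq_ncard, Finset.sum_mul]
      simp only [Finset.sum_add_distrib, Finset.sum_const, Finset.card_range, smul_eq_mul]
      ring
    rw [this]; omega
  · rintro s3 - ⟨⟨h3, h4⟩, -⟩
    refine ⟨?_, h4⟩
    refine bijOn_congr h3 (fun x => rfl) (fun x => ?_) rfl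
    have := x.1.2
    simp only [Set.mem_ofPred_eq, this, true_and]
    constructor
    · rintro ⟨h5, h6 | h6⟩
      · rcases Nat.eq_zero_or_pos x.2 with h7 | h7
        · exact Or.inl h7
        · exact Or.inr ⟨h6, h7, h5⟩
      · exact Or.inl h6
    · rintro (h5 | ⟨h5, h6, h7⟩)
      · exact ⟨by omega, Or.inr h5⟩
      · exact ⟨h7, Or.inl h5⟩

end

end RealRAM

/-! ### Emitting the edges of the layered graph -/

namespace RealRAM

/-- Append an edge to the layered graph: the scalars `42` and `43` are the positions of its tail and
head in the tables, and the entry `0` of array `14` is the weight of the underlying edge. -/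
def emit : Prog :=
  .iset 6 (var 40) (.load 38 (var 42)) ;; .iset 7 (var 40) (.load 38 (var 43)) ;;
  .rset 2 (var 40) (.sub (.add (.load 14 (.const 0)) (.load 13 (var 42))) (.load 13 (var 43))) ;;
  .ite (.rlt (.load 2 (var 40)) .zero) (.iset 8 (var 40) (.const 1))
    (.iset 8 (var 40) (.const 0)) ;;
  assign 40 ((var 40).add (.const 1))

open Classical in
/-- The edges in `S` are stored; `px`, `py` are the positions of their tails and heads in the tables
`id` and `tb`, and `bw` are the weights of the underlying edges. -/
def Emitted {α : Type} (px py : α → ℕ) (bw : α → ℝ) (id : ℕ → ℕ) (tb : ℕ → ℝ) (S : Set α)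
    (tail head flag : ℕ → ℕ) (wt : ℕ → ℝ) (N : ℕ) : Prop :=
  ∃ f : α → ℕ, Set.BijOn f S (Set.Iio N) ∧ ∀ x ∈ S, tail (f x) = id (px x) ∧
    head (f x) = id (py x) ∧ wt (f x) = bw x + tb (px x) - tb (py x) ∧
    flag (f x) = if bw x + tb (px x) - tb (py x) < 0 then 1 else 0

theorem Emitted.congr {α : Type} {px py : α → ℕ} {bw : α → ℝ} {id : ℕ → ℕ} {tb : ℕ → ℝ}
    {S S' : Set α} {tail head flag : ℕ → ℕ} {wt : ℕ → ℝ} {N : ℕ}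
    (h : Emitted px py bw id tb S tail head flag wt N) (hS : ∀ x, x ∈ S' ↔ x ∈ S) :
    Emitted px py bw id tb S' tail head flag wt N := by
  rwa [show S' = S from Set.ext hS]

/-- The new edge takes the value of the counter as its number, and all earlier numbers are smaller,
so no stored edge is disturbed. -/
theorem emit_spec {α : Type} {px py : α → ℕ} {bw : α → ℝ} {S : Set α} {s : State} {x : α}
    (h : Emitted px py bw (s.ints 38) (s.reals 13) S (s.ints 6) (s.ints 7) (s.ints 8) (s.reals 2)
      (s.ints 40 0)) (hx : x ∉ S) (h42 : s.ints 42 0 = px x) (h43 : s.ints 43 0 = py x)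
    (hw : s.reals 14 0 = bw x) :
    Ter emit s 60 fun s' => Emitted px py bw (s.ints 38) (s.reals 13) (insert x S) (s'.ints 6)
      (s'.ints 7) (s'.ints 8) (s'.reals 2) (s'.ints 40 0) := by
  classical
  obtain ⟨f, hf, hS⟩ := h
  set N := s.ints 40 0 with hN
  refine Ter.exec rfl (by decide) ⟨Function.update f x N, ?_⟩
  have hne : ∀ y ∈ S, f y ≠ N := fun y hy => (hf.mapsTo hy).ne
  have e40 : (emit.exec s).ints 40 0 = N + 1 := by
    simp only [emit, assign, Prog.exec, BExpr.Holds, IExpr.eval, RExpr.eval, eval_var,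
      State.setInt_ints, State.setInt_reals, State.setReal_reals, State.setReal_ints,
      Nat.reduceEqDiff, if_true, if_false, ← hN, h42, h43, hw, Function.update_self]
    split_ifs <;> simp [← hN]
  have e6 : (emit.exec s).ints 6 = Function.update (s.ints 6) N (s.ints 38 (px x)) := by
    simp only [emit, assign, Prog.exec, BExpr.Holds, IExpr.eval, RExpr.eval, eval_var,
      State.setInt_ints, State.setInt_reals, State.setReal_reals, State.setReal_ints,
      Nat.reduceEqDiff, if_true, if_false, ← hN, h42, h43, hw, Function.update_self]
    split_ifs <;> simp
  have e7 : (emit.exec s).ints 7 = Function.update (s.ints 7) N (s.ints 38 (py x)) := by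
    simp only [emit, assign, Prog.exec, BExpr.Holds, IExpr.eval, RExpr.eval, eval_var,
      State.setInt_ints, State.setInt_reals, State.setReal_reals, State.setReal_ints,
      Nat.reduceEqDiff, if_true, if_false, ← hN, h42, h43, hw, Function.update_self]
    split_ifs <;> simp
  have e2 : (emit.exec s).reals 2 = Function.update (s.reals 2) N
      (bw x + s.reals 13 (px x) - s.reals 13 (py x)) := by
    simp only [emit, assign, Prog.exec, BExpr.Holds, IExpr.eval, RExpr.eval, eval_var,
      State.setInt_ints, State.setInt_reals, State.setReal_reals, State.setReal_ints,
      Nat.reduceEqDiff, if_true, if_false, ← hN, h42, h43, hw, Function.update_self]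
    split_ifs <;> simp
  have e8 : (emit.exec s).ints 8 = Function.update (s.ints 8) N
      (if bw x + s.reals 13 (px x) - s.reals 13 (py x) < 0 then 1 else 0) := by
    simp only [emit, assign, Prog.exec, BExpr.Holds, IExpr.eval, RExpr.eval, eval_var,
      State.setInt_ints, State.setInt_reals, State.setReal_reals, State.setReal_ints,
      Nat.reduceEqDiff, if_true, if_false, ← hN, h42, h43, hw, Function.update_self]
    split_ifs <;> simp
  rw [e40, e6, e7, e2, e8]
  refine ⟨bijOn_insert hf (fun y hy => ?_) (by simp), fun y hy => ?_⟩
  · rw [Function.update_of_ne]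
    rintro rfl; exact hx hy
  · rcases Set.mem_insert_iff.1 hy with rfl | hy'
    · simp
    · have hyx : y ≠ x := by rintro rfl; exact hx hy'
      simpa only [Function.update_of_ne hyx, Function.update_of_ne (hne y hy')] using hS y hy'

/-- A set of copies of edges and self edges. -/
def sumSet {α β : Type} (A : α → Prop) (B : β → Prop) : Set (α ⊕ β) := {x | Sum.elim A B x}

@[simp] theorem inl_mem_sumSet {α β : Type} (A : α → Prop) (B : β → Prop) (x : α) :
    Sum.inl x ∈ sumSet A B ↔ A x := Iff.rfl

@[simp] theorem inr_mem_sumSet {α β : Type} (A : α → Prop) (B : β → Prop) (x : β) :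
    Sum.inr x ∈ sumSet A B ↔ B x := Iff.rfl

section

variable {n m : ℕ} (G : WGraph (Fin n) (Fin m)) (r : ℕ)

open Classical in
/-- The number of copies of an edge. -/
noncomputable def copies (e : Fin m) : ℕ :=
  if G.src e ∈ G.copied r then (if e ∈ G.neg then r else r + 1) else 1

/-- The position of the tail of an edge of the layered graph in the tables. -/
def posTail : (Fin m × ℕ) ⊕ (Fin n × ℕ) → ℕ
  | Sum.inl x => x.2 * n + G.src x.1
  | Sum.inr x => x.2 * n + x.1

open Classical in
/-- The position of the head of an edge of the layered graph in the tables. -/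
noncomputable def posHead : (Fin m × ℕ) ⊕ (Fin n × ℕ) → ℕ
  | Sum.inl x => (G.dst x.1 : ℕ) +
      if G.dst x.1 ∈ G.copied r then (if x.1 ∈ G.neg then x.2 * n + n else x.2 * n) else 0
  | Sum.inr x => (x.1 : ℕ) + if x.2 < r then x.2 * n + n else 0

/-- The weight of the edge underlying an edge of the layered graph. -/
def baseWt : (Fin m × ℕ) ⊕ (Fin n × ℕ) → ℝ
  | Sum.inl x => G.wt x.1
  | Sum.inr _ => 0

/-- The edges in `S` of the layered graph are stored. -/
def Built (id : ℕ → ℕ) (tb : ℕ → ℝ) (S : Set ((Fin m × ℕ) ⊕ (Fin n × ℕ))) (s : State) : Prop :=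
  Emitted (posTail G) (posHead G r) (baseWt G) id tb S (s.ints 6) (s.ints 7) (s.ints 8) (s.reals 2)
    (s.ints 40 0)

end

/-- The test whether the vertex `x` is copied. -/
def isCopied (x : IExpr) : BExpr := .rlt (.load 13 ((var 34).add x)) .zero

/-- The test whether the edge held by the scalar `20` is negative. -/
def isNeg : BExpr := .ilt (.const 0) (.load 14 (var 20))

/-- Emit the copy of the edge held by the scalar `20` in the row that starts at the scalar `41`. -/
def emitCopy : Prog :=
  (assign 42 ((var 41).add (.load 12 (var 20))) ;; assign 43 (.load 13 (var 20)) ;;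
    .ite (isCopied (.load 13 (var 20)))
      (.ite isNeg (assign 43 ((var 43).add ((var 41).add (var 10))))
        (assign 43 ((var 43).add (var 41)))) .skip) ;;
  emit ;; assign 41 ((var 41).add (var 10))

/-- Emit the copies of the edges. -/
def buildCopies : Prog :=
  forUp 20 11
    ((assign 45 (.const 1) ;;
      .ite (isCopied (.load 12 (var 20)))
        (.ite isNeg (assign 45 (var 30)) (assign 45 (var 33))) .skip ;;
      assign 41 (.const 0) ;; .rset 14 (.const 0) (.load 10 (var 20))) ;;
    forUp 46 45 emitCopy)

/-- Emit the self edge of the vertex held by the scalar `21` in the layer held by the scalar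
`46`. -/
def emitSelf : Prog :=
  (assign 42 ((var 41).add (var 21)) ;; assign 43 (var 21) ;;
    .ite (.ilt (var 46) (var 30)) (assign 43 ((var 43).add ((var 41).add (var 10)))) .skip) ;;
  emit ;; assign 41 ((var 41).add (var 10))

/-- Emit the self edges. -/
def buildSelf : Prog :=
  .rset 14 (.const 0) .zero ;;
  forUp 21 10 (.ite (isCopied (var 21)) (assign 41 (.const 0) ;; forUp 46 33 emitSelf) .skip)

section

variable {n m : ℕ} {G : WGraph (Fin n) (Fin m)} {r : ℕ} {s : State}

theorem Tables.isCopied_iff (h : Tables G r s) (hG : ∀ e, e ∉ G.neg → 0 ≤ G.wt e) {x : IExpr}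
    {v : Fin n} (hx : x.eval s = v) : (isCopied x).Holds s ↔ v ∈ G.copied r := by
  rw [← h.copied_iff hG]
  simp only [isCopied, BExpr.Holds, RExpr.eval, IExpr.eval, eval_var, hx, h.h34]

theorem Tables.isNeg_iff (h : Tables G r s) {e : Fin m} (he : s.ints 20 0 = e) :
    isNeg.Holds s ↔ e ∈ G.neg := by
  have := h.rep.flag_eq_zero e
  simp only [Equiv.refl_apply] at this
  simp only [isNeg, BExpr.Holds, IExpr.eval, eval_var, he]
  rw [Nat.pos_iff_ne_zero, Ne, this, not_not]

theorem emitCopy_spec (h : Tables G r s) (hG : ∀ e, e ∉ G.neg → 0 ≤ G.wt e) {e : Fin m} {i : ℕ}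
    (h20 : s.ints 20 0 = e) (h41 : s.ints 41 0 = i * n) (hw : s.reals 14 0 = G.wt e)
    {S : Set ((Fin m × ℕ) ⊕ (Fin n × ℕ))} (hB : Built G r (s.ints 38) (s.reals 13) S s)
    (hS : Sum.inl (e, i) ∉ S) :
    Ter emitCopy s 150 fun s' => Built G r (s.ints 38) (s.reals 13) (insert (Sum.inl (e, i)) S) s' ∧
      s'.ints 41 0 = (i + 1) * n := by
  classical
  have t1 := h.rep.tail e
  have t2 := h.rep.head e
  simp only [Equiv.refl_apply] at t1 t2
  refine (Ter.seq (T := 75) (Q := fun s1 => s1.ints 42 0 = posTail G (Sum.inl (e, i)) ∧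
    s1.ints 43 0 = posHead G r (Sum.inl (e, i))) (Ter.exec rfl (by decide) ?_)
    (T' := 70) ?_).mono (by omega) fun _ _ h => h
  -- The tests are evaluated after assignments to scalars on which they do not depend; `hc` and `hn`
  -- transfer them to those states.
  · have hc : ∀ s' : State, s'.ints 13 = s.ints 13 → s'.ints 20 = s.ints 20 →
        s'.ints 34 = s.ints 34 → s'.reals 13 = s.reals 13 →
        ((isCopied (.load 13 (var 20))).Holds s' ↔ G.dst e ∈ G.copied r) := by
      intro s' k1 k2 k3 k4
      rw [← h.isCopied_iff hG (x := .load 13 (var 20)) (v := G.dst e)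
        (by simp [IExpr.eval, eval_var, h20, t2])]
      simp only [isCopied, BExpr.Holds, RExpr.eval, IExpr.eval, eval_var, k1, k2, k3, k4]
    have hn : ∀ s' : State, s'.ints 14 = s.ints 14 → s'.ints 20 = s.ints 20 →
        (isNeg.Holds s' ↔ e ∈ G.neg) := by
      intro s' k1 k2
      rw [← h.isNeg_iff h20]
      simp only [isNeg, BExpr.Holds, IExpr.eval, eval_var, k1, k2]
    simp only [assign, Prog.exec, IExpr.eval, eval_var]
    rw [hc _ (by simp) (by simp) (by simp) (by simp), hn _ (by simp) (by simp)]
    simp only [posTail, posHead]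
    split_ifs <;> simp [h20, h41, t1, t2, h.rep.verts]
  rintro s1 hf1 ⟨h42, h43⟩
  refine (Ter.seq (emit_spec (S := S) (x := Sum.inl (e, i)) (px := posTail G) (py := posHead G r)
    (bw := baseWt G) ?_ hS h42 h43 ?_) (T' := 10) ?_).mono (by omega) fun _ _ h => h
  · rw [hf1.1 38 rfl, hf1.2 13 rfl, hf1.1 6 rfl, hf1.1 7 rfl, hf1.1 8 rfl, hf1.2 2 rfl,
      hf1.1 40 rfl]
    exact hB
  · rw [hf1.2 14 rfl, hw]; rfl
  · intro s2 hf2 h2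
    rw [hf1.1 38 rfl, hf1.2 13 rfl] at h2
    refine Ter.exec rfl (by decide) ?_
    simp only [assign, Prog.exec, IExpr.eval, eval_var, Built, State.setInt_ints,
      State.setInt_reals, Nat.reduceEqDiff, if_true, if_false, Function.update_self]
    refine ⟨h2, ?_⟩
    rw [hf2.1 41 rfl, hf2.1 10 rfl, hf1.1 41 rfl, hf1.1 10 rfl, h41, h.rep.verts]
    ring

theorem emitSelf_spec (h : Tables G r s) {u : Fin n} {i : ℕ}
    (h21 : s.ints 21 0 = u) (h46 : s.ints 46 0 = i) (h41 : s.ints 41 0 = i * n)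
    (hw : s.reals 14 0 = 0)
    {S : Set ((Fin m × ℕ) ⊕ (Fin n × ℕ))} (hB : Built G r (s.ints 38) (s.reals 13) S s)
    (hS : Sum.inr (u, i) ∉ S) :
    Ter emitSelf s 150 fun s' => Built G r (s.ints 38) (s.reals 13) (insert (Sum.inr (u, i)) S) s' ∧
      s'.ints 41 0 = (i + 1) * n := by
  classical
  refine (Ter.seq (T := 75) (Q := fun s1 => s1.ints 42 0 = posTail G (Sum.inr (u, i)) ∧
    s1.ints 43 0 = posHead G r (Sum.inr (u, i))) (Ter.exec rfl (by decide) ?_)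
    (T' := 70) ?_).mono (by omega) fun _ _ h => h
  · simp only [assign, Prog.exec, IExpr.eval, eval_var, BExpr.Holds, State.setInt_ints,
      Nat.reduceEqDiff, if_false, h46, h.h30]
    simp only [posTail, posHead]
    split_ifs <;> simp [h21, h41, h.rep.verts]
  rintro s1 hf1 ⟨h42, h43⟩
  refine (Ter.seq (emit_spec (S := S) (x := Sum.inr (u, i)) (px := posTail G) (py := posHead G r)
    (bw := baseWt G) ?_ hS h42 h43 ?_) (T' := 10) ?_).mono (by omega) fun _ _ h => h
  · rw [hf1.1 38 rfl, hf1.2 13 rfl, hf1.1 6 rfl, hf1.1 7 rfl, hf1.1 8 rfl, hf1.2 2 rfl,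
      hf1.1 40 rfl]
    exact hB
  · rw [hf1.2 14 rfl, hw]; rfl
  · intro s2 hf2 h2
    rw [hf1.1 38 rfl, hf1.2 13 rfl] at h2
    refine Ter.exec rfl (by decide) ?_
    simp only [assign, Prog.exec, IExpr.eval, eval_var, Built, State.setInt_ints,
      State.setInt_reals, Nat.reduceEqDiff, if_true, if_false, Function.update_self]
    refine ⟨h2, ?_⟩
    rw [hf2.1 41 rfl, hf2.1 10 rfl, hf1.1 41 rfl, hf1.1 10 rfl, h41, h.rep.verts]
    ring

theorem Built.congr {id : ℕ → ℕ} {tb : ℕ → ℝ} {S S' : Set ((Fin m × ℕ) ⊕ (Fin n × ℕ))}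
    {s' : State} (h : Built G r id tb S s) (hS : ∀ x, x ∈ S' ↔ x ∈ S)
    (h6 : s'.ints 6 = s.ints 6) (h7 : s'.ints 7 = s.ints 7) (h8 : s'.ints 8 = s.ints 8)
    (h2 : s'.reals 2 = s.reals 2) (h40 : s'.ints 40 = s.ints 40) : Built G r id tb S' s' := by
  rw [Built, h6, h7, h8, h2, h40]
  exact Emitted.congr h hS

theorem copies_le (e : Fin m) [Decidable (G.src e ∈ G.copied r)] :
    copies G r e ≤ (if G.src e ∈ G.copied r then 1 else 0) * r + 1 := by
  classical
  simp only [copies]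
  split_ifs <;> omega

/-- Every edge has a bounded cost, and only edges that leave copied vertices cost a further multiple
of `r`; the latter term is what remoteness and the degree bound control. -/
theorem buildCopies_spec (h : Tables G r s) (hG : ∀ e, e ∉ G.neg → 0 ≤ G.wt e)
    (hB : Built G r (s.ints 38) (s.reals 13) ∅ s) :
    Ter buildCopies s (m * 400 + {e | G.src e ∈ G.copied r}.ncard * (r * 200) + 9) fun s' =>
      Built G r (s.ints 38) (s.reals 13)
        (sumSet (fun x => x.2 < copies G r x.1) (fun _ => False)) s' := by
  classical
  set A : Set (Fin m) := {e | G.src e ∈ G.copied r} with hA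
  refine (Ter.forUp (fun j => (if ∃ e ∈ A, (e : ℕ) = j then 1 else 0) * (r * 200) + 300)
    (fun j s' => Built G r (s.ints 38) (s.reals 13)
      (sumSet (fun x => (x.1 : ℕ) < j ∧ x.2 < copies G r x.1) (fun _ => False)) s')
    h.rep.edges rfl rfl (by norm_num) ?_ ?_).mono ?_ ?_
  · refine hB.congr ?_ (by simp) (by simp) (by simp) (by simp) (by simp)
    rintro (x | x) <;> simp
  · rintro j s1 hj hf h20 h11 hI
    have hT1 := h.frame hf rfl rfl
    have t1 := hT1.rep.tail ⟨j, hj⟩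
    have t2 := hT1.rep.weight ⟨j, hj⟩
    simp only [Equiv.refl_apply] at t1 t2
    have hex : (∃ v ∈ A, (v : ℕ) = j) ↔ G.src ⟨j, hj⟩ ∈ G.copied r :=
      ⟨fun ⟨v, hv, h⟩ => by subst h; exact hv, fun h => ⟨⟨j, hj⟩, h, rfl⟩⟩
    have hcl := copies_le (G := G) (r := r) ⟨j, hj⟩
    simp only [hex]
    set K := copies G r ⟨j, hj⟩ with hK
    refine (Ter.seq (T := 60) (Q := fun s2 => s2.ints 45 0 = K ∧ s2.ints 41 0 = 0 ∧
      s2.reals 14 0 = G.wt ⟨j, hj⟩) (Ter.exec rfl (by decide) ?_) (T' := K * 170 + 9) ?_).mono ?_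
      fun _ _ h => h
    · have hc : ∀ s' : State, s'.ints 12 = s1.ints 12 → s'.ints 20 = s1.ints 20 →
          s'.ints 34 = s1.ints 34 → s'.reals 13 = s1.reals 13 →
          ((isCopied (.load 12 (var 20))).Holds s' ↔ G.src ⟨j, hj⟩ ∈ G.copied r) := by
        intro s' k1 k2 k3 k4
        rw [← hT1.isCopied_iff hG (x := .load 12 (var 20)) (v := G.src ⟨j, hj⟩)
          (by simp [IExpr.eval, eval_var, h20, t1])]
        simp only [isCopied, BExpr.Holds, RExpr.eval, IExpr.eval, eval_var, k1, k2, k3, k4]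
      have hn : ∀ s' : State, s'.ints 14 = s1.ints 14 → s'.ints 20 = s1.ints 20 →
          (isNeg.Holds s' ↔ (⟨j, hj⟩ : Fin m) ∈ G.neg) := by
        intro s' k1 k2
        rw [← hT1.isNeg_iff h20]
        simp only [isNeg, BExpr.Holds, IExpr.eval, eval_var, k1, k2]
      simp only [assign, Prog.exec, IExpr.eval, RExpr.eval, eval_var]
      rw [hc _ (by simp) (by simp) (by simp) (by simp), hn _ (by simp) (by simp)]
      rw [hK, copies]
      split_ifs <;> simp [h20, t2, hT1.h30, hT1.h33]
    · rintro s2 hf2 ⟨h45, h41, h14⟩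
      have hT2 := hT1.frame hf2 rfl rfl
      refine (Ter.forUp_const 158 (fun i s' => Built G r (s.ints 38) (s.reals 13)
        (sumSet (fun x => ((x.1 : ℕ) < j ∧ x.2 < copies G r x.1) ∨ ((x.1 : ℕ) = j ∧ x.2 < i))
          (fun _ => False)) s' ∧ s'.ints 41 0 = i * n) h45 rfl rfl (by norm_num) ?_ ?_).mono
        (by omega) ?_
      · refine ⟨?_, by simpa using h41⟩
        have e6 := hf2.1 6 rfl
        have e7 := hf2.1 7 rfl
        have e8 := hf2.1 8 rfl
        have e2 := hf2.2 2 rfl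
        have e40 := hf2.1 40 rfl
        refine hI.congr ?_ (by simp [e6]) (by simp [e7]) (by simp [e8]) (by simp [e2])
          (by simp [e40])
        rintro (x | x) <;> simp
      · rintro i s3 hi hf3 h46 - ⟨h3, h4⟩
        have hT3 := hT2.frame hf3 rfl rfl
        have e38 : s3.ints 38 = s.ints 38 := by rw [hf3.1 38 rfl, hf2.1 38 rfl, hf.1 38 rfl]
        have e13 : s3.reals 13 = s.reals 13 := by rw [hf3.2 13 rfl, hf2.2 13 rfl, hf.2 13 rfl]
        rw [← e38, ← e13] at h3 ⊢
        refine (emitCopy_spec (e := ⟨j, hj⟩) (i := i) hT3 hG ?_ h4 ?_ h3 (by simp)).mono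
          (by omega) ?_
        · rw [hf3.1 20 rfl, hf2.1 20 rfl, h20]
        · rw [hf3.2 14 rfl, h14]
        · rintro s4 - ⟨h5, h6⟩
          refine ⟨h5.congr ?_ (by simp) (by simp) (by simp) (by simp) (by simp), by simpa using h6⟩
          rintro (x | x)
          · simp only [inl_mem_sumSet, Set.mem_insert_iff, Sum.inl.injEq, Prod.ext_iff, Fin.ext_iff]
            omega
          · simp
      · rintro s3 - ⟨⟨h3, -⟩, -⟩
        refine h3.congr ?_ (by simp) (by simp) (by simp) (by simp) (by simp)
        rintro (x | x)
        · have : (x.1 : ℕ) = j → copies G r x.1 = K := fun h => by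
            rw [hK]; congr 1; exact Fin.ext h
          simp only [inl_mem_sumSet]
          by_cases hxj : (x.1 : ℕ) = j
          · rw [this hxj]; omega
          · omega
        · simp
    · have := Nat.mul_le_mul_right 170 hcl
      split_ifs at this ⊢ <;> omega
  · have : ∑ j ∈ Finset.range m, ((if ∃ e ∈ A, (e : ℕ) = j then 1 else 0) * (r * 200) +
        300 + 12) = A.ncard * (r * 200) + m * 312 := by
      rw [← sum_indicator_eq_ncard, Finset.sum_mul]
      simp only [Finset.sum_add_distrib, Finset.sum_const, Finset.card_range, smul_eq_mul]
      ring
    rw [this]; omega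
  · rintro s1 - ⟨h1, -⟩
    refine h1.congr ?_ rfl rfl rfl rfl rfl
    rintro (x | x) <;> simp

theorem buildSelf_spec (h : Tables G r s) (hG : ∀ e, e ∉ G.neg → 0 ≤ G.wt e)
    (hB : Built G r (s.ints 38) (s.reals 13)
      (sumSet (fun x => x.2 < copies G r x.1) (fun _ => False)) s) :
    Ter buildSelf s (n * 60 + (G.copied r).ncard * ((r + 1) * 200) + 20) fun s' =>
      Built G r (s.ints 38) (s.reals 13)
        (sumSet (fun x => x.2 < copies G r x.1) (fun x => x.1 ∈ G.copied r ∧ x.2 < r + 1)) s' := by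
  classical
  refine (Ter.seq (T := 5) (Q := fun s1 => s1 = s.setReal 14 0 0) (Ter.exec rfl (by decide) rfl)
    (T' := n * 60 + (G.copied r).ncard * ((r + 1) * 200) + 9) ?_).mono (by omega) fun _ _ h => h
  rintro s1 hf1 rfl
  have hT1 := h.frame hf1 rfl rfl
  refine (Ter.forUp (fun j => (if ∃ v ∈ G.copied r, (v : ℕ) = j then 1 else 0) *
      ((r + 1) * 200) + 40)
    (fun j s' => Built G r (s.ints 38) (s.reals 13) (sumSet (fun x => x.2 < copies G r x.1)
      (fun x => (x.1 : ℕ) < j ∧ x.1 ∈ G.copied r ∧ x.2 < r + 1)) s')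
    hT1.rep.verts rfl rfl (by norm_num) ?_ ?_).mono ?_ ?_
  · refine hB.congr ?_ (by simp) (by simp) (by simp) (by simp) (by simp)
    rintro (x | x) <;> simp
  · rintro j s2 hj hf h21 h10 hI
    have hT2 := hT1.frame hf rfl rfl
    have hex : (∃ v ∈ G.copied r, (v : ℕ) = j) ↔ (⟨j, hj⟩ : Fin n) ∈ G.copied r :=
      ⟨fun ⟨v, hv, h⟩ => by subst h; exact hv, fun h => ⟨_, h, rfl⟩⟩
    have hc := hT2.isCopied_iff hG (x := var 21) (v := ⟨j, hj⟩) h21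
    refine (Ter.ite (T := (if ∃ v ∈ G.copied r, (v : ℕ) = j then 1 else 0) * ((r + 1) * 200) + 20)
      (fun hb => ?_) (fun hb => ?_)).mono
      (by simp only [isCopied, BExpr.cost, RExpr.cost, IExpr.cost, var]; omega) fun _ _ h => h
    · have hR := hc.1 hb
      rw [if_pos (hex.2 hR)]
      refine (Ter.seq (T := 5) (Q := fun s4 => s4 = s2.setInt 41 0 0)
        (Ter.exec rfl (by decide) rfl) (T' := (r + 1) * 200 + 9) ?_).mono (by omega)
        fun _ _ h => h
      rintro s3 hf3 rfl
      have hT3 := hT2.frame hf3 rfl rfl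
      refine (Ter.forUp_const 188 (fun i s' => Built G r (s.ints 38) (s.reals 13)
        (sumSet (fun x => x.2 < copies G r x.1) (fun x => ((x.1 : ℕ) < j ∧ x.1 ∈ G.copied r ∧
          x.2 < r + 1) ∨ ((x.1 : ℕ) = j ∧ x.2 < i))) s' ∧ s'.ints 41 0 = i * n)
        hT3.h33 rfl rfl (by norm_num) ?_ ?_).mono (by omega) ?_
      · refine ⟨hI.congr ?_ (by simp) (by simp) (by simp) (by simp) (by simp), by simp⟩
        rintro (x | x) <;> simp
      · rintro i s4 hi hf4 h46 - ⟨h3, h4⟩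
        have hT4 := hT3.frame hf4 rfl rfl
        have e38 : s4.ints 38 = s.ints 38 := by rw [hf4.1 38 rfl, hf3.1 38 rfl, hf.1 38 rfl]; rfl
        have e13 : s4.reals 13 = s.reals 13 := by
          rw [hf4.2 13 rfl, hf3.2 13 rfl, hf.2 13 rfl]; simp
        rw [← e38, ← e13] at h3 ⊢
        refine (emitSelf_spec (u := ⟨j, hj⟩) (i := i) hT4 ?_ h46 h4 ?_ h3 (by simp)).mono
          (by omega) ?_
        · rw [hf4.1 21 rfl, hf3.1 21 rfl, h21]
        · rw [hf4.2 14 rfl, hf3.2 14 rfl, hf.2 14 rfl]; simp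
        · rintro s5 - ⟨h5, h6⟩
          refine ⟨h5.congr ?_ (by simp) (by simp) (by simp) (by simp) (by simp), by simpa using h6⟩
          rintro (x | x)
          · simp
          · by_cases hp : x.1 ∈ G.copied r <;>
              simp only [inr_mem_sumSet, Set.mem_insert_iff, Sum.inr.injEq, Prod.ext_iff,
                Fin.ext_iff, hp, true_and, false_and, and_false, false_or] <;> omega
      · rintro s4 - ⟨⟨h3, -⟩, -⟩
        refine h3.congr ?_ (by simp) (by simp) (by simp) (by simp) (by simp)
        rintro (x | x)
        · simp
        · have : (x.1 : ℕ) = j → x.1 ∈ G.copied r := fun h => by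
            have : x.1 = ⟨j, hj⟩ := Fin.ext h
            rw [this]; exact hR
          simp only [inr_mem_sumSet]
          by_cases hxj : (x.1 : ℕ) = j
          · simp [this hxj, hxj]
          · simp only [hxj, false_and, or_false, Nat.lt_succ_iff_lt_or_eq]
    · have hR := fun h => hb (hc.2 h)
      refine Ter.exec rfl (by simp [Prog.cost]) ?_
      simp only [Prog.exec]
      refine hI.congr ?_ (by simp) (by simp) (by simp) (by simp) (by simp)
      rintro (x | x)
      · simp
      · have : (x.1 : ℕ) = j → x.1 ∉ G.copied r := fun h => by
          have : x.1 = ⟨j, hj⟩ := Fin.ext h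
          rw [this]; exact hR
        simp only [inr_mem_sumSet]
        by_cases hxj : (x.1 : ℕ) = j
        · simp [this hxj]
        · simp only [hxj, or_false, Nat.lt_succ_iff_lt_or_eq]
  · have : ∑ j ∈ Finset.range n, ((if ∃ v ∈ G.copied r, (v : ℕ) = j then 1 else 0) *
        ((r + 1) * 200) + 40 + 12) = (G.copied r).ncard * ((r + 1) * 200) + n * 52 := by
      rw [← sum_indicator_eq_ncard, Finset.sum_mul]
      simp only [Finset.sum_add_distrib, Finset.sum_const, Finset.card_range, smul_eq_mul]
      ring
    rw [this]; omega
  · rintro s2 - ⟨h1, -⟩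
    refine h1.congr ?_ rfl rfl rfl rfl rfl
    rintro (x | x) <;> simp

end

end RealRAM

namespace WGraph

/-! ### The size of the layered graph -/

section

variable {n m : ℕ} (G : WGraph (Fin n) (Fin m)) (r : ℕ)

/-- Layer 0 is charged with all of `α`, the layers `1, …, r` only with `S`. -/
theorem ncard_layers_le {α : Type} [Finite α] (S : Set α) (p : α × ℕ → Prop)
    (h : ∀ x, p x → x.2 ≤ r ∧ (x.1 ∈ S ∨ x.2 = 0)) :
    Finite {x // p x} ∧ Nat.card {x // p x} ≤ Nat.card α + S.ncard * r := by
  have hsub : {x | p x} ⊆ (Set.univ ×ˢ {0}) ∪ (S ×ˢ ((Finset.Ioc 0 r : Finset ℕ) : Set ℕ)) := by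
    intro x hx
    obtain ⟨h1, h2⟩ := h x hx
    by_cases h0 : x.2 = 0
    · left; simp [h0]
    · right
      exact ⟨h2.resolve_right h0, by simp; omega⟩
  have hfin : ((Set.univ ×ˢ {0}) ∪ (S ×ˢ ((Finset.Ioc 0 r : Finset ℕ) : Set ℕ)) :
      Set (α × ℕ)).Finite :=
    (Set.finite_univ.prod (Set.finite_singleton 0)).union
      ((Set.toFinite S).prod (Finset.finite_toSet _))
  refine ⟨(hfin.subset hsub).to_subtype, ?_⟩
  refine (Set.ncard_le_ncard hsub hfin).trans ((Set.ncard_union_le _ _).trans ?_)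
  rw [Set.ncard_prod, Set.ncard_prod, Set.ncard_coe_finset]
  simp [Set.ncard_univ]

theorem card_lVertex_le : Finite (G.LVertex r) ∧
    Nat.card (G.LVertex r) ≤ n + (G.copied r).ncard * r := by
  have := ncard_layers_le r (G.copied r) (fun x : Fin n × ℕ => x.2 ≤ r ∧
    (x.1 ∈ G.copied r ∨ x.2 = 0)) fun x hx => hx
  rw [Nat.card_fin] at this
  exact this

theorem card_lCopy_le : Finite (G.LCopy r) ∧
    Nat.card (G.LCopy r) ≤ m + {e | G.src e ∈ G.copied r}.ncard * r := by
  have := ncard_layers_le r {e | G.src e ∈ G.copied r} (fun x : Fin m × ℕ => x.2 ≤ r ∧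
    (G.src x.1 ∈ G.copied r ∨ x.2 = 0) ∧ (x.1 ∈ G.neg → x.2 < r)) fun x hx => ⟨hx.1, hx.2.1⟩
  rw [Nat.card_fin] at this
  exact this

theorem card_lSelf_le : Finite (G.LSelf r) ∧
    Nat.card (G.LSelf r) ≤ (G.copied r).ncard * (r + 1) := by
  have hsub : {x : Fin n × ℕ | x.1 ∈ G.copied r ∧ x.2 ≤ r} ⊆
      G.copied r ×ˢ ((Finset.range (r + 1) : Finset ℕ) : Set ℕ) := by
    intro x hx
    exact ⟨hx.1, by have := hx.2; simp; omega⟩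
  have hfin : (G.copied r ×ˢ ((Finset.range (r + 1) : Finset ℕ) : Set ℕ)).Finite :=
    (Set.toFinite _).prod (Finset.finite_toSet _)
  refine ⟨(hfin.subset hsub).to_subtype, (Set.ncard_le_ncard hsub hfin).trans ?_⟩
  rw [Set.ncard_prod, Set.ncard_coe_finset]
  simp

instance : Finite (G.LCopy r) := (G.card_lCopy_le r).1

instance : Finite (G.LSelf r) := (G.card_lSelf_le r).1

variable {G r} {D : ℝ} (hm : 1 ≤ m) (hD : ∀ v, (G.outDegree v : ℝ) ≤ D * ((m : ℝ) / n))
include hm hD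

/-- Some edge exists, and its tail has out-degree at least `1`; the degree bound then forces `1 ≤ D
* (m / n)`. -/
theorem card_vertices_le : (0 : ℝ) < n ∧ (n : ℝ) ≤ D * m := by
  let e : Fin m := ⟨0, hm⟩
  have hn : (0 : ℝ) < n := by exact_mod_cast (G.src e).pos
  refine ⟨hn, ?_⟩
  have h1 : 1 ≤ G.outDegree (G.src e) := by
    rw [outDegree, Nat.one_le_iff_ne_zero, ← Nat.pos_iff_ne_zero, Set.ncard_pos]
    exact ⟨e, rfl⟩
  have h2 : (1 : ℝ) ≤ D * ((m : ℝ) / n) := le_trans (by exact_mod_cast h1) (hD (G.src e))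
  rw [mul_div_assoc', le_div_iff₀ hn] at h2
  linarith

omit hm hD in
theorem ncard_copied_le (hG : ∀ e, e ∉ G.neg → 0 ≤ G.wt e) (hr : 1 ≤ r) (h : G.IsRemote r) :
    ((G.copied r).ncard : ℝ) * r ≤ n := by
  have hr' : (0 : ℝ) < r := by exact_mod_cast hr
  have h1 : ((G.copied r).ncard : ℝ) ≤ (n : ℝ) / r := by
    refine le_trans ?_ (h.trans_eq (by rw [Nat.card_fin]))
    exact_mod_cast Set.ncard_le_ncard (G.copied_subset_reach hG r) (Set.toFinite _)
  rwa [le_div_iff₀ hr'] at h1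

/-- At most `n / r` vertices are copied and each has at most `D * (m / n)` outgoing edges; `r` times
the product is `D * m`. -/
theorem ncard_edges_copied_le (hG : ∀ e, e ∉ G.neg → 0 ≤ G.wt e) (hr : 1 ≤ r)
    (h : G.IsRemote r) : ({e | G.src e ∈ G.copied r}.ncard : ℝ) * r ≤ D * m := by
  classical
  obtain ⟨hn, hnD⟩ := card_vertices_le hm hD
  have hm' : (0 : ℝ) < m := by exact_mod_cast hm
  have hD0 : 0 ≤ D := by
    by_contra hlt
    nlinarith
  have h1 : {e | G.src e ∈ G.copied r}.ncard ≤
      ∑ v ∈ (G.copied r).toFinite.toFinset, G.outDegree v := by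
    have : {e | G.src e ∈ G.copied r} =
        (((G.copied r).toFinite.toFinset.biUnion fun v => Finset.univ.filter fun e => G.src e = v :
          Finset (Fin m)) : Set (Fin m)) := by
      ext e; simp
    rw [this, Set.ncard_coe_finset]
    refine Finset.card_biUnion_le.trans (Finset.sum_le_sum fun v _ => ?_)
    rw [outDegree, ← Set.ncard_coe_finset]
    simp
  have h2 : ({e | G.src e ∈ G.copied r}.ncard : ℝ) ≤ (G.copied r).ncard * (D * ((m : ℝ) / n)) := by
    refine le_trans (Nat.cast_le.2 h1) ?_
    push_cast
    refine (Finset.sum_le_card_nsmul _ _ _ fun v _ => hD v).trans_eq ?_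
    rw [nsmul_eq_mul, Set.ncard_eq_toFinset_card _ (Set.toFinite _)]
  have hr' : (0 : ℝ) < r := by exact_mod_cast hr
  calc ({e | G.src e ∈ G.copied r}.ncard : ℝ) * r
      ≤ ((G.copied r).ncard * (D * ((m : ℝ) / n))) * r := by gcongr
    _ = ((G.copied r).ncard * r) * (D * ((m : ℝ) / n)) := by ring
    _ ≤ n * (D * ((m : ℝ) / n)) := by
        refine mul_le_mul_of_nonneg_right (ncard_copied_le hG hr h) ?_
        positivity
    _ = D * m := by field_simp

end

end WGraph

namespace RealRAM

/-! ### The complete algorithm -/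

/-- Store the layered graph in the arrays `5, …, 8` and `2`. -/
def buildLayered : Prog :=
  buildIds ;; assign 40 (.const 0) ;; buildCopies ;; buildSelf ;;
  .iset 5 (.const 0) (var 39) ;; .iset 5 (.const 1) (var 40)

section

variable {n m : ℕ} {G : WGraph (Fin n) (Fin m)} {r : ℕ} {s : State}

/-- The program deals in raw pairs and table positions; here these are matched with the vertices,
edges and weights of `G.layered r`. -/
theorem exists_stores (hr : 1 ≤ r) {N M : ℕ} (h0 : s.ints 5 0 = N) (h1 : s.ints 5 1 = M)
    (hid : Set.BijOn (idOf n s) {x | x.2 ≤ r ∧ (x.1 ∈ G.copied r ∨ x.2 = 0)} (Set.Iio N))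
    (hz : ∀ v < n, s.ints 38 v = v)
    (htab : ∀ j ≤ r, ∀ v : Fin n, s.reals 13 (j * n + v) = G.superDist j v)
    (hB : Emitted (posTail G) (posHead G r) (baseWt G) (s.ints 38) (s.reals 13)
      (sumSet (fun x => x.2 < copies G r x.1) (fun x => x.1 ∈ G.copied r ∧ x.2 < r + 1))
      (s.ints 6) (s.ints 7) (s.ints 8) (s.reals 2) M) :
    ∃ (ν : G.LVertex r ≃ Fin N) (ε : (G.LCopy r ⊕ G.LSelf r) ≃ Fin M),
      (∀ v : Fin n, (ν (G.layerZero r v) : ℕ) = v) ∧ Stores s 5 2 (G.layered r) ν ε := by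
  classical
  obtain ⟨ν, hν⟩ := exists_equiv_of_bijOn hid (β := G.LVertex r) Subtype.val
    Subtype.val_injective fun x => ⟨fun h => ⟨⟨x, h⟩, rfl⟩, by rintro ⟨y, rfl⟩; exact y.2⟩
  obtain ⟨f, hf, hE⟩ := hB
  let g : G.LCopy r ⊕ G.LSelf r → (Fin m × ℕ) ⊕ (Fin n × ℕ) := Sum.map Subtype.val Subtype.val
  have hg : ∀ x, x ∈ sumSet (fun x => x.2 < copies G r x.1)
      (fun x => x.1 ∈ G.copied r ∧ x.2 < r + 1) ↔ ∃ b, g b = x := by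
    rintro (⟨e, j⟩ | ⟨u, j⟩)
    -- The layers that `e` may leave form an initial segment. A negative edge whose tail is not
    -- copied still has its copy in layer 0 because `r ≥ 1`.
    · have : j < copies G r e ↔ (j ≤ r ∧ (G.src e ∈ G.copied r ∨ j = 0) ∧ (e ∈ G.neg → j < r)) := by
        rw [copies]
        split_ifs with h1 h2
        · simp only [h1, h2, true_or, true_and, true_imp_iff]; omega
        · simp only [h1, h2, true_or, false_imp_iff, and_true]; omega
        · simp only [h1, false_or]
          constructor
          · intro h; exact ⟨by omega, by omega, fun _ => by omega⟩
          · intro h; omega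
      rw [inl_mem_sumSet, this]
      constructor
      · intro h; exact ⟨Sum.inl ⟨(e, j), h⟩, rfl⟩
      · rintro ⟨b | b, hb⟩
        · obtain ⟨b, hb'⟩ := b
          have hb : b = (e, j) := Sum.inl.inj hb
          subst hb; exact hb'
        · exact absurd hb (Sum.inr_ne_inl (a := (e, j)) (b := b.1))
    · rw [inr_mem_sumSet]
      constructor
      · intro h; exact ⟨Sum.inr ⟨(u, j), h.1, Nat.lt_succ_iff.1 h.2⟩, rfl⟩
      · rintro ⟨b | b, hb⟩
        · exact absurd hb (Sum.inl_ne_inr (a := b.1) (b := (u, j)))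
        · obtain ⟨b, hb1, hb2⟩ := b
          have hb : b = (u, j) := Sum.inr.inj hb
          subst hb; exact ⟨hb1, Nat.lt_succ_iff.2 hb2⟩
  obtain ⟨ε, hε⟩ := exists_equiv_of_bijOn hf g
    (Sum.map_injective.2 ⟨Subtype.val_injective, Subtype.val_injective⟩) hg
  have hsrc : ∀ b, posTail G (g b) = (G.lSrc r b).1.2 * n + (G.lSrc r b).1.1 := by
    rintro (b | b) <;> rfl
  have hdst : ∀ b, posHead G r (g b) = (G.lDst r b).1.2 * n + (G.lDst r b).1.1 := by
    rintro (b | b)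
    · show posHead G r (Sum.inl b.1) = (G.copyHead r b).1.2 * n + (G.copyHead r b).1.1
      simp only [posHead, WGraph.copyHead]
      split_ifs <;> ring
    · show posHead G r (Sum.inr b.1) = (G.selfHead r b).1.2 * n + (G.selfHead r b).1.1
      simp only [posHead, WGraph.selfHead]
      split_ifs <;> ring
  have hbase : ∀ b, baseWt G (g b) = G.lBase r b := by rintro (b | b) <;> rfl
  have hwt : ∀ b, baseWt G (g b) + s.reals 13 (posTail G (g b)) - s.reals 13 (posHead G r (g b)) =
      G.lWt r b := by
    intro b
    rw [hsrc, hdst, hbase, htab _ (G.lSrc r b).2.1, htab _ (G.lDst r b).2.1]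
    rfl
  have hE' := fun b => hE (g b) ((hg _).2 ⟨b, rfl⟩)
  refine ⟨ν, ε, fun v => ?_, h0, h1, fun b => ?_, fun b => ?_, fun b => ?_, fun b => ?_⟩
  · rw [hν]
    simpa [idOf, WGraph.layerZero] using hz v v.2
  · rw [hε, hν, (hE' b).1, hsrc]; rfl
  · rw [hε, hν, (hE' b).2.1, hdst]; rfl
  · rw [hε, (hE' b).2.2.2, hwt]; rfl
  · rw [hε, (hE' b).2.2.1, hwt]; rfl

theorem buildLayered_spec (h : Tables G r s) (hG : ∀ e, e ∉ G.neg → 0 ≤ G.wt e) (hr : 1 ≤ r) :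
    Ter buildLayered s (n * 300 + m * 400 + (G.copied r).ncard * ((r + 1) * 300) +
        {e | G.src e ∈ G.copied r}.ncard * (r * 200) + 100) fun s' =>
      ∃ (N M : ℕ) (ν : G.LVertex r ≃ Fin N) (ε : (G.LCopy r ⊕ G.LSelf r) ≃ Fin M),
        (∀ v : Fin n, (ν (G.layerZero r v) : ℕ) = v) ∧ Stores s' 5 2 (G.layered r) ν ε := by
  set X := {e | G.src e ∈ G.copied r}.ncard
  set Y := (G.copied r).ncard
  have hY : Y * ((r + 1) * 300) = Y * ((r + 1) * 200) + Y * (r * 60) + Y * (r * 40 + 100) := by ring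
  refine ((buildIds_spec h hG).seq
    (T' := n * 60 + m * 400 + Y * ((r + 1) * 200) + X * (r * 200) + 50) ?_).mono (by simp only [X, Y] at hY ⊢; omega)
    fun _ _ h => h
  rintro s1 hf1 ⟨h1, h2⟩
  have hT1 := h.frame hf1 rfl rfl
  refine (Ter.seq (T := 5) (Q := fun s2 => s2 = s1.setInt 40 0 0) (Ter.exec rfl (by decide) rfl)
    (T' := n * 60 + m * 400 + Y * ((r + 1) * 200) + X * (r * 200) + 45) ?_).mono (by simp only [X, Y] at hY ⊢; omega)
    fun _ _ h => h
  rintro s2 hf2 rfl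
  have hT2 := hT1.frame hf2 rfl rfl
  refine ((buildCopies_spec hT2 hG ⟨fun _ => 0, by simp, by simp⟩).seq
    (T' := n * 60 + Y * ((r + 1) * 200) + 36) ?_).mono (by simp only [X, Y] at hY ⊢; omega) fun _ _ h => h
  intro s3 hf3 h3
  have hT3 := hT2.frame hf3 rfl rfl
  rw [← hf3.1 38 rfl, ← hf3.2 13 rfl] at h3
  refine ((buildSelf_spec hT3 hG h3).seq (T' := 16) ?_).mono (by simp only [Y] at hY ⊢; omega) fun _ _ h => h
  intro s4 hf4 h4
  have hT4 := hT3.frame hf4 rfl rfl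
  rw [← hf4.1 38 rfl, ← hf4.2 13 rfl] at h4
  have e38 : s4.ints 38 = s1.ints 38 := by rw [hf4.1 38 rfl, hf3.1 38 rfl]; simp
  have e39 : s4.ints 39 = s1.ints 39 := by rw [hf4.1 39 rfl, hf3.1 39 rfl]; simp
  refine Ter.exec rfl (by decide) ?_
  refine ⟨s4.ints 39 0, s4.ints 40 0, exists_stores hr ?_ ?_ ?_ ?_ ?_ ?_⟩
  · simp [Prog.exec, IExpr.eval, eval_var]
  · simp [Prog.exec, IExpr.eval, eval_var]
  · rw [e39]
    refine bijOn_congr h1 (fun x => ?_) (fun x => Iff.rfl) rfl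
    simp [Prog.exec, IExpr.eval, eval_var, idOf, e38]
  · simpa [Prog.exec, IExpr.eval, eval_var, e38] using h2
  · simpa [Prog.exec, IExpr.eval, eval_var] using hT4.tab
  · simpa [Prog.exec, IExpr.eval, eval_var, Built] using h4

theorem Stores.frame {V E : Type} {N M : ℕ} {H : WGraph V E} {ν : V ≃ Fin N} {ε : E ≃ Fin M}
    {p : Prog} {s' : State} (h : Stores s 5 2 H ν ε) (hf : Frame p s s')
    (hp : (p.wi 5 || p.wi 6 || p.wi 7 || p.wi 8 || p.wr 2) = false) : Stores s' 5 2 H ν ε := by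
  simp only [Bool.or_eq_false_iff] at hp
  obtain ⟨⟨⟨⟨h0, h1⟩, h2⟩, h3⟩, h4⟩ := hp
  obtain ⟨k0, k1, k2, k3, k4, k5⟩ := h
  exact ⟨by rwa [hf.1 _ h0], by rwa [hf.1 _ h0], by rwa [hf.1 (5 + 1) h1], by rwa [hf.1 (5 + 2) h2],
    by rwa [hf.1 (5 + 3) h3], by rwa [hf.2 _ h4]⟩

/-- Build the layered graph of the input. -/
def prepare : Prog :=
  copyGraph 0 0 ;; assign 30 (.load 0 (.const 2)) ;; assign 33 ((var 30).add (.const 1)) ;;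
  levels ;; countNeg ;; buildLayered

/-- The complete algorithm. -/
def hopReduction : Prog := prepare ;; copyGraph 5 2 ;; iterate ;; finish

/-- The time of one round on a graph with `n` vertices and `m` edges. -/
def roundTime (n m : ℕ) : ℕ := (n + m) * (160 * Nat.size n + 700)

/-- The time for building the layered graph, where `Y` vertices are copied and `X` edges leave
them. -/
def prepareTime (n m r X Y : ℕ) : ℕ :=
  (r + 1) * (roundTime n m + n * 30 + 120) +
    (n * 330 + m * 510 + Y * ((r + 1) * 300) + X * (r * 200) + 250)

/-- The time for solving the problem in the layered graph with `N` vertices and `M` edges. -/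
def solveTime (n m r k N M : ℕ) : ℕ :=
  (k / r + 1) * (roundTime N M + 100) + (n * 30 + m * 60 + M * 60 + N * 30 + 150)

theorem prepare_spec (hm : 1 ≤ m) (hr : 1 ≤ r) (hG : ∀ e, e ∉ G.neg → 0 ≤ G.wt e) :
    Ter prepare (inputState G r) (prepareTime n m r {e | G.src e ∈ G.copied r}.ncard
        (G.copied r).ncard) fun s =>
      (∃ (N M : ℕ) (ν : G.LVertex r ≃ Fin N) (ε : (G.LCopy r ⊕ G.LSelf r) ≃ Fin M),
        (∀ v : Fin n, (ν (G.layerZero r v) : ℕ) = v) ∧ Stores s 5 2 (G.layered r) ν ε) ∧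
      s.ints 30 0 = r ∧ s.ints 35 0 = G.neg.ncard := by
  have hn : 0 < n := (G.src ⟨0, hm⟩).pos
  set X := {e | G.src e ∈ G.copied r}.ncard
  set Y := (G.copied r).ncard
  set Z := (r + 1) * (roundTime n m + n * 30 + 120) with hZ
  set U := Y * ((r + 1) * 300) + X * (r * 200) with hU
  have hT : prepareTime n m r X Y = Z + (n * 330 + m * 510 + U + 250) := by
    rw [prepareTime, ← hZ, hU]; ring
  rw [hT]
  refine ((copyGraph_spec (Or.inl ⟨rfl, rfl⟩) (stores_inputState G r)).seq
    (T' := Z + (n * 330 + m * 450 + U + 220)) ?_).mono (by omega) fun _ _ h => h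
  intro s1 hf1 hR1
  refine (Ter.seq (T := 5) (Q := fun s2 => s2 = s1.setInt 30 0 r) (Ter.exec rfl (by decide) ?_)
    (T' := Z + (n * 330 + m * 450 + U + 210)) ?_).mono (by omega) fun _ _ h => h
  · simp only [assign, Prog.exec, IExpr.eval, hf1.1 0 rfl]; rfl
  rintro s2 hf2 rfl
  have hR2 := hR1.frame hf2 rfl
  refine (Ter.seq (T := 10) (Q := fun s3 => s3 = (s1.setInt 30 0 r).setInt 33 0 (r + 1))
    (Ter.exec rfl (by decide) ?_)
    (T' := Z + (n * 330 + m * 450 + U + 200)) ?_).mono (by omega) fun _ _ h => h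
  · simp [assign, Prog.exec, IExpr.eval, eval_var]
  rintro s3 hf3 rfl
  have hR3 := hR2.frame hf3 rfl
  refine ((levels_spec (r := r) hR3 hG hn (by simp)).seq
    (T' := n * 300 + m * 450 + U + 130) ?_).mono ?_ fun _ _ h => h
  · rintro s4 hf4 ⟨h34, htab⟩
    have hT4 : Tables G r s4 := by
      refine ⟨hR3.frame hf4 rfl, ?_, ?_, h34, htab⟩
      · rw [hf4.1 30 rfl]; simp
      · rw [hf4.1 33 rfl]; simp
    refine ((countNeg_spec hT4.rep).seq (T' := n * 300 + m * 400 + U + 110) ?_).mono (by omega)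
      fun _ _ h => h
    intro s5 hf5 h5
    have hT5 := hT4.frame hf5 rfl rfl
    refine (buildLayered_spec hT5 hG hr).mono (by simp only [X, Y] at hU ⊢; omega) fun s6 hf6 h6 => ⟨h6, ?_, ?_⟩
    · rw [hf6.1 30 rfl, hT5.h30]
    · rw [hf6.1 35 rfl, h5]
  · have : Z = (r + 1) * ((n + m) * (160 * Nat.size n + 700) + n * 30 + 120) := rfl
    omega

/-- A passed test certifies the prices by itself. If there were no negative cycle, the labels of
layer 0 after `q` rounds with `|N| ≤ q * r` would be the `|N|`-hop distances of `G`, which satisfy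
every edge; so a failed test proves that a negative cycle exists. -/
theorem solve_spec {N M : ℕ} {ν : G.LVertex r ≃ Fin N} {ε : (G.LCopy r ⊕ G.LSelf r) ≃ Fin M}
    (hm : 1 ≤ m) (hr : 1 ≤ r) (hG : ∀ e, e ∉ G.neg → 0 ≤ G.wt e)
    (hf : Frame prepare (inputState G r) s) (hS : Stores s 5 2 (G.layered r) ν ε)
    (hν : ∀ v : Fin n, (ν (G.layerZero r v) : ℕ) = v) (h30 : s.ints 30 0 = r)
    (h35 : s.ints 35 0 = G.neg.ncard) :
    Ter (copyGraph 5 2 ;; iterate ;; finish) s (solveTime n m r G.neg.ncard N M) fun s' =>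
      (verdict s' = 1 ∧ G.HasNegativeCycle) ∨
        (verdict s' = 0 ∧ G.IsValid (price s' n) ∧ G.EliminatesAll (price s' n)) := by
  have hn : 0 < n := (G.src ⟨0, hm⟩).pos
  have hN : 0 < N := (ν (G.layerZero r ⟨0, hn⟩)).pos
  set k := G.neg.ncard with hk
  set Z := (k / r + 1) * (roundTime N M + 100) with hZ
  have hT : solveTime n m r k N M = Z + (n * 30 + m * 60 + M * 60 + N * 30 + 150) := rfl
  rw [hT]
  refine ((copyGraph_spec (Or.inr ⟨rfl, rfl⟩) hS).seq
    (T' := Z + (n * 30 + m * 60 + N * 30 + 100)) ?_).mono (by omega) fun _ _ h => h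
  intro s1 hf1 hR1
  refine ((iterate_spec (r := r) (k := k) hR1 (G.layered_nonneg r) hN ?_ hr ?_).seq
    (T' := n * 30 + m * 60 + 50) ?_).mono ?_ fun _ _ h => h
  · rw [hf1.1 30 rfl, h30]
  · rw [hf1.1 35 rfl, h35]
  · rintro s2 hf2 ⟨q, hq, hd⟩
    have e0 : s2.ints 0 = (inputState G r).ints 0 := by rw [hf2.1 0 rfl, hf1.1 0 rfl, hf.1 0 rfl]
    have e1 : s2.ints 1 = (inputState G r).ints 1 := by rw [hf2.1 1 rfl, hf1.1 1 rfl, hf.1 1 rfl]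
    have e2 : s2.ints 2 = (inputState G r).ints 2 := by rw [hf2.1 2 rfl, hf1.1 2 rfl, hf.1 2 rfl]
    have er : s2.reals 0 = (inputState G r).reals 0 := by
      rw [hf2.2 0 rfl, hf1.2 0 rfl, hf.2 0 rfl]
    have hin := stores_inputState G r
    refine (finish_spec (n := n) (m := m) ?_ ?_).mono le_rfl ?_
    · rw [e0]; exact hin.vertices
    · rw [e0]; exact hin.edges
    rintro s3 - ⟨h3, h4⟩
    rw [er, e1, e2] at h4
    have hp : ∀ v : Fin n, price s3 n v = (G.layered r).superDist q (G.layerZero r v) := by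
      intro v
      rw [← hd, hν, ← h3 v v.2]; rfl
    have hw : ∀ e : Fin m, (inputState G r).reals 0 e +
        s3.reals 1 ((inputState G r).ints 1 e) - s3.reals 1 ((inputState G r).ints 2 e) =
        (G.reweight (price s3 n)).wt e := by
      intro e
      have t1 := hin.tail e
      have t2 := hin.head e
      have t3 := hin.weight e
      simp only [Equiv.refl_apply, zero_add] at t1 t2 t3
      rw [t1, t2, t3]; rfl
    rcases h4 with ⟨h4, e, he, h5⟩ | ⟨h4, h5⟩
    · left
      refine ⟨h4, ?_⟩
      by_contra hc
      have h6 := hw ⟨e, he⟩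
      simp only at h6
      rw [h6] at h5
      simp only [WGraph.reweight, hp, G.superDist_layered_of_no_cycle r hG hr hc hq] at h5
      linarith [G.superDist_feasible_of_no_cycle hG hc ⟨e, he⟩]
    · right
      have h6 : ∀ e, 0 ≤ (G.reweight (price s3 n)).wt e := fun e => by
        rw [← hw]; exact h5 e e.2
      exact ⟨h4, fun e _ => h6 e, fun e _ => h6 e⟩
  · have : Z = (k / r + 1) * ((N + M) * (160 * Nat.size N + 700) + 100) := rfl
    omega

/-- The two runs are composed by hand rather than by `Ter.seq`, because `N` and `M`, on which the
time bound depends, are only produced by the postcondition of `prepare`. -/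
theorem hopReduction_spec (hm : 1 ≤ m) (hr : 1 ≤ r) (hG : ∀ e, e ∉ G.neg → 0 ≤ G.wt e) :
    ∃ (N M : ℕ) (ν : G.LVertex r ≃ Fin N) (ε : (G.LCopy r ⊕ G.LSelf r) ≃ Fin M),
      (∀ v : Fin n, (ν (G.layerZero r v) : ℕ) = v) ∧
      Ter hopReduction (inputState G r) (prepareTime n m r {e | G.src e ∈ G.copied r}.ncard
          (G.copied r).ncard + solveTime n m r G.neg.ncard N M) fun s =>
        Stores s 5 2 (G.layered r) ν ε ∧
        ((verdict s = 1 ∧ G.HasNegativeCycle) ∨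
          (verdict s = 0 ∧ G.IsValid (price s n) ∧ G.EliminatesAll (price s n))) := by
  obtain ⟨t, s, h1, h2, ⟨N, M, ν, ε, h3, h4⟩, h5, h6⟩ := prepare_spec (r := r) hm hr hG
  obtain ⟨t', s', h7, h8, h9⟩ := solve_spec hm hr hG h1.frame h4 h3 h5 h6
  exact ⟨N, M, ν, ε, h3, t + t', s', Run.seq h1 h7, Nat.add_le_add h2 h8, h4.frame h7.frame rfl, h9⟩

end

/-! ### The running time -/

theorem size_le_log {x : ℕ} {b : ℝ} (hx : 1 ≤ x) (hb : (x : ℝ) ≤ b) :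
    (Nat.size x : ℝ) ≤ 1 + 2 * Real.log b := by
  have h1 : Nat.size x ≤ Nat.log 2 x + 1 := Nat.size_le.2 (Nat.lt_pow_succ_log_self (by norm_num) x)
  have h2 : ((Nat.log 2 x : ℕ) : ℝ) ≤ Real.logb 2 x := Real.natLog_le_logb x 2
  have h3 : Real.logb 2 x ≤ 2 * Real.log x := by
    rw [Real.logb, div_le_iff₀ (Real.log_pos (by norm_num))]
    have := Real.log_two_gt_d9
    have h4 : 0 ≤ Real.log x := Real.log_nonneg (by exact_mod_cast hx)
    nlinarith
  have h4 : Real.log x ≤ Real.log b := Real.log_le_log (by exact_mod_cast hx) hb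
  have h5 : (Nat.size x : ℝ) ≤ Nat.log 2 x + 1 := by exact_mod_cast h1
  linarith

/-- With `L = log (g + 2)`, the logarithmic factor is at most `160 * (1 + 2 * (2 * E + L)) + 700`,
and `E, L ≥ 1` turn this into `(860 + 640 + 320) * (E * L) = 1820 * (E * L)`. -/
theorem roundTime_le {x y m : ℕ} {E A B g : ℝ} (hE : 1 ≤ E) (hm : 1 ≤ m) (hmg : (m : ℝ) ≤ g)
    (hx : 1 ≤ x) (hxE : (x : ℝ) ≤ 2 * E * m) (hxy : (x : ℝ) + y ≤ B * (E * m)) (hB : 0 ≤ B)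
    (hA : A = E ^ 2 * Real.log (g + 2) * m) : (roundTime x y : ℝ) ≤ B * 1820 * A := by
  have hm' : (1 : ℝ) ≤ m := by exact_mod_cast hm
  have hL : 1 ≤ Real.log (g + 2) := by
    rw [Real.le_log_iff_exp_le (by linarith)]
    have := Real.exp_one_lt_d9
    linarith
  set L := Real.log (g + 2) with hLdef
  have h1 : Real.log (2 * E * m) ≤ 2 * E + L := by
    rw [Real.log_mul (by positivity) (by positivity)]
    have h2 : Real.log (2 * E) ≤ 2 * E := (Real.log_le_self (by positivity))
    have h3 : Real.log m ≤ L := Real.log_le_log (by linarith) (by linarith)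
    linarith
  have h2 := size_le_log hx hxE
  have h3 : (160 * (Nat.size x : ℝ) + 700) ≤ 1820 * (E * L) := by
    have h4 : E ≤ E * L := le_mul_of_one_le_right (by linarith) hL
    have h5 : L ≤ E * L := le_mul_of_one_le_left (by linarith) hE
    nlinarith
  rw [roundTime]
  push_cast
  calc ((x : ℝ) + y) * (160 * (Nat.size x : ℝ) + 700)
      ≤ (B * (E * m)) * (1820 * (E * L)) := by
        refine mul_le_mul hxy h3 (by positivity) (by positivity)
    _ = B * 1820 * A := by rw [hA]; ring

/-- The `r + 1` rounds on `G` and at most `k / r + 1` rounds on `H`, both graphs of size `O(E * m)`,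
dominate everything else; `50000` leaves ample slack. -/
theorem totalTime_le {n m r k X Y N M : ℕ} {E : ℝ} (hE : 1 ≤ E) (hm : 1 ≤ m) (hr : 1 ≤ r)
    (hn : 1 ≤ n) (hN : 1 ≤ N) (hnE : (n : ℝ) ≤ E * m) (hY : (Y : ℝ) * r ≤ n)
    (hX : (X : ℝ) * r ≤ E * m) (hNY : N ≤ n + Y * r) (hM : M ≤ m + X * r + Y * (r + 1)) :
    ((prepareTime n m r X Y + solveTime n m r k N M : ℕ) : ℝ) ≤
      50000 * E ^ 2 * (hopReductionCost k r m * Real.log (hopReductionCost k r m + 2)) := by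
  have hr' : (1 : ℝ) ≤ r := by exact_mod_cast hr
  have hm' : (1 : ℝ) ≤ m := by exact_mod_cast hm
  have hn' : (1 : ℝ) ≤ n := by exact_mod_cast hn
  set g := hopReductionCost k r m with hg
  have hg' : g = (k : ℝ) / r * m + r * m := rfl
  have hmg : (m : ℝ) ≤ g := by
    rw [hg']
    have : (0 : ℝ) ≤ (k : ℝ) / r * m := by positivity
    nlinarith
  have hL : 1 ≤ Real.log (g + 2) := by
    rw [Real.le_log_iff_exp_le (by linarith)]
    have := Real.exp_one_lt_d9
    linarith
  set L := Real.log (g + 2) with hLdef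
  set a := E ^ 2 * L * m with ha
  have hEm : E * m ≤ a := by
    have : E * 1 ≤ E * (E * L) := by
      refine mul_le_mul_of_nonneg_left ?_ (by linarith)
      nlinarith
    rw [ha]
    nlinarith
  have hmE : (m : ℝ) ≤ E * m := le_mul_of_one_le_left (by linarith) hE
  have hNY' : (N : ℝ) ≤ n + Y * r := by exact_mod_cast hNY
  have hM' : (M : ℝ) ≤ m + X * r + Y * (r + 1) := by exact_mod_cast hM
  have hY1 : (Y : ℝ) * (r + 1) ≤ 2 * n := by nlinarith [Nat.cast_nonneg (α := ℝ) Y]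
  have hR1 : (roundTime n m : ℝ) ≤ 2 * 1820 * a :=
    roundTime_le hE hm hmg hn (by nlinarith) (by linarith) (by norm_num) ha
  -- The factor `6` comes from `N ≤ 2 * n ≤ 2 * E * m` and `M ≤ m + E * m + 2 * n ≤ 4 * E * m`.
  have hR2 : (roundTime N M : ℝ) ≤ 6 * 1820 * a :=
    roundTime_le hE hm hmg hN (by nlinarith) (by linarith) (by norm_num) ha
  have hk : ((k / r : ℕ) : ℝ) ≤ (k : ℝ) / r := Nat.cast_div_le
  have ha0 : 1 ≤ a := by linarith
  have hra : a ≤ r * a := le_mul_of_one_le_left (by linarith) hr'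
  -- Here `3790 = 2 * 1820 + 30 + 120`, and below `11020 = 6 * 1820 + 100`; the lower-order terms
  -- are absorbed by `n ≤ a` and `1 ≤ a`.
  have h1 : ((r : ℝ) + 1) * (roundTime n m + n * 30 + 120) ≤ (r + 1) * (3790 * a) :=
    mul_le_mul_of_nonneg_left (by linarith) (by linarith)
  have h2 : (((k / r : ℕ) : ℝ) + 1) * (roundTime N M + 100) ≤ ((k : ℝ) / r + 1) * (11020 * a) := by
    refine mul_le_mul (by linarith) (by linarith) (by positivity) (by positivity)
  have hfin : g * L * E ^ 2 = (k : ℝ) / r * a + r * a := by rw [hg', ha]; ring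
  have hka : 0 ≤ (k : ℝ) / r * a := by positivity
  rw [prepareTime, solveTime]
  push_cast
  nlinarith

end RealRAM

/-! ### Assembly of the theorem -/

theorem mainTheorem3 :
    ∃ (P : RealRAM.Prog) (c : ℕ), ∀ D : ℝ, ∃ C : ℝ,
      ∀ (n m r : ℕ) (G : WGraph (Fin n) (Fin m)),
        1 ≤ r → 1 ≤ m →
        (∀ v, (G.outDegree v : ℝ) ≤ D * ((m : ℝ) / n)) →
        (∀ e, e ∉ G.neg → 0 ≤ G.wt e) →
        G.IsRemote r →
        ∃ (t : ℕ) (s : RealRAM.State),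
          RealRAM.Run P (RealRAM.inputState G r) t s ∧
          (t : ℝ) ≤ C * (hopReductionCost G.neg.ncard r m *
            Real.log (hopReductionCost G.neg.ncard r m + 2) ^ c) ∧
          ((RealRAM.verdict s = 1 ∧ G.HasNegativeCycle) ∨
            (RealRAM.verdict s = 0 ∧ G.IsValid (RealRAM.price s n) ∧
              G.EliminatesAll (RealRAM.price s n))) ∧
          WGraph.IsHopReduction r G (G.layered r) (G.layerZero r) ∧
          ∃ (N M : ℕ) (ν : G.LVertex r ≃ Fin N)
            (ε : (G.LCopy r ⊕ G.LSelf r) ≃ Fin M),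
            ((N : ℝ) + M ≤ C * m) ∧
            (∀ v : Fin n, (ν (G.layerZero r v) : ℕ) = v) ∧
            RealRAM.Stores s 5 2 (G.layered r) ν ε := by
  -- Replacing `D` by `max D 1` provides `E ≥ 1`, which the estimates of the logarithms need. The
  -- same constant covers the size of `H`, which is at most `6 * (E * m)`.
  refine ⟨RealRAM.hopReduction, 1, fun D => ⟨50000 * max D 1 ^ 2, ?_⟩⟩
  intro n m r G hr hm hD hG hrem
  set E := max D 1 with hE
  have hE1 : 1 ≤ E := le_max_right _ _
  have hm' : (1 : ℝ) ≤ m := by exact_mod_cast hm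
  have hr' : (1 : ℝ) ≤ r := by exact_mod_cast hr
  have hDE : D * m ≤ E * m := mul_le_mul_of_nonneg_right (le_max_left _ _) (by linarith)
  obtain ⟨N, M, ν, ε, h0, t, s, h1, h2, h3, h4⟩ := RealRAM.hopReduction_spec (r := r) hm hr hG
  obtain ⟨hn, hnD⟩ := WGraph.card_vertices_le hm hD
  have hY := WGraph.ncard_copied_le hG hr hrem
  have hX := WGraph.ncard_edges_copied_le hm hD hG hr hrem
  have hN : N = Nat.card (G.LVertex r) := by rw [Nat.card_congr ν, Nat.card_fin]
  have hM : M = Nat.card (G.LCopy r) + Nat.card (G.LSelf r) := by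
    rw [← Nat.card_sum, Nat.card_congr ε, Nat.card_fin]
  have hN' := hN.trans_le (G.card_lVertex_le r).2
  have hM' := hM.trans_le (Nat.add_le_add (G.card_lCopy_le r).2 (G.card_lSelf_le r).2)
  have hn1 : 1 ≤ n := by exact_mod_cast hn
  have hN1 : 1 ≤ N := (ν (G.layerZero r ⟨0, hn1⟩)).pos
  refine ⟨t, s, h1, ?_, h4, G.isHopReduction_layered r hG hr, N, M, ν, ε, ?_, h0, h3⟩
  · rw [pow_one]
    refine le_trans (Nat.cast_le.2 h2) ?_
    exact RealRAM.totalTime_le hE1 hm hr hn1 hN1 (hnD.trans hDE) hY (hX.trans hDE) hN' hM'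
  · have hN2 : (N : ℝ) ≤ n + (G.copied r).ncard * r := by exact_mod_cast hN'
    have hM2 : (M : ℝ) ≤ m + {e | G.src e ∈ G.copied r}.ncard * r +
      (G.copied r).ncard * (r + 1) := by exact_mod_cast hM'
    have hY1 : ((G.copied r).ncard : ℝ) ≤ (G.copied r).ncard * r :=
      le_mul_of_one_le_right (Nat.cast_nonneg _) hr'
    have hmE : (m : ℝ) ≤ E * m := le_mul_of_one_le_left (by linarith) hE1
    have hEE : E * m ≤ E ^ 2 * m := by
      refine mul_le_mul_of_nonneg_right ?_ (by linarith)
      nlinarith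
    have : (N : ℝ) + M ≤ 6 * (E * m) := by linarith
    linarith
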